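/- **Setting.** Let $n\ge 1$, $M\ge 0$, $\mathbb T=\mathbb R/\mathbb Z$; spacetime is $\mathbb R\times\mathbb R\times\mathbb T^{n-1}$ with Cartesian coordinates $(x^0,x^1,\dots,x^n)$, $x^0=t$. Greek indices run over $0,\dots,n$, $a,j,k$ over $1,\dots,n$, $i$ over $2,\dots,n$; repeated Greek indices and repeated indices $a$ are summed. Let $L^\alpha(\Psi,v)$ be smooth real functions and $A^\alpha(\Psi,v)$ smooth symmetric $M\times M$ matrices of $(\Psi,v)\in\mathbb R\times\mathbb R^M$ with $L^0\equiv1$, $L^1(0,0)=1$, $\partial L^1/\partial\Psi\ne0$ for $|\Psi|+|v|$ small (where $|v|=\sum_J|v^J|$), and $A^0(0,0)$, $A^0(0,0)-A^1(0,0)$ positive definite. Write $L=L^\alpha\partial_\alpha$. Fix integers $N_{Top}\ge n+5$ and $N_{Mid}=\lceil N_{Top}/2\rceil+1$. Let $0<U_0\le1$ and $T_{Boot}>0$. Consider a function $u$ with $u|_{t=0}=1-x^1$, put $\mathcal M=\{0\le t<T_{Boot},\ 0\le u\le U_0\}$ and $\Sigma_t^{u'}=\{x^0=t,\ 0\le u\le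 u'\}$, and let $\Psi,v$ be smooth on $\mathcal M$ (with smooth data on $\{t=0,\ 0\le 1-x^1\le 1\}$) with $$L\Psi=0,\qquad A^\alpha\partial_\alpha v=0,\qquad Lu=0,\qquad L\vartheta^i=0\quad\text{on }\mathcal M,\qquad \vartheta^i|_{t=0}=x^i .$$ The change of variables map $\Upsilon:(t,u,\vartheta)\mapsto(x^0,\dots,x^n)$ is the inverse of $(t,u,\vartheta^2,\dots,\vartheta^n)$. Set $V_\alpha^J=\partial_\alpha v^J$, $\upmu=1/\partial_tu$, $\upxi_j=\upmu\,\partial_ju$, $\breve X=-\upmu L^a\partial_a$, $\Theta_i=\partial/\partial\vartheta^i$ (in geometric coordinates; Cartesian components $\Theta_i^j$), $\upxi_j^{(Small)}=\upxi_j+\delta_j^1$, $\Theta_i^{j,(Small)}=\Theta_i^j-\delta_i^j$, $\mathcal G=(\partial L^1/\partial\Psi)\,\upxi_1$, $\upmu_\star(t,u)=\min_{\Sigma_t^u}\upmu$, and $\mathring A_*=\sup_{t=0,\,0\le1-x^1\le1}|\min\{\mathcal G\breve X\Psi,0\}|$, where at $t=0$ the quantity $\mathcal G\breve X\Psi$ is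 expressed through the data by $\upmu=1/L^1$, $\upxi_1=-\upmu$. For $f$ on $\mathcal M$, let $\mathscr Z^{[N_1,N_2];1}f$ denote the sum of the absolute values of all strings of $N$ operators, $N_1\le N\le N_2$, from $\{L,\breve X,\Theta_2,\dots,\Theta_n\}$ with at most one factor $\breve X$, applied to $f$; $\mathscr Z_*$ denotes the sum over those strings that also contain a factor other than $\breve X$; $\mathscr P$ the sum over those without $\breve X$; $\mathscr P_*$ the sum over those without $\breve X$ that contain some $\Theta_i$ or at least two factors $L$. The superscript $\le N$ means $[0,N]$; for the arrays $v$ and $V$ one also sums over the components. **Bootstrap assumptions** with parameters $\mathring\alpha>0$, $\mathring\epsilon\ge0$, $\mathring A>0$, $\varepsilon>0$. Assume $\mathring A_*>0$, $T_{Boot}\le2\mathring A_*^{-1}$, $\upmu>0$ on $\mathcal M$, that $\Upsilon$ is a ($C^\infty$) diffeomorphism of $[0,T_{Boot})\times[0,U_0]\times\mathbb T^{n-1}$ onto $\mathcal M$, and that for all $(t,u)\in[0,T_{Boot})\times[0,U_0]$ and all $J,\alpha,i,j,k$, with $\|\cdot\|=\|\cdot\|_{L^\infty(\Sigma_t^u)}$: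 * $\|\mathscr P^{\le N_{Mid}-1}v^J\|\le\varepsilon$ and $\|\mathscr P^{\le N_{Mid}-1}V_\alpha^J\|\le\varepsilon$; * $\|\Psi\|\le\mathring\alpha+\varepsilon^{1/2}$, $\|\mathscr Z_*^{[1,N_{Mid}];1}\Psi\|\le\varepsilon^{1/2}$, $\|\breve X\Psi\|\le\mathring A+\varepsilon^{1/2}$; * $\|\mathscr Z^{\le N_{Mid}-1;1}v\|\le\varepsilon^{1/2}$ and $\|\mathscr Z^{\le N_{Mid}-1;1}V\|\le\varepsilon^{1/2}$; * $\|\upmu\|\le1+2\mathring A_*^{-1}\|\mathcal G\breve X\Psi\|_{L^\infty(\Sigma_0^u)}+\mathring\alpha^{1/2}+\varepsilon^{1/2}$, $\|L\upmu\|\le\|\mathcal G\breve X\Psi\|_{L^\infty(\Sigma_0^u)}+\varepsilon^{1/2}$, $\|\mathscr P_*^{[1,N_{Mid}-1]}\upmu\|\le\varepsilon^{1/2}$; * $\|\upxi_j^{(Small)}\|\le\mathring\alpha^{1/2}+\mathring\epsilon^{1/2}$, $\|\mathscr Z_*^{[1,N_{Mid}-1];1}\upxi_j^{(Small)}\|\le\varepsilon^{1/2}$,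 $\|\breve X\upxi_j^{(Small)}\|\le\|\breve X\upxi_j^{(Small)}\|_{L^\infty(\Sigma_0^u)}+\varepsilon^{1/2}$, $\|\mathscr Z^{\le N_{Mid}-1;1}\Theta_i^{k,(Small)}\|\le\varepsilon^{1/2}$. **Proposition.** There are $\alpha_0>0$, $\varepsilon_1>0$ and continuous increasing functions $f,g:(0,\infty)\to(0,\infty)$, depending only on $n$, $M$, $N_{Top}$ and the functions $L^\alpha,A^\alpha$, such that the following holds whenever the above assumptions hold with $\mathring\alpha<\alpha_0$, $\mathring\epsilon\le\varepsilon<\mathring\alpha$, $\varepsilon<\varepsilon_1$, $\varepsilon<f(\mathring A^{-1})$ and $\varepsilon<g(\mathring A_*)$. If $$\inf_{(t,u)\in[0,T_{Boot})\times[0,U_0]}\upmu_\star(t,u)>0,$$ then $\Upsilon$ extends to a global ($C^1$) diffeomorphism from $[0,T_{Boot}]\times[0,U_0]\times\mathbb T^{n-1}$ onto its image, and for $\alpha=0,\dots,n$ and $i=2,\dots,n$ the extension satisfies $$\Upsilon^\alpha,\ \frac{\partial}{\partial\vartheta^i}\Upsilon^\alpha\in C\big([0,T_{Boot}],W^{1,\infty}([0,U_0]\times\mathbb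 T^{n-1})\big)\cap C^1\big([0,T_{Boot}],L^\infty([0,U_0]\times\mathbb T^{n-1})\big),$$ where for the torus-valued components $\Upsilon^2,\dots,\Upsilon^n$ this is understood for real-valued lifts on a fundamental domain. -/

import Mathlib

open scoped ContDiff ENNReal
open Set MeasureTheory

namespace ShockFormation

noncomputable section

/- Conventions. The number of space dimensions is `n = d + 1 ≥ 1`. Spacetime is `ℝ × ℝ × 𝕋^d`, where
`𝕋 = ℝ / ℤ`. All calculus is done in the coordinates of the universal cover: a point of `Pt d` has
coordinates indexed by `0, 1, ..., d + 1`. In the Cartesian picture they are `(t, x¹, x², ..., xⁿ)`;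
in the geometric picture they are `(t, u, ϑ², ..., ϑⁿ)`. Index `0` is time, index `j.succ` with
`j : Fin (d + 1)` is a spatial index and index `i.succ.succ` with `i : Fin d` is a torus index. -/

/-- Coordinates on (the universal cover of) `ℝ × ℝ × 𝕋^d`. -/
abbrev Pt (d : ℕ) : Type := Fin (d + 2) → ℝ

/-- Coordinates on (the universal cover of) a time slice `ℝ × 𝕋^d`. -/
abbrev SlicePt (d : ℕ) : Type := Fin (d + 1) → ℝ

/-- The covering map onto `ℝ × ℝ × 𝕋^d`. -/
def proj {d : ℕ} (p : Pt d) : ℝ × ℝ × (Fin d → UnitAddCircle) :=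
  (p 0, p 1, fun i => ((p i.succ.succ : ℝ) : UnitAddCircle))

/-- `F` is the lift of a `C^k` diffeomorphism from the projection of `S` to `ℝ × ℝ × 𝕋^d` onto its
image: `F` is `C^k` on `S` (up to the boundary), it induces a well-defined and injective map between
subsets of `ℝ × ℝ × 𝕋^d`, and it has a `C^k` inverse on the image. -/
def IsDiffeoOntoImage {d : ℕ} (k : WithTop ℕ∞) (F : Pt d → Pt d) (S : Set (Pt d)) : Prop :=
  ContDiffOn ℝ k F S ∧
  (∀ p ∈ S, ∀ q ∈ S, proj (F p) = proj (F q) ↔ proj p = proj q) ∧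
  ∃ G : Pt d → Pt d, ContDiffOn ℝ k G (F '' S) ∧ LeftInvOn G F S

/-! ### The equations -/

/-- The nonlinearities of the system `L Ψ = 0`, `A^α ∂_α v = 0` in one unknown `Ψ` and `M` unknowns
`v`, with their structural properties. -/
structure System (d M : ℕ) where
  /-- Cartesian components `L^α(Ψ, v)`. -/
  L : Fin (d + 2) → ℝ → (Fin M → ℝ) → ℝ
  /-- The matrices `A^α(Ψ, v)`. -/
  A : Fin (d + 2) → ℝ → (Fin M → ℝ) → Matrix (Fin M) (Fin M) ℝ
  smooth_L : ∀ α, ContDiff ℝ ∞ (fun s : ℝ × (Fin M → ℝ) => L α s.1 s.2)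
  smooth_A : ∀ α I J, ContDiff ℝ ∞ (fun s : ℝ × (Fin M → ℝ) => A α s.1 s.2 I J)
  symm_A : ∀ α ψ w, (A α ψ w).IsSymm
  L_zero : ∀ ψ w, L 0 ψ w = 1
  L_one : L 1 0 0 = 1
  /-- The genuinely nonlinear-type condition. -/
  nonlinear : ∃ r > 0, ∀ (ψ : ℝ) (w : Fin M → ℝ), |ψ| + ∑ J, |w J| < r →
    deriv (fun s => L 1 s w) ψ ≠ 0
  posDef_A0 : (A 0 0 0).PosDef
  posDef_A0_sub_A1 : (A 0 0 0 - A 1 0 0).PosDef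

/-- The unknowns on a bootstrap region. All maps are total; they are meaningful only on the relevant
regions. `Ψ`, `v`, `u`, `ϑ` are functions of the Cartesian coordinates, `Υ` maps geometric
coordinates to Cartesian coordinates. -/
structure Config (d M : ℕ) where
  /-- The bootstrap time. -/
  T : ℝ
  /-- The thickness of the region in the eikonal direction. -/
  U₀ : ℝ
  Ψ : Pt d → ℝ
  v : Pt d → Fin M → ℝ
  /-- The eikonal function. -/
  u : Pt d → ℝ
  /-- The geometric torus coordinates. -/
  ϑ : Pt d → Fin d → ℝ
  /-- The change of variables map from geometric to Cartesian coordinates. -/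
  Υ : Pt d → Pt d

/-- `[0,T) × [0,U₀] × 𝕋^d` in geometric coordinates. -/
def box (d : ℕ) (T U₀ : ℝ) : Set (Pt d) :=
  {q | 0 ≤ q 0 ∧ q 0 < T ∧ 0 ≤ q 1 ∧ q 1 ≤ U₀}

/-- `[0,T] × [0,U₀] × 𝕋^d` in geometric coordinates. -/
def closedBox (d : ℕ) (T U₀ : ℝ) : Set (Pt d) :=
  {q | 0 ≤ q 0 ∧ q 0 ≤ T ∧ 0 ≤ q 1 ∧ q 1 ≤ U₀}

/-- The initial hypersurface portion `0 ≤ 1 - x¹ ≤ 1` of `t = 0`. -/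
def dataSlab (d : ℕ) : Set (SlicePt d) := {y | 0 ≤ 1 - y 0 ∧ 1 - y 0 ≤ 1}

namespace Config

variable {d M : ℕ} (S : System d M) (C : Config d M)

/-- The spacetime region `0 ≤ t < T`, `0 ≤ u ≤ U₀`. -/
def region : Set (Pt d) := {p | 0 ≤ p 0 ∧ p 0 < C.T ∧ 0 ≤ C.u p ∧ C.u p ≤ C.U₀}

/-- `Σ_t^u`: the points with time `t` at which the eikonal function lies in `[0,u]`. -/
def slice (t u : ℝ) : Set (Pt d) := {p | p 0 = t ∧ 0 ≤ C.u p ∧ C.u p ≤ u}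

/-- The geometric coordinates `(t, u, ϑ)` of a point given in Cartesian coordinates. -/
def chart (p : Pt d) : Pt d :=
  Fin.cons (p 0) (Fin.cons (C.u p) (C.ϑ p) : SlicePt d)

/-- The derivative `Z f = Z^α ∂_α f` of `f` along the vectorfield with Cartesian components `Z^α`;
one-sided at the boundary of the region. -/
def der (f : Pt d → ℝ) (Z : Pt d → Pt d) : Pt d → ℝ :=
  fun p => fderivWithin ℝ f C.region p (Z p)

/-- The Cartesian partial derivative `∂_α f`. -/
def pd (α : Fin (d + 2)) (f : Pt d → ℝ) : Pt d → ℝ := C.der f (fun _ => Pi.single α 1)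

/-- `V_α^J = ∂_α v^J`. -/
def V (α : Fin (d + 2)) (J : Fin M) : Pt d → ℝ := C.pd α (fun p => C.v p J)

/-- The vectorfield `L`. -/
def vecL (p : Pt d) : Pt d := fun α => S.L α (C.Ψ p) (C.v p)

/-- The inverse foliation density `μ = 1 / ∂_t u`. -/
def μ (p : Pt d) : ℝ := 1 / C.pd 0 C.u p

/-- `ξ_j = μ ∂_j u`. -/
def ξ (j : Fin (d + 1)) (p : Pt d) : ℝ := C.μ p * C.pd j.succ C.u p

/-- The vectorfield `X̆`, tangent to the constant-time slices, with `X̆^j = -μ L^j`. -/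
def vecX (p : Pt d) : Pt d :=
  Fin.cons 0 (fun j : Fin (d + 1) => -(C.μ p * S.L j.succ (C.Ψ p) (C.v p)))

/-- The geometric torus coordinate vectorfields `∂/∂ϑ`, expressed in Cartesian components. -/
def vecΘ (i : Fin d) (p : Pt d) : Pt d :=
  fderivWithin ℝ C.Υ (box d C.T C.U₀) (C.chart p) (Pi.single i.succ.succ 1)

/-- `ξ_j^{(Small)} = ξ_j + δ_j^1`. -/
def ξSmall (j : Fin (d + 1)) (p : Pt d) : ℝ := C.ξ j p + if j = 0 then 1 else 0

/-- The Cartesian component `j` of `∂/∂ϑ^i` minus the Kronecker delta. -/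
def ΘSmall (i : Fin d) (j : Fin (d + 1)) (p : Pt d) : ℝ :=
  C.vecΘ i p j.succ - if j = i.succ then 1 else 0

/-- The blowup coefficient `𝒢 = (∂L¹/∂Ψ) ξ_1`. -/
def blowupCoeff (p : Pt d) : ℝ := deriv (fun s => S.L 1 s (C.v p)) (C.Ψ p) * C.ξ 0 p

/-! ### Strings of commutation vectorfields -/

/-- The commutation vectorfields: letter `0` is `L`, letter `1` is `X̆`, letter `i.succ.succ` is
the torus vectorfield with label `i`. -/
def vecZ (a : Fin (d + 2)) : Pt d → Pt d :=
  (Fin.cons (C.vecL S) (Fin.cons (C.vecX S) C.vecΘ : Fin (d + 1) → Pt d → Pt d) :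
    Fin (d + 2) → Pt d → Pt d) a

/-- The string of vectorfields spelled by a word, applied to `f` (first letter outermost). -/
def string : List (Fin (d + 2)) → (Pt d → ℝ) → Pt d → ℝ
  | [], f => f
  | a :: w, f => C.der (string w f) (C.vecZ S a)

open Classical in
/-- The sum of the absolute values of all strings of length between `m` and `N` that satisfy `P`,
applied to `f`. -/
def stringSum (P : List (Fin (d + 2)) → Prop) (m N : ℕ) (f : Pt d → ℝ) (p : Pt d) : ℝ :=
  ∑ k ∈ Finset.Icc m N, ∑ w : Fin k → Fin (d + 2),
    if P (List.ofFn w) then |C.string S (List.ofFn w) f p| else 0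

end Config

/-- Strings of type `𝒵^{·;1}`: at most one factor `X̆`. -/
def StrZ {d : ℕ} (w : List (Fin (d + 2))) : Prop := w.count 1 ≤ 1

/-- Strings of type `𝒵_*^{·;1}`: at most one factor `X̆` and at least one factor that is not `X̆`. -/
def StrZStar {d : ℕ} (w : List (Fin (d + 2))) : Prop := w.count 1 ≤ 1 ∧ ∃ a ∈ w, a ≠ 1

/-- Strings of type `𝒫`: no factor `X̆`. -/
def StrP {d : ℕ} (w : List (Fin (d + 2))) : Prop := 1 ∉ w

/-- Strings of type `𝒫_*`: no factor `X̆`, and at least one torus vectorfield or at least two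
factors `L`. -/
def StrPStar {d : ℕ} (w : List (Fin (d + 2))) : Prop :=
  1 ∉ w ∧ ((∃ a ∈ w, a ≠ 0) ∨ 2 ≤ w.count 0)

namespace Config

variable {d M : ℕ} (S : System d M) (C : Config d M)

/-- `‖f‖_{L^∞(Σ_t^u)} ≤ b`. It is used for functions that are continuous on `Σ_t^u`, for which the
essential supremum over `[0,u] × 𝕋^d` in geometric coordinates is the supremum. -/
def BoundedBy (f : Pt d → ℝ) (t u b : ℝ) : Prop := ∀ p ∈ C.slice t u, |f p| ≤ b

/-- `‖f‖_{L^∞(Σ_t^u)}` for a function that is continuous on `Σ_t^u`. -/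
def supNorm (f : Pt d → ℝ) (t u : ℝ) : ℝ := sSup ((fun p => |f p|) '' C.slice t u)

/-- `μ_⋆(t,u)`, the minimum of `μ` over `Σ_t^u`. -/
def μStar (t u : ℝ) : ℝ := sInf (C.μ '' C.slice t u)

/-! ### The data and the solution -/

/-- The initial datum of `Ψ`, as a function of `(x¹, ..., xⁿ)`. -/
def Ψ₀ (y : SlicePt d) : ℝ := C.Ψ (Fin.cons 0 y)

/-- The initial datum of `v`, as a function of `(x¹, ..., xⁿ)`. -/
def v₀ (y : SlicePt d) : Fin M → ℝ := C.v (Fin.cons 0 y)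

/-- `μ` at `t = 0` in terms of the data: since `u = 1 - x¹` at `t = 0` and `L u = 0`, one has
`∂_t u = L¹` there. -/
def μ₀ (y : SlicePt d) : ℝ := 1 / S.L 1 (C.Ψ₀ y) (C.v₀ y)

/-- `X̆ Ψ` at `t = 0` in terms of the data. -/
def XΨ₀ (y : SlicePt d) : ℝ :=
  ∑ j : Fin (d + 1), -(C.μ₀ S y * S.L j.succ (C.Ψ₀ y) (C.v₀ y)) *
    fderivWithin ℝ C.Ψ₀ (dataSlab d) y (Pi.single j 1)

/-- `𝒢` at `t = 0` in terms of the data; there `ξ_1 = -μ`. -/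
def blowupCoeff₀ (y : SlicePt d) : ℝ :=
  deriv (fun s => S.L 1 s (C.v₀ y)) (C.Ψ₀ y) * -(C.μ₀ S y)

/-- The data quantity `Å_* = sup [𝒢 X̆ Ψ]_-` over the initial slab `0 ≤ 1 - x¹ ≤ 1`. -/
def AStar : ℝ :=
  sSup ((fun y => |min (C.blowupCoeff₀ S y * C.XΨ₀ S y) 0|) '' dataSlab d)

/-- `C` is a smooth solution on the region `0 ≤ t < T`, `0 ≤ u ≤ U₀` (with smooth data on the initial
slab `0 ≤ 1 - x¹ ≤ 1`), together with its eikonal function, its geometric torus coordinates and its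
change of variables map, which is a diffeomorphism from `[0,T) × [0,U₀] × 𝕋^d` onto the region. -/
structure IsSolution : Prop where
  T_pos : 0 < C.T
  U₀_pos : 0 < C.U₀
  U₀_le : C.U₀ ≤ 1
  /-- `Ψ`, `v` and `u` are functions on `ℝ × ℝ × 𝕋^d`. -/
  periodic_Ψ : ∀ p q, proj p = proj q → C.Ψ p = C.Ψ q
  periodic_v : ∀ p q, proj p = proj q → C.v p = C.v q
  periodic_u : ∀ p q, proj p = proj q → C.u p = C.u q
  smooth_Ψ₀ : ContDiffOn ℝ ∞ C.Ψ₀ (dataSlab d)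
  smooth_v₀ : ContDiffOn ℝ ∞ C.v₀ (dataSlab d)
  smooth_Ψ : ContDiffOn ℝ ∞ C.Ψ C.region
  smooth_v : ContDiffOn ℝ ∞ C.v C.region
  /-- `L Ψ = 0`. -/
  eq_Ψ : ∀ p ∈ C.region, C.der C.Ψ (C.vecL S) p = 0
  /-- `A^α ∂_α v = 0`. -/
  eq_v : ∀ p ∈ C.region, ∀ I : Fin M,
    ∑ α : Fin (d + 2), ∑ J : Fin M, S.A α (C.Ψ p) (C.v p) I J * C.V α J p = 0
  /-- The eikonal equation and its initial condition. -/
  eikonal : ∀ p ∈ C.region, C.der C.u (C.vecL S) p = 0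
  eikonal_init : ∀ p : Pt d, p 0 = 0 → C.u p = 1 - p 1
  /-- The transport equations for the torus coordinates and their initial conditions. -/
  torus : ∀ p ∈ C.region, ∀ i : Fin d, C.der (fun p => C.ϑ p i) (C.vecL S) p = 0
  torus_init : ∀ p ∈ C.region, p 0 = 0 → ∀ i : Fin d, C.ϑ p i = p i.succ.succ
  /-- `Υ` is the inverse of `(t, u, ϑ)`, and it is a diffeomorphism. -/
  image_Υ : C.Υ '' box d C.T C.U₀ = C.region
  chart_Υ : ∀ q ∈ box d C.T C.U₀, C.chart (C.Υ q) = q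
  diffeo : IsDiffeoOntoImage ∞ C.Υ (box d C.T C.U₀)

/-- The bootstrap assumptions, with data-size parameters `α` (size of `Ψ`), `ε₀` (data smallness),
`A` (size of `X̆ Ψ`), bootstrap parameter `ε` and derivative count `Nmid`. -/
structure Bootstrap (α ε₀ A ε : ℝ) (Nmid : ℕ) : Prop where
  T_le : C.T ≤ 2 * (C.AStar S)⁻¹
  μ_pos : ∀ p ∈ C.region, 0 < C.μ p
  /-- Fundamental assumptions for `v` and `V`. -/
  fund_v : ∀ t ∈ Ico 0 C.T, ∀ u ∈ Icc 0 C.U₀, ∀ J : Fin M,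
    C.BoundedBy (C.stringSum S StrP 0 (Nmid - 1) (fun p => C.v p J)) t u ε
  fund_V : ∀ t ∈ Ico 0 C.T, ∀ u ∈ Icc 0 C.U₀, ∀ (β : Fin (d + 2)) (J : Fin M),
    C.BoundedBy (C.stringSum S StrP 0 (Nmid - 1) (C.V β J)) t u ε
  /-- Auxiliary assumptions for `Ψ`. -/
  aux_Ψ : ∀ t ∈ Ico 0 C.T, ∀ u ∈ Icc 0 C.U₀, C.BoundedBy C.Ψ t u (α + √ε)
  aux_ZΨ : ∀ t ∈ Ico 0 C.T, ∀ u ∈ Icc 0 C.U₀,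
    C.BoundedBy (C.stringSum S StrZStar 1 Nmid C.Ψ) t u (√ε)
  aux_XΨ : ∀ t ∈ Ico 0 C.T, ∀ u ∈ Icc 0 C.U₀,
    C.BoundedBy (C.der C.Ψ (C.vecX S)) t u (A + √ε)
  /-- Auxiliary assumptions for `v` and `V`. -/
  aux_v : ∀ t ∈ Ico 0 C.T, ∀ u ∈ Icc 0 C.U₀,
    C.BoundedBy (fun p => ∑ J : Fin M,
      C.stringSum S StrZ 0 (Nmid - 1) (fun p => C.v p J) p) t u (√ε)
  aux_V : ∀ t ∈ Ico 0 C.T, ∀ u ∈ Icc 0 C.U₀,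
    C.BoundedBy (fun p => ∑ β : Fin (d + 2), ∑ J : Fin M,
      C.stringSum S StrZ 0 (Nmid - 1) (C.V β J) p) t u (√ε)
  /-- Auxiliary assumptions for `μ`. -/
  aux_μ : ∀ t ∈ Ico 0 C.T, ∀ u ∈ Icc 0 C.U₀,
    C.BoundedBy C.μ t u (1 + 2 * (C.AStar S)⁻¹ *
      C.supNorm (fun p => C.blowupCoeff S p * C.der C.Ψ (C.vecX S) p) 0 u + √α + √ε)
  aux_Lμ : ∀ t ∈ Ico 0 C.T, ∀ u ∈ Icc 0 C.U₀,
    C.BoundedBy (C.der C.μ (C.vecL S)) t u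
      (C.supNorm (fun p => C.blowupCoeff S p * C.der C.Ψ (C.vecX S) p) 0 u + √ε)
  aux_Pμ : ∀ t ∈ Ico 0 C.T, ∀ u ∈ Icc 0 C.U₀,
    C.BoundedBy (C.stringSum S StrPStar 1 (Nmid - 1) C.μ) t u (√ε)
  /-- Auxiliary assumptions for `ξ` and the torus vectorfields. -/
  aux_ξ : ∀ t ∈ Ico 0 C.T, ∀ u ∈ Icc 0 C.U₀, ∀ j : Fin (d + 1),
    C.BoundedBy (C.ξSmall j) t u (√α + √ε₀)
  aux_Zξ : ∀ t ∈ Ico 0 C.T, ∀ u ∈ Icc 0 C.U₀, ∀ j : Fin (d + 1),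
    C.BoundedBy (C.stringSum S StrZStar 1 (Nmid - 1) (C.ξSmall j)) t u (√ε)
  aux_Xξ : ∀ t ∈ Ico 0 C.T, ∀ u ∈ Icc 0 C.U₀, ∀ j : Fin (d + 1),
    C.BoundedBy (C.der (C.ξSmall j) (C.vecX S)) t u
      (C.supNorm (C.der (C.ξSmall j) (C.vecX S)) 0 u + √ε)
  aux_Θ : ∀ t ∈ Ico 0 C.T, ∀ u ∈ Icc 0 C.U₀, ∀ (i : Fin d) (j : Fin (d + 1)),
    C.BoundedBy (C.stringSum S StrZ 0 (Nmid - 1) (C.ΘSmall i j)) t u (√ε)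

end Config

/-- A continuous increasing function `(0,∞) → (0,∞)`: "`A` is small relative to `B`" means
`A < f B` for such an `f`. -/
def IsSmallnessScale (f : ℝ → ℝ) : Prop :=
  ContinuousOn f (Ioi 0) ∧ StrictMonoOn f (Ioi 0) ∧ ∀ s ∈ Ioi (0 : ℝ), 0 < f s

/-! ### Function spaces in time with values in function spaces on `[0,U₀] × 𝕋^d` -/

/-- Lebesgue measure on `[0,U₀] × [0,1)^d`, the fundamental domain of `[0,U₀] × 𝕋^d`. -/
def sliceMeasure (d : ℕ) (U₀ : ℝ) : Measure (SlicePt d) :=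
  volume.restrict {y | 0 ≤ y 0 ∧ y 0 ≤ U₀ ∧ ∀ i : Fin d, 0 ≤ y i.succ ∧ y i.succ < 1}

/-- The universal cover `(0,U₀) × ℝ^d` of `(0,U₀) × 𝕋^d`. -/
def strip (d : ℕ) (U₀ : ℝ) : Set (SlicePt d) := {y | 0 < y 0 ∧ y 0 < U₀}

/-- `h` is the weak partial derivative of `g` in direction `j` on the interior of
`[0,U₀] × 𝕋^d`. -/
def HasWeakPartial {d : ℕ} (U₀ : ℝ) (j : Fin (d + 1)) (g h : SlicePt d → ℝ) : Prop :=
  LocallyIntegrableOn g (strip d U₀) ∧ LocallyIntegrableOn h (strip d U₀) ∧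
  ∀ φ : SlicePt d → ℝ, ContDiff ℝ ∞ φ → HasCompactSupport φ → tsupport φ ⊆ strip d U₀ →
    ∫ y, g y * fderiv ℝ φ y (Pi.single j 1) = -∫ y, h y * φ y

/-- The curve `F` in `L^∞([0,U₀] × 𝕋^d)` is `t ↦ f(t, ·)` for `t ∈ [0,T]`. -/
def Represents {d : ℕ} {U₀ : ℝ} (T : ℝ) (F : ℝ → Lp ℝ ∞ (sliceMeasure d U₀))
    (f : Pt d → ℝ) : Prop :=
  ∀ t ∈ Icc 0 T, F t =ᵐ[sliceMeasure d U₀] fun y => f (Fin.cons t y)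

/-- `f ∈ C([0,T], W^{1,∞}([0,U₀] × 𝕋^d))`: the function and all its first-order weak partial
derivatives on the slices are continuous curves in `L^∞`. -/
def InCZeroWOneInfty {d : ℕ} (T U₀ : ℝ) (f : Pt d → ℝ) : Prop :=
  (∃ F : ℝ → Lp ℝ ∞ (sliceMeasure d U₀), Represents T F f ∧ ContinuousOn F (Icc 0 T)) ∧
  ∀ j : Fin (d + 1), ∃ (h : Pt d → ℝ) (H : ℝ → Lp ℝ ∞ (sliceMeasure d U₀)),
    Represents T H h ∧ ContinuousOn H (Icc 0 T) ∧
    ∀ t ∈ Icc 0 T, HasWeakPartial U₀ j (fun y => f (Fin.cons t y)) (fun y => h (Fin.cons t y))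

/-- `f ∈ C¹([0,T], L^∞([0,U₀] × 𝕋^d))`. -/
def InCOneLInfty {d : ℕ} (T U₀ : ℝ) (f : Pt d → ℝ) : Prop :=
  ∃ F : ℝ → Lp ℝ ∞ (sliceMeasure d U₀), Represents T F f ∧ ContDiffOn ℝ 1 F (Icc 0 T)

end

end ShockFormation

namespace ShockFormation

noncomputable section

open Filter Topology

/-! ### Geometry of the coordinate boxes -/

section BoxGeometry

variable {d : ℕ} {T U : ℝ}

/-! In geometric coordinates `L` is `∂/∂t`, so `Υ` is a flow: `∂_t Υ = ℓ(s)` with `s = (Ψ, v) ∘ Υ`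
and `ℓ = S.vecField`. It extends to `t = T` once enough time derivatives are bounded. The extension
stays a diffeomorphism because `μ`, the factor whose vanishing would make `DΥ` degenerate, is
bounded below by some `c > 0`.

Bounds. The bootstrap assumptions control `s`, its derivatives along `L` and the torus fields, and
one further application of `X̆ = ∂_u + ∑ b_i ∂/∂ϑ^i`; they say nothing directly about `∂_u`. Since
`X̆ Υ = -μ (ℓ(s) - e_0)` is bounded and the torus block of `DΥ` is close to the identity, `b` is at
most linear in `|∂_u Υ|`. Hence `∂_t ∂_u Υ = Dℓ(s) ∂_u s` is at most linear in `|∂_u Υ|`, and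
Grönwall's inequality bounds `∂_u Υ` up to time `T` (`exists_bound_eikonal`). Then `b` is bounded,
and so are all `∂_a (ℓ ∘ s)` and `∂_a ∂_{ϑ^i} (ℓ ∘ s)`, which are the time derivatives of `∂_a Υ`
and `∂_a ∂_{ϑ^i} Υ` (`exists_bound_flow`).

Regularity. A smooth function on the half-open box that has bounded `∂_t`, and whose first partials
have bounded `∂_t`, extends to a `C¹` function on the closed box, Lipschitz in time together with
its partials (`hasLipPartials_timeExt`). The constants do not depend on the spatial point, so these
are estimates in the `L^∞` norm of the slices. This is applied to the components of `Υ` and of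
`∂_{ϑ^i} Υ`.

Diffeomorphism. Two inequalities pass to the limit `t → T`. In the torus directions `DΥ` is within
`1/2` of the identity, so at fixed `(t, u)` the image is a graph over `ℝ^d`. And `DΥ` sends a
direction `(0, 1, θ)` to a vector whose `x¹` component is at most `-c/4` plus the size of its torus
part, because `X̆ Υ¹ = -μ L¹ ≤ -c/2` and `ε` is small (`FlowControl.transversal`). The graphs of
different `u` are therefore strictly ordered, so the lift is injective (`IsStackedGraphMap.injOn`);
the same inequalities make the derivative injective, and properness makes the inverse continuous.
Equivariance under `ℤ^d` carries everything to the torus. -/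

/-- The interior of the closed box. -/
def openBox (d : ℕ) (T U : ℝ) : Set (Pt d) :=
  {q | 0 < q 0 ∧ q 0 < T ∧ 0 < q 1 ∧ q 1 < U}

theorem box_subset_closedBox : box d T U ⊆ closedBox d T U :=
  fun _ h => ⟨h.1, h.2.1.le, h.2.2⟩

theorem openBox_subset_box : openBox d T U ⊆ box d T U :=
  fun _ h => ⟨h.1.le, h.2.1, h.2.2.1.le, h.2.2.2.le⟩

theorem isOpen_openBox : IsOpen (openBox d T U) := by
  have h0 : Continuous fun q : Pt d => q 0 := continuous_apply 0
  have h1 : Continuous fun q : Pt d => q 1 := continuous_apply 1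
  exact (isOpen_lt continuous_const h0).inter ((isOpen_lt h0 continuous_const).inter
    ((isOpen_lt continuous_const h1).inter (isOpen_lt h1 continuous_const)))

theorem isClosed_closedBox : IsClosed (closedBox d T U) := by
  have h0 : Continuous fun q : Pt d => q 0 := continuous_apply 0
  have h1 : Continuous fun q : Pt d => q 1 := continuous_apply 1
  exact (isClosed_le continuous_const h0).inter ((isClosed_le h0 continuous_const).inter
    ((isClosed_le continuous_const h1).inter (isClosed_le h1 continuous_const)))

theorem convex_coord_preimage {ι : Type*} (a : ι) {I : Set ℝ} (hI : Convex ℝ I) :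
    Convex ℝ {q : ι → ℝ | q a ∈ I} :=
  hI.linear_preimage (LinearMap.proj a : (ι → ℝ) →ₗ[ℝ] ℝ)

theorem convex_box : Convex ℝ (box d T U) := by
  have : box d T U = {q | q 0 ∈ Ico 0 T} ∩ {q | q 1 ∈ Icc 0 U} := by
    ext q; simp [box, and_assoc]
  rw [this]
  exact (convex_coord_preimage 0 (convex_Ico _ _)).inter (convex_coord_preimage 1 (convex_Icc _ _))

theorem convex_closedBox : Convex ℝ (closedBox d T U) := by
  have : closedBox d T U = {q | q 0 ∈ Icc 0 T} ∩ {q | q 1 ∈ Icc 0 U} := by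
    ext q; simp [closedBox, and_assoc]
  rw [this]
  exact (convex_coord_preimage 0 (convex_Icc _ _)).inter (convex_coord_preimage 1 (convex_Icc _ _))

theorem convex_openBox : Convex ℝ (openBox d T U) := by
  have : openBox d T U = {q | q 0 ∈ Ioo 0 T} ∩ {q | q 1 ∈ Ioo 0 U} := by
    ext q; simp [openBox, and_assoc]
  rw [this]
  exact (convex_coord_preimage 0 (convex_Ioo _ _)).inter (convex_coord_preimage 1 (convex_Ioo _ _))

theorem fin_zero_ne_one {d : ℕ} : (0 : Fin (d + 2)) ≠ 1 := by
  simp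

theorem closure_openBox (hT : 0 < T) (hU : 0 < U) :
    closure (openBox d T U) = closedBox d T U := by
  -- Both boxes are products over the coordinates, so the closure is taken factor by factor.
  have key : ∀ (I J : Set ℝ), {q : Pt d | q 0 ∈ I ∧ q 1 ∈ J} =
      univ.pi (fun a : Fin (d + 2) => if a = 0 then I else if a = 1 then J else univ) := by
    intro I J
    ext q
    simp only [mem_ofPred_eq, mem_univ_pi]
    constructor
    · rintro ⟨h0, h1⟩ a
      by_cases ha : a = 0
      · simpa [ha] using h0
      · by_cases hb : a = 1
        · simpa [hb] using h1
        · simp [ha, hb]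
    · intro h
      exact ⟨by simpa using h 0, by simpa using h 1⟩
  have e1 : openBox d T U = {q : Pt d | q 0 ∈ Ioo 0 T ∧ q 1 ∈ Ioo 0 U} := by
    ext q; simp [openBox, and_assoc]
  have e2 : closedBox d T U = {q : Pt d | q 0 ∈ Icc 0 T ∧ q 1 ∈ Icc 0 U} := by
    ext q; simp [closedBox, and_assoc]
  rw [e1, e2, key, key, closure_pi_set]
  congr 1
  funext a
  by_cases ha : a = 0
  · simp [ha, closure_Ioo hT.ne]
  · by_cases hb : a = 1
    · simp [hb, closure_Ioo hU.ne]
    · simp [ha, hb]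

theorem openBox_nonempty (hT : 0 < T) (hU : 0 < U) : (openBox d T U).Nonempty := by
  refine ⟨fun a => if a = 0 then T / 2 else U / 2, ?_⟩
  simp [openBox]
  exact ⟨hT, hU⟩

theorem openBox_subset_interior_box : openBox d T U ⊆ interior (box d T U) :=
  interior_maximal openBox_subset_box isOpen_openBox

theorem uniqueDiffOn_box (hT : 0 < T) (hU : 0 < U) : UniqueDiffOn ℝ (box d T U) :=
  uniqueDiffOn_convex convex_box ((openBox_nonempty hT hU).mono openBox_subset_interior_box)

theorem uniqueDiffOn_closedBox (hT : 0 < T) (hU : 0 < U) : UniqueDiffOn ℝ (closedBox d T U) :=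
  uniqueDiffOn_convex convex_closedBox ((openBox_nonempty hT hU).mono
    (openBox_subset_interior_box.trans (interior_mono box_subset_closedBox)))

theorem box_subset_closure_interior (hT : 0 < T) (hU : 0 < U) :
    box d T U ⊆ closure (interior (box d T U)) := by
  refine box_subset_closedBox.trans ?_
  rw [← closure_openBox hT hU]
  exact closure_mono openBox_subset_interior_box

theorem update_mem_box {q : Pt d} (hq : q ∈ closedBox d T U) {s : ℝ} (hs : s ∈ Ico 0 T) :
    Function.update q 0 s ∈ box d T U := by
  refine ⟨by simpa using hs.1, by simpa using hs.2, ?_, ?_⟩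
  · rw [Function.update_of_ne fin_zero_ne_one.symm]; exact hq.2.2.1
  · rw [Function.update_of_ne fin_zero_ne_one.symm]; exact hq.2.2.2

theorem update_mem_closedBox {q : Pt d} (hq : q ∈ closedBox d T U) {s : ℝ} (hs : s ∈ Icc 0 T) :
    Function.update q 0 s ∈ closedBox d T U := by
  refine ⟨by simpa using hs.1, by simpa using hs.2, ?_, ?_⟩
  · rw [Function.update_of_ne fin_zero_ne_one.symm]; exact hq.2.2.1
  · rw [Function.update_of_ne fin_zero_ne_one.symm]; exact hq.2.2.2

end BoxGeometry

/-! ### Extension in time -/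

section TimeExtension

variable {d : ℕ} {T U K : ℝ} {f : Pt d → ℝ}

/-- Lipschitz dependence on the time coordinate. -/
def TimeLip (s : Set (Pt d)) (K : ℝ) (f : Pt d → ℝ) : Prop :=
  ∀ q ∈ s, ∀ τ, Function.update q 0 τ ∈ s → |f (Function.update q 0 τ) - f q| ≤ K * |τ - q 0|

/-- The extension of a function to the final time `T` by its limit in time. -/
def timeExt (T : ℝ) (f : Pt d → ℝ) (q : Pt d) : ℝ :=
  if q 0 < T then f q else limUnder (𝓝[<] T) fun s => f (Function.update q 0 s)

theorem timeExt_of_mem_box {q : Pt d} (hq : q ∈ box d T U) : timeExt T f q = f q :=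
  if_pos hq.2.1

/-- A Lipschitz function on `[0, T)` extends to a Lipschitz function on `ℝ`, whose value at `T` must
be the limit in the definition of `timeExt`. Having one `g` for the whole time line removes the case
distinction at `T` later. -/
theorem exists_lipschitz_timeExt (hT : 0 < T) (hK : 0 ≤ K) (hf : TimeLip (box d T U) K f)
    {q : Pt d} (hq : q ∈ closedBox d T U) :
    ∃ g : ℝ → ℝ, LipschitzWith K.toNNReal g ∧
      ∀ s ∈ Icc 0 T, timeExt T f (Function.update q 0 s) = g s := by
  have h1 : LipschitzOnWith K.toNNReal (fun s => f (Function.update q 0 s)) (Ico 0 T) := by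
    refine LipschitzOnWith.of_dist_le_mul fun s hs s' hs' => ?_
    rw [Real.dist_eq, Real.dist_eq, Real.coe_toNNReal K hK]
    have := hf _ (update_mem_box hq hs') s (by
      rw [Function.update_idem]; exact update_mem_box hq hs)
    simpa using this
  obtain ⟨g, hg, hgf⟩ := h1.extend_real
  refine ⟨g, hg, fun s hs => ?_⟩
  rcases hs.2.lt_or_eq with h | h
  · rw [timeExt_of_mem_box (update_mem_box hq ⟨hs.1, h⟩)]
    exact hgf ⟨hs.1, h⟩
  · rw [timeExt, if_neg (by simp [h])]
    refine Tendsto.limUnder_eq ?_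
    have h2 : Tendsto g (𝓝[<] T) (𝓝 (g s)) := by
      rw [h]; exact hg.continuous.continuousWithinAt
    refine h2.congr' ?_
    have : Ico 0 T ∈ 𝓝[<] T := Ico_mem_nhdsLT hT
    filter_upwards [this] with r hr
    simpa using (hgf hr).symm

theorem timeLip_timeExt (hT : 0 < T) (hK : 0 ≤ K) (hf : TimeLip (box d T U) K f) :
    TimeLip (closedBox d T U) K (timeExt T f) := by
  intro q hq τ hτ
  obtain ⟨g, hg, hgf⟩ := exists_lipschitz_timeExt hT hK hf hq
  have h1 := hgf τ ⟨by simpa using hτ.1, by simpa using hτ.2.1⟩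
  have h2 := hgf (q 0) ⟨hq.1, hq.2.1⟩
  rw [Function.update_eq_self] at h2
  rw [h1, h2]
  have := hg.dist_le_mul τ (q 0)
  rwa [Real.dist_eq, Real.dist_eq, Real.coe_toNNReal K hK] at this

/-- No spatial modulus of continuity up to `T` is needed. Freezing the time at `min (q 0) s` gives a
continuous function that only sees `f` on the half-open box, and it is uniformly within `K * (T -
s)` of the extension. -/
theorem continuousOn_timeExt (hT : 0 < T) (hK : 0 ≤ K) (hf : TimeLip (box d T U) K f)
    (hc : ContinuousOn f (box d T U)) : ContinuousOn (timeExt T f) (closedBox d T U) := by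
  refine continuousOn_of_uniform_approx_of_continuousOn fun V hV => ?_
  obtain ⟨ε, hε, hεV⟩ := Metric.mem_uniformity_dist.1 hV
  obtain ⟨s, hs0, hsT, hs⟩ : ∃ s, 0 ≤ s ∧ s < T ∧ K * (T - s) < ε := by
    have h : Tendsto (fun s => K * (T - s)) (𝓝[<] T) (𝓝 (K * (T - T))) := by
      have : Continuous fun s => K * (T - s) := by fun_prop
      exact this.continuousWithinAt
    have h' := (h.eventually_lt_const (u := ε) (by simpa using hε)).and (Ico_mem_nhdsLT hT)
    obtain ⟨s, hs⟩ := h'.exists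
    exact ⟨s, hs.2.1, hs.2.2, hs.1⟩
  refine ⟨fun q => f (Function.update q 0 (min (q 0) s)), ?_, fun q hq => hεV ?_⟩
  · refine hc.comp ?_ fun q hq =>
      update_mem_box hq ⟨le_min hq.1 hs0, (min_le_right _ _).trans_lt hsT⟩
    exact (Continuous.update continuous_id 0
      ((continuous_apply (0 : Fin (d + 2))).min continuous_const)).continuousOn
  · have hm : min (q 0) s ∈ Ico 0 T := ⟨le_min hq.1 hs0, (min_le_right _ _).trans_lt hsT⟩
    have h1 := timeLip_timeExt hT hK hf q hq (min (q 0) s)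
      (box_subset_closedBox (update_mem_box hq hm))
    rw [timeExt_of_mem_box (update_mem_box hq hm), abs_sub_comm] at h1
    rw [Real.dist_eq]
    refine h1.trans_lt (lt_of_le_of_lt ?_ hs)
    refine mul_le_mul_of_nonneg_left ?_ hK
    rw [abs_sub_comm, abs_of_nonneg (by simp)]
    rcases le_total (q 0) s with h | h
    · simp [h, hsT.le]
    · simp only [min_eq_right h]; linarith [hq.2.1]

/-! ### Partial derivatives on the half-open box. -/

variable {E : Type*} [NormedAddCommGroup E] [NormedSpace ℝ E]

/-- The partial derivative on the half-open box, one-sided at the boundary. -/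
def boxPartial (T U : ℝ) (a : Fin (d + 2)) (f : Pt d → E) (q : Pt d) : E :=
  fderivWithin ℝ f (box d T U) q (Pi.single a 1)

/-- The linear form with the given coefficients. -/
def coeffForm (c : Fin (d + 2) → ℝ) : Pt d →L[ℝ] ℝ :=
  ∑ a, c a • (ContinuousLinearMap.proj a : Pt d →L[ℝ] ℝ)

theorem coeffForm_apply (c : Fin (d + 2) → ℝ) (z : Pt d) : coeffForm c z = ∑ a, c a * z a := by
  simp [coeffForm]

theorem coeffForm_single (c : Fin (d + 2) → ℝ) (a : Fin (d + 2)) :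
    coeffForm c (Pi.single a 1) = c a := by
  simp [coeffForm_apply, Pi.single_apply]

theorem coeffForm_eq (l : Pt d →L[ℝ] ℝ) : coeffForm (fun a => l (Pi.single a 1)) = l := by
  ext z
  rw [coeffForm_apply]
  conv_rhs => rw [← Finset.univ_sum_single z, map_sum]
  refine Finset.sum_congr rfl fun a _ => ?_
  have : (Pi.single a (z a) : Pt d) = z a • Pi.single a 1 := by
    rw [← Pi.single_smul]; simp
  rw [this, map_smul, smul_eq_mul, mul_comm]

theorem fderivWithin_box_eq (q : Pt d) :
    fderivWithin ℝ f (box d T U) q = coeffForm (fun a => boxPartial T U a f q) :=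
  (coeffForm_eq _).symm

theorem continuous_coeffForm : Continuous (coeffForm (d := d)) := by
  unfold coeffForm
  fun_prop

theorem hasFDerivWithinAt_box (hf : ContDiffOn ℝ ∞ f (box d T U)) {q : Pt d}
    (hq : q ∈ box d T U) :
    HasFDerivWithinAt f (coeffForm fun a => boxPartial T U a f q) (box d T U) q := by
  rw [← fderivWithin_box_eq]
  exact ((hf.differentiableOn (by simp)) q hq).hasFDerivWithinAt

theorem contDiffOn_boxPartial {f : Pt d → E} (hT : 0 < T) (hU : 0 < U)
    (hf : ContDiffOn ℝ ∞ f (box d T U)) (a : Fin (d + 2)) :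
    ContDiffOn ℝ ∞ (boxPartial T U a f) (box d T U) := by
  have := hf.fderivWithin (uniqueDiffOn_box hT hU) (m := ∞) (by simp)
  exact this.clm_apply contDiffOn_const

theorem boxPartial_congr {f g : Pt d → E} (h : EqOn f g (box d T U)) {q : Pt d}
    (hq : q ∈ box d T U) (a : Fin (d + 2)) : boxPartial T U a f q = boxPartial T U a g q := by
  rw [boxPartial, boxPartial, fderivWithin_congr h (h hq)]

/-- One-sided second derivatives are symmetric even at boundary points, because the box lies in the
closure of its interior. -/
theorem boxPartial_comm {f : Pt d → E} (hT : 0 < T) (hU : 0 < U)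
    (hf : ContDiffOn ℝ ∞ f (box d T U)) (a b : Fin (d + 2)) {q : Pt d} (hq : q ∈ box d T U) :
    boxPartial T U a (boxPartial T U b f) q = boxPartial T U b (boxPartial T U a f) q := by
  have hu := uniqueDiffOn_box (d := d) hT hU
  have hs := (hf q hq).isSymmSndFDerivWithinAt
    (by rw [minSmoothness_of_isRCLikeNormedField]; exact WithTop.coe_le_coe.2 le_top) hu
    (box_subset_closure_interior hT hU hq) hq
  have hd : DifferentiableWithinAt ℝ (fderivWithin ℝ f (box d T U)) (box d T U) q :=
    ((hf.fderivWithin hu (m := ∞) (by simp)).differentiableOn (by simp)) q hq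
  have key : ∀ a b : Fin (d + 2), boxPartial T U a (boxPartial T U b f) q =
      fderivWithin ℝ (fderivWithin ℝ f (box d T U)) (box d T U) q (Pi.single a 1)
        (Pi.single b 1) := by
    intro a b
    have h2 := hd.hasFDerivWithinAt.clm_apply
      (hasFDerivWithinAt_const (Pi.single b 1 : Pt d) q (box d T U))
    have h3 := h2.fderivWithin (hu q hq)
    change fderivWithin ℝ (fun q => fderivWithin ℝ f (box d T U) q (Pi.single b 1))
      (box d T U) q (Pi.single a 1) = _
    rw [h3]
    simp
  rw [key, key]
  exact hs _ _

theorem hasDerivWithinAt_update {f : Pt d → E} (hf : ContDiffOn ℝ ∞ f (box d T U)) {q : Pt d}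
    (hq : q ∈ closedBox d T U) {s : ℝ} (hs : s ∈ Ico 0 T) :
    HasDerivWithinAt (fun s => f (Function.update q 0 s))
      (boxPartial T U 0 f (Function.update q 0 s)) (Ico 0 T) s := by
  have h1 := ((hf.differentiableOn (by simp)) _ (update_mem_box hq hs)).hasFDerivWithinAt
  have h2 : HasDerivWithinAt (fun s => Function.update q 0 s) (Pi.single 0 1) (Ico 0 T) s :=
    (hasDerivAt_update q 0 s).hasDerivWithinAt
  exact h1.comp_hasDerivWithinAt s h2 fun r hr => update_mem_box hq hr

theorem boxPartial_clm {F : Type*} [NormedAddCommGroup F] [NormedSpace ℝ F] {f : Pt d → E}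
    (hT : 0 < T) (hU : 0 < U) (hf : ContDiffOn ℝ ∞ f (box d T U)) (l : E →L[ℝ] F)
    (a : Fin (d + 2)) {q : Pt d} (hq : q ∈ box d T U) :
    boxPartial T U a (fun q => l (f q)) q = l (boxPartial T U a f q) := by
  have h1 := ((hf.differentiableOn (by simp)) q hq).hasFDerivWithinAt
  have h2 := l.hasFDerivAt.comp_hasFDerivWithinAt q h1
  exact congrArg (fun l : Pt d →L[ℝ] F => l (Pi.single a 1))
    (h2.fderivWithin (uniqueDiffOn_box hT hU q hq))

theorem boxPartial_apply {ι : Type*} [Fintype ι] {f : Pt d → ι → ℝ}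
    (hT : 0 < T) (hU : 0 < U) (hf : ContDiffOn ℝ ∞ f (box d T U)) (j : ι)
    (a : Fin (d + 2)) {q : Pt d} (hq : q ∈ box d T U) :
    boxPartial T U a (fun q => f q j) q = boxPartial T U a f q j :=
  boxPartial_clm hT hU hf (ContinuousLinearMap.proj j) a hq

theorem boxPartial_boxPartial_apply {ι : Type*} [Fintype ι] {f : Pt d → ι → ℝ}
    (hT : 0 < T) (hU : 0 < U) (hf : ContDiffOn ℝ ∞ f (box d T U)) (j : ι)
    (a b : Fin (d + 2)) {q : Pt d} (hq : q ∈ box d T U) :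
    boxPartial T U b (boxPartial T U a fun q => f q j) q =
      boxPartial T U b (boxPartial T U a f) q j := by
  rw [boxPartial_congr (fun z hz => boxPartial_apply hT hU hf j a hz) hq,
    boxPartial_apply hT hU (contDiffOn_boxPartial hT hU hf a) j b hq]

theorem timeLip_of_bound (hf : ContDiffOn ℝ ∞ f (box d T U))
    (hb : ∀ q ∈ box d T U, |boxPartial T U 0 f q| ≤ K) : TimeLip (box d T U) K f := by
  intro q hq τ hτ
  have hq' := box_subset_closedBox hq
  have := Convex.norm_image_sub_le_of_norm_hasDerivWithin_le
    (fun s hs => hasDerivWithinAt_update hf hq' hs)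
    (fun s hs => by simpa using hb _ (update_mem_box hq' hs)) (convex_Ico 0 T)
    (x := q 0) (y := τ) ⟨hq.1, hq.2.1⟩ ⟨by simpa using hτ.1, by simpa using hτ.2.1⟩
  simpa using this

/-- `f` is continuously differentiable on the closed box with partial derivatives `h a`, and `f`
and its partial derivatives are Lipschitz in time. -/
structure HasLipPartials (T U K : ℝ) (f : Pt d → ℝ) (h : Fin (d + 2) → Pt d → ℝ) : Prop where
  hasFDerivWithinAt : ∀ q ∈ closedBox d T U,
    HasFDerivWithinAt f (coeffForm fun a => h a q) (closedBox d T U) q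
  timeLip : TimeLip (closedBox d T U) K f
  continuousOn_partial : ∀ a, ContinuousOn (h a) (closedBox d T U)
  timeLip_partial : ∀ a, TimeLip (closedBox d T U) K (h a)

/-- On the open box, which is convex, the extension is differentiable with the expected partials.
These have limits at every point of the closure by `continuousOn_timeExt`, so the extension is
differentiable there too, with the limit as derivative. -/
theorem hasLipPartials_timeExt (hT : 0 < T) (hU : 0 < U) (hK : 0 ≤ K)
    (hf : ContDiffOn ℝ ∞ f (box d T U))
    (h0 : ∀ q ∈ box d T U, |boxPartial T U 0 f q| ≤ K)
    (h1 : ∀ a, ∀ q ∈ box d T U, |boxPartial T U 0 (boxPartial T U a f) q| ≤ K) :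
    HasLipPartials T U K (timeExt T f) (fun a => timeExt T (boxPartial T U a f)) := by
  have hl := timeLip_of_bound hf h0
  have hs := contDiffOn_boxPartial hT hU hf
  have hla := fun a => timeLip_of_bound (hs a) (h1 a)
  have hc := continuousOn_timeExt hT hK hl hf.continuousOn
  have hca := fun a => continuousOn_timeExt hT hK (hla a) (hs a).continuousOn
  refine ⟨fun q hq => ?_, timeLip_timeExt hT hK hl, hca, fun a => timeLip_timeExt hT hK (hla a)⟩
  have hfd : ∀ q ∈ openBox d T U,
      HasFDerivAt (timeExt T f) (coeffForm fun a => timeExt T (boxPartial T U a f) q) q := by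
    intro q hq
    have hqb := openBox_subset_box hq
    have hn : openBox d T U ∈ 𝓝 q := isOpen_openBox.mem_nhds hq
    have e1 := (hasFDerivWithinAt_box hf hqb).hasFDerivAt (mem_of_superset hn openBox_subset_box)
    have e2 : timeExt T f =ᶠ[𝓝 q] f := by
      filter_upwards [hn] with z hz using timeExt_of_mem_box (openBox_subset_box hz)
    have e3 : (fun a => timeExt T (boxPartial T U a f) q) = fun a => boxPartial T U a f q :=
      funext fun a => timeExt_of_mem_box hqb
    rw [e3]
    exact e1.congr_of_eventuallyEq e2
  rw [← closure_openBox hT hU] at hq ⊢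
  refine hasFDerivWithinAt_closure_of_tendsto_fderiv
    (fun z hz => (hfd z hz).differentiableAt.differentiableWithinAt) convex_openBox isOpen_openBox
    (fun z hz => ?_) ?_
  · rw [closure_openBox hT hU] at hz
    exact (hc z hz).mono (openBox_subset_box.trans box_subset_closedBox)
  · have hq' := hq
    rw [closure_openBox hT hU] at hq'
    have t1 : Tendsto (fun z => coeffForm fun a => timeExt T (boxPartial T U a f) z)
        (𝓝[openBox d T U] q) (𝓝 (coeffForm fun a => timeExt T (boxPartial T U a f) q)) := by
      refine (continuous_coeffForm.tendsto _).comp (tendsto_pi_nhds.2 fun a => ?_)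
      exact ((hca a) q hq').mono (openBox_subset_box.trans box_subset_closedBox)
    refine t1.congr' ?_
    filter_upwards [self_mem_nhdsWithin] with z hz using (hfd z hz).fderiv.symm

theorem HasLipPartials.congr {h : Fin (d + 2) → Pt d → ℝ} {g : Pt d → ℝ}
    (H : HasLipPartials T U K f h) (hg : EqOn g f (closedBox d T U)) :
    HasLipPartials T U K g h := by
  refine ⟨fun q hq => (H.hasFDerivWithinAt q hq).congr hg (hg hq), fun q hq τ hτ => ?_,
    H.continuousOn_partial, H.timeLip_partial⟩
  rw [hg hq, hg hτ]
  exact H.timeLip q hq τ hτ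

theorem HasLipPartials.continuousOn {h : Fin (d + 2) → Pt d → ℝ}
    (H : HasLipPartials T U K f h) : ContinuousOn f (closedBox d T U) :=
  fun q hq => (H.hasFDerivWithinAt q hq).continuousWithinAt

end TimeExtension


/-! ### Curves in function spaces on the slices -/

section FunctionSpaces

variable {d : ℕ} {T U K : ℝ} {f : Pt d → ℝ}

theorem cons_mem_closedBox {t : ℝ} (ht : t ∈ Icc 0 T) {y : SlicePt d} (h0 : 0 ≤ y 0)
    (h1 : y 0 ≤ U) : (Fin.cons t y : Pt d) ∈ closedBox d T U :=
  ⟨ht.1, ht.2, h0, h1⟩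

/-- The fundamental domain of the slices. -/
def sliceDomain (d : ℕ) (U : ℝ) : Set (SlicePt d) :=
  {y | 0 ≤ y 0 ∧ y 0 ≤ U ∧ ∀ i : Fin d, 0 ≤ y i.succ ∧ y i.succ < 1}

theorem measurableSet_sliceDomain : MeasurableSet (sliceDomain d U) := by
  have : sliceDomain d U = {y | 0 ≤ y 0} ∩ ({y | y 0 ≤ U} ∩
      ⋂ i : Fin d, ({y | 0 ≤ y i.succ} ∩ {y | y i.succ < 1})) := by
    ext y; simp [sliceDomain]
  rw [this]
  exact (measurableSet_le measurable_const (measurable_pi_apply _)).inter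
    ((measurableSet_le (measurable_pi_apply _) measurable_const).inter
      (MeasurableSet.iInter fun i => (measurableSet_le measurable_const
        (measurable_pi_apply _)).inter (measurableSet_lt (measurable_pi_apply _) measurable_const)))

/-- A compact box that contains the fundamental domain of the slices. -/
def sliceCompact (d : ℕ) (U : ℝ) : Set (SlicePt d) :=
  Icc 0 (Fin.cons U fun _ => 1)

theorem sliceDomain_subset : sliceDomain d U ⊆ sliceCompact d U := by
  intro y hy
  refine ⟨fun a => ?_, fun a => ?_⟩
  · refine Fin.cases hy.1 (fun i => (hy.2.2 i).1) a
  · refine Fin.cases hy.2.1 (fun i => (hy.2.2 i).2.le) a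

theorem sliceMeasure_eq : sliceMeasure d U = volume.restrict (sliceDomain d U) := rfl

instance isFiniteMeasure_sliceMeasure : IsFiniteMeasure (sliceMeasure d U) := by
  rw [sliceMeasure_eq]
  refine ⟨?_⟩
  rw [Measure.restrict_apply_univ]
  exact (measure_mono sliceDomain_subset).trans_lt isCompact_Icc.measure_lt_top

theorem ae_sliceMeasure {P : SlicePt d → Prop} (h : ∀ y ∈ sliceDomain d U, P y) :
    ∀ᵐ y ∂sliceMeasure d U, P y := by
  rw [sliceMeasure_eq]
  exact (ae_restrict_iff' measurableSet_sliceDomain).2 (Eventually.of_forall h)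

theorem continuousOn_slice (hf : ContinuousOn f (closedBox d T U)) {t : ℝ} (ht : t ∈ Icc 0 T) :
    ContinuousOn (fun y : SlicePt d => f (Fin.cons t y)) {y | 0 ≤ y 0 ∧ y 0 ≤ U} :=
  hf.comp (by fun_prop) fun _ hy => cons_mem_closedBox ht hy.1 hy.2

theorem memLp_slice (hf : ContinuousOn f (closedBox d T U)) {t : ℝ} (ht : t ∈ Icc 0 T) :
    MemLp (fun y : SlicePt d => f (Fin.cons t y)) ∞ (sliceMeasure d U) := by
  have hc : ContinuousOn (fun y : SlicePt d => f (Fin.cons t y)) (sliceCompact d U) :=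
    (continuousOn_slice hf ht).mono fun y hy => ⟨hy.1 0, hy.2 0⟩
  obtain ⟨B, hB⟩ := isCompact_Icc.exists_bound_of_continuousOn hc
  refine memLp_top_of_bound ?_ B (ae_sliceMeasure fun y hy => hB y (sliceDomain_subset hy))
  rw [sliceMeasure_eq]
  exact (hc.mono sliceDomain_subset).aestronglyMeasurable measurableSet_sliceDomain

open Classical in
/-- The curve of slices of a function on the closed box. -/
def sliceCurve (d : ℕ) (U : ℝ) (f : Pt d → ℝ) (t : ℝ) : Lp ℝ ∞ (sliceMeasure d U) :=
  if h : MemLp (fun y : SlicePt d => f (Fin.cons t y)) ∞ (sliceMeasure d U) then h.toLp else 0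

theorem represents_sliceCurve (hf : ContinuousOn f (closedBox d T U)) :
    Represents T (sliceCurve d U f) f := by
  intro t ht
  rw [sliceCurve, dif_pos (memLp_slice hf ht)]
  exact MemLp.coeFn_toLp _

theorem norm_le_of_ae_bound_top {F : Lp ℝ ∞ (sliceMeasure d U)} {B : ℝ} (hB : 0 ≤ B)
    (h : ∀ᵐ y ∂sliceMeasure d U, |F y| ≤ B) : ‖F‖ ≤ B := by
  have := Lp.norm_le_of_ae_bound (f := F) (C := B) hB h
  simpa using this

theorem update_cons_mem {s t : ℝ} (hs : s ∈ Icc 0 T) {y : SlicePt d} (hy : y ∈ sliceDomain d U) :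
    Function.update (Fin.cons t y : Pt d) 0 s ∈ closedBox d T U := by
  rw [Fin.update_cons_zero]
  exact cons_mem_closedBox hs hy.1 hy.2.1

/-- The constant in `TimeLip` is the same for all spatial points, so the pointwise estimate is an
`L^∞` estimate. -/
theorem norm_sliceCurve_sub_le (hK : 0 ≤ K) (hf : ContinuousOn f (closedBox d T U))
    (hl : TimeLip (closedBox d T U) K f) {s t : ℝ} (hs : s ∈ Icc 0 T) (ht : t ∈ Icc 0 T) :
    ‖sliceCurve d U f s - sliceCurve d U f t‖ ≤ K * |s - t| := by
  refine norm_le_of_ae_bound_top (by positivity) ?_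
  filter_upwards [Lp.coeFn_sub (sliceCurve d U f s) (sliceCurve d U f t),
    represents_sliceCurve hf s hs, represents_sliceCurve hf t ht,
    ae_sliceMeasure fun y hy => hl (Fin.cons t y) (cons_mem_closedBox ht hy.1 hy.2.1) s
      (update_cons_mem hs hy)] with y h1 h2 h3 h4
  rw [h1, Pi.sub_apply, h2, h3]
  simpa using h4

theorem continuousOn_sliceCurve (hK : 0 ≤ K) (hf : ContinuousOn f (closedBox d T U))
    (hl : TimeLip (closedBox d T U) K f) : ContinuousOn (sliceCurve d U f) (Icc 0 T) := by
  have : LipschitzOnWith K.toNNReal (sliceCurve d U f) (Icc 0 T) := by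
    refine LipschitzOnWith.of_dist_le_mul fun s hs t ht => ?_
    rw [dist_eq_norm, Real.dist_eq, Real.coe_toNNReal K hK]
    exact norm_sliceCurve_sub_le hK hf hl hs ht
  exact this.continuousOn

theorem HasLipPartials.hasDerivWithinAt_update {h : Fin (d + 2) → Pt d → ℝ}
    (H : HasLipPartials T U K f h) {q : Pt d} (hq : q ∈ closedBox d T U) {s : ℝ}
    (hs : s ∈ Icc 0 T) :
    HasDerivWithinAt (fun s => f (Function.update q 0 s)) (h 0 (Function.update q 0 s))
      (Icc 0 T) s := by
  have h1 := H.hasFDerivWithinAt _ (update_mem_closedBox hq hs)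
  have h2 : HasDerivWithinAt (fun s => Function.update q 0 s) (Pi.single 0 1) (Icc 0 T) s :=
    (hasDerivAt_update q 0 s).hasDerivWithinAt
  have := h1.comp_hasDerivWithinAt s h2 fun r hr => update_mem_closedBox hq hr
  rwa [coeffForm_single] at this

/-- Mean value inequality for `f` minus its linear part in time, whose derivative is small by the
Lipschitz bound on `h 0`. The remainder is uniform in `q`, which is what differentiability of the
curve in `L^∞` requires. -/
theorem HasLipPartials.time_taylor {h : Fin (d + 2) → Pt d → ℝ} (hK : 0 ≤ K)
    (H : HasLipPartials T U K f h) {q : Pt d} (hq : q ∈ closedBox d T U) {s : ℝ}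
    (hs : s ∈ Icc 0 T) :
    |f (Function.update q 0 s) - f q - (s - q 0) * h 0 q| ≤ K * |s - q 0| * |s - q 0| := by
  have h0 : q 0 ∈ Icc 0 T := ⟨hq.1, hq.2.1⟩
  have hsub : uIcc (q 0) s ⊆ Icc 0 T := ordConnected_Icc.uIcc_subset h0 hs
  have hd : ∀ r ∈ uIcc (q 0) s, HasDerivWithinAt
      (fun r => f (Function.update q 0 r) - (r - q 0) * h 0 q)
      (h 0 (Function.update q 0 r) - h 0 q) (uIcc (q 0) s) r := by
    intro r hr
    have h1 := (H.hasDerivWithinAt_update hq (hsub hr)).mono hsub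
    have h2 : HasDerivWithinAt (fun r => (r - q 0) * h 0 q) (h 0 q) (uIcc (q 0) s) r := by
      simpa using (((hasDerivAt_id r).sub_const (q 0)).mul_const (h 0 q)).hasDerivWithinAt
    exact h1.sub h2
  have hb : ∀ r ∈ uIcc (q 0) s, ‖h 0 (Function.update q 0 r) - h 0 q‖ ≤ K * |s - q 0| := by
    intro r hr
    refine (H.timeLip_partial 0 q hq r (update_mem_closedBox hq (hsub hr))).trans ?_
    exact mul_le_mul_of_nonneg_left (abs_sub_left_of_mem_uIcc hr) hK
  have := Convex.norm_image_sub_le_of_norm_hasDerivWithin_le hd hb (convex_uIcc _ _)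
    left_mem_uIcc right_mem_uIcc
  rw [Real.norm_eq_abs, Real.norm_eq_abs] at this
  simpa [sub_right_comm] using this

theorem HasLipPartials.hasDerivWithinAt_sliceCurve {h : Fin (d + 2) → Pt d → ℝ} (hK : 0 ≤ K)
    (H : HasLipPartials T U K f h) {t : ℝ} (ht : t ∈ Icc 0 T) :
    HasDerivWithinAt (sliceCurve d U f) (sliceCurve d U (h 0) t) (Icc 0 T) t := by
  rw [hasDerivWithinAt_iff_isLittleO]
  have h1 : (fun s => sliceCurve d U f s - sliceCurve d U f t - (s - t) • sliceCurve d U (h 0) t)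
      =O[𝓝[Icc 0 T] t] fun s => (s - t) * (s - t) := by
    refine Asymptotics.IsBigO.of_bound K ?_
    filter_upwards [self_mem_nhdsWithin] with s hs
    rw [norm_mul, Real.norm_eq_abs, ← mul_assoc]
    refine norm_le_of_ae_bound_top (by positivity) ?_
    filter_upwards [
      Lp.coeFn_sub (sliceCurve d U f s - sliceCurve d U f t) ((s - t) • sliceCurve d U (h 0) t),
      Lp.coeFn_sub (sliceCurve d U f s) (sliceCurve d U f t),
      Lp.coeFn_smul (s - t) (sliceCurve d U (h 0) t),
      represents_sliceCurve H.continuousOn s hs, represents_sliceCurve H.continuousOn t ht,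
      represents_sliceCurve (H.continuousOn_partial 0) t ht,
      ae_sliceMeasure fun y hy =>
        H.time_taylor hK (cons_mem_closedBox (y := y) ht hy.1 hy.2.1) hs]
      with y e1 e2 e3 e4 e5 e6 e7
    rw [e1, Pi.sub_apply, e2, Pi.sub_apply, e3, Pi.smul_apply, e4, e5, e6, smul_eq_mul]
    simpa using e7
  refine h1.trans_isLittleO ?_
  have h2 : (fun s => s - t) =o[𝓝[Icc 0 T] t] fun _ => (1 : ℝ) := by
    rw [Asymptotics.isLittleO_one_iff]
    have : Continuous fun s : ℝ => s - t := by fun_prop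
    simpa [ContinuousWithinAt] using this.continuousWithinAt (s := Icc 0 T) (x := t)
  simpa using h2.mul_isBigO (Asymptotics.isBigO_refl (fun s => s - t) _)

theorem HasLipPartials.inCOneLInfty {h : Fin (d + 2) → Pt d → ℝ} (hT : 0 < T) (hK : 0 ≤ K)
    (H : HasLipPartials T U K f h) : InCOneLInfty T U f := by
  have hd := fun t (ht : t ∈ Icc 0 T) => H.hasDerivWithinAt_sliceCurve hK ht
  have hu : UniqueDiffOn ℝ (Icc 0 T) := uniqueDiffOn_Icc hT
  refine ⟨sliceCurve d U f, represents_sliceCurve H.continuousOn,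
    (contDiffOn_one_iff_derivWithin hu).2 ⟨fun t ht => (hd t ht).differentiableWithinAt, ?_⟩⟩
  exact (continuousOn_sliceCurve hK (H.continuousOn_partial 0) (H.timeLip_partial 0)).congr
    fun t ht => (hd t ht).derivWithin (hu t ht)

/-! ### Weak partial derivatives on the slices. -/

theorem isOpen_strip : IsOpen (strip d U) :=
  (isOpen_lt continuous_const (continuous_apply 0)).inter
    (isOpen_lt (continuous_apply 0) continuous_const)

/-- Nothing is known about `g` and `h` outside `s`. All products are supported in the compact set
`tsupport φ ⊆ s`, which gives integrability, and integration by parts needs the line derivative of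
`g` only there. -/
theorem integral_mul_fderiv_eq_neg_of_support_subset {E : Type*} [NormedAddCommGroup E]
    [NormedSpace ℝ E] [FiniteDimensional ℝ E] [MeasurableSpace E] [BorelSpace E] (μ : Measure E)
    [μ.IsAddHaarMeasure] {s : Set E} {g h φ : E → ℝ} {v : E} (hg : ContinuousOn g s)
    (hh : ContinuousOn h s) (hd : ∀ y ∈ s, HasLineDerivAt ℝ g (h y) y v)
    (hφ : ContDiff ℝ ∞ φ) (hc : HasCompactSupport φ) (hs : tsupport φ ⊆ s) :
    ∫ y, g y * fderiv ℝ φ y v ∂μ = -∫ y, h y * φ y ∂μ := by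
  have hφ' : Continuous fun y => fderiv ℝ φ y v :=
    (hφ.continuous_fderiv (by simp)).clm_apply continuous_const
  have hsupp : tsupport (fun y => fderiv ℝ φ y v) ⊆ tsupport φ :=
    (tsupport_fderiv_apply_subset ℝ v)
  have hint : ∀ {a b : E → ℝ}, ContinuousOn a s → Continuous b → tsupport b ⊆ tsupport φ →
      Integrable (fun y => a y * b y) μ := by
    intro a b ha hb hb'
    have hK : IsCompact (tsupport φ) := hc
    have h1 : IntegrableOn (fun y => a y * b y) (tsupport φ) μ :=
      ((ha.mono hs).mul hb.continuousOn).integrableOn_compact hK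
    refine (integrableOn_iff_integrable_of_support_subset ?_).1 h1
    intro y hy
    exact hb' (subset_tsupport b (fun h => hy (by simp [h])))
  have := integral_bilinear_hasLineDerivAt_right_eq_neg_left_of_integrable (μ := μ)
    (f := g) (f' := h) (g := φ) (g' := fun y => fderiv ℝ φ y v) (v := v)
    (B := ContinuousLinearMap.mul ℝ ℝ) (hint hh hφ.continuous le_rfl) (hint hg hφ' hsupp)
    (hint hg hφ.continuous le_rfl) (fun y hy => hd y (hs hy))
    (fun y _ => ((hφ.differentiable (by simp)) y).hasFDerivAt.hasLineDerivAt v)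
  simpa using this

theorem HasLipPartials.hasWeakPartial {h : Fin (d + 2) → Pt d → ℝ}
    (H : HasLipPartials T U K f h) {t : ℝ} (ht : t ∈ Icc 0 T) (j : Fin (d + 1)) :
    HasWeakPartial U j (fun y => f (Fin.cons t y)) (fun y => h j.succ (Fin.cons t y)) := by
  have hsub : strip d U ⊆ {y : SlicePt d | 0 ≤ y 0 ∧ y 0 ≤ U} := fun y hy => ⟨hy.1.le, hy.2.le⟩
  have hg := (continuousOn_slice H.continuousOn ht).mono hsub
  have hh := (continuousOn_slice (H.continuousOn_partial j.succ) ht).mono hsub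
  refine ⟨hg.locallyIntegrableOn isOpen_strip.measurableSet,
    hh.locallyIntegrableOn isOpen_strip.measurableSet, fun φ hφ hc hs => ?_⟩
  refine integral_mul_fderiv_eq_neg_of_support_subset volume hg hh (fun y hy => ?_) hφ hc hs
  have hy' := hsub hy
  have h1 := H.hasFDerivWithinAt _ (cons_mem_closedBox ht hy'.1 hy'.2)
  have h2 : HasDerivAt (fun r : ℝ => (Fin.cons t (y + r • Pi.single j 1) : Pt d))
      (Pi.single j.succ 1) 0 := by
    rw [hasDerivAt_pi]
    intro a
    refine Fin.cases ?_ (fun i => ?_) a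
    · simpa using hasDerivAt_const (0 : ℝ) t
    · have := ((hasDerivAt_id (0 : ℝ)).mul_const ((Pi.single j 1 : SlicePt d) i)).const_add (y i)
      simpa [Pi.single_apply, Fin.succ_inj] using this
  -- A spatial line keeps the time fixed, so it stays in the closed box for small `r` even when `t`
  -- is `0` or `T`. The one-sided derivative therefore gives a two-sided line derivative.
  have h3 : ∀ᶠ r in 𝓝 (0 : ℝ),
      (Fin.cons t (y + r • Pi.single j 1) : Pt d) ∈ closedBox d T U := by
    have hcont : Continuous fun r : ℝ => y + r • (Pi.single j 1 : SlicePt d) := by fun_prop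
    have : ∀ᶠ r in 𝓝 (0 : ℝ), y + r • (Pi.single j 1 : SlicePt d) ∈ strip d U :=
      hcont.continuousAt.eventually_mem (by simpa using isOpen_strip.mem_nhds hy)
    filter_upwards [this] with r hr
    exact cons_mem_closedBox ht (hsub hr).1 (hsub hr).2
  have h1' : HasFDerivWithinAt f (coeffForm fun a => h a (Fin.cons t y)) (closedBox d T U)
      (Fin.cons t (y + (0 : ℝ) • Pi.single j 1)) := by simpa using h1
  have h4 := h1'.comp_hasDerivAt_of_eq (0 : ℝ) h2 h3 rfl
  rw [coeffForm_single] at h4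
  exact h4

theorem HasLipPartials.inCZeroWOneInfty {h : Fin (d + 2) → Pt d → ℝ} (hK : 0 ≤ K)
    (H : HasLipPartials T U K f h) : InCZeroWOneInfty T U f :=
  ⟨⟨sliceCurve d U f, represents_sliceCurve H.continuousOn,
    continuousOn_sliceCurve hK H.continuousOn H.timeLip⟩, fun j =>
    ⟨h j.succ, sliceCurve d U (h j.succ), represents_sliceCurve (H.continuousOn_partial _),
      continuousOn_sliceCurve hK (H.continuousOn_partial _) (H.timeLip_partial _),
      fun _ ht => H.hasWeakPartial ht j⟩⟩

end FunctionSpaces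


/-! ### Diffeomorphisms given by stacking graphs -/

section StackedGraphs

variable {d : ℕ} {T U c K : ℝ}

/-- The point with the given time, eikonal and torus coordinates. -/
def mkPt (t u : ℝ) (θ : Fin d → ℝ) : Pt d := Fin.cons t (Fin.cons u θ : SlicePt d)

/-- The torus coordinates of a point. -/
def torusPart : Pt d →L[ℝ] (Fin d → ℝ) :=
  ContinuousLinearMap.pi fun i => ContinuousLinearMap.proj i.succ.succ

@[simp] theorem torusPart_apply (q : Pt d) (i : Fin d) : torusPart q i = q i.succ.succ := rfl

@[simp] theorem mkPt_zero (t u : ℝ) (θ : Fin d → ℝ) : mkPt t u θ 0 = t := rfl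

@[simp] theorem mkPt_one (t u : ℝ) (θ : Fin d → ℝ) : mkPt t u θ 1 = u := rfl

@[simp] theorem mkPt_succ_succ (t u : ℝ) (θ : Fin d → ℝ) (i : Fin d) :
    mkPt t u θ i.succ.succ = θ i := rfl

@[simp] theorem torusPart_mkPt (t u : ℝ) (θ : Fin d → ℝ) : torusPart (mkPt t u θ) = θ := rfl

theorem pt_ext {p q : Pt d} (h0 : p 0 = q 0) (h1 : p 1 = q 1)
    (h : torusPart p = torusPart q) : p = q := by
  funext a
  refine Fin.cases h0 (fun b => Fin.cases h1 (fun i => congrFun h i) b) a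

theorem mkPt_eta (q : Pt d) : mkPt (q 0) (q 1) (torusPart q) = q := pt_ext rfl rfl rfl

theorem mkPt_add (t u t' u' : ℝ) (θ θ' : Fin d → ℝ) :
    mkPt t u θ + mkPt t' u' θ' = mkPt (t + t') (u + u') (θ + θ') := pt_ext rfl rfl rfl

theorem mkPt_sub (t u t' u' : ℝ) (θ θ' : Fin d → ℝ) :
    mkPt t u θ - mkPt t' u' θ' = mkPt (t - t') (u - u') (θ - θ') := pt_ext rfl rfl rfl

theorem smul_mkPt (s t u : ℝ) (θ : Fin d → ℝ) : s • mkPt t u θ = mkPt (s * t) (s * u) (s • θ) :=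
  pt_ext rfl rfl rfl

theorem norm_pt_le {q : Pt d} {B : ℝ} (hB : 0 ≤ B) (h0 : |q 0| ≤ B) (h1 : |q 1| ≤ B)
    (h : ‖torusPart q‖ ≤ B) : ‖q‖ ≤ B := by
  refine (pi_norm_le_iff_of_nonneg hB).2 fun a => ?_
  refine Fin.cases h0 (fun b => Fin.cases h1 (fun i => ?_) b) a
  exact (norm_le_pi_norm (torusPart q) i).trans h

theorem norm_torusPart_le (q : Pt d) : ‖torusPart q‖ ≤ ‖q‖ :=
  (pi_norm_le_iff_of_nonneg (norm_nonneg _)).2 fun i => norm_le_pi_norm q i.succ.succ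

/-- The inclusion of the torus coordinates. -/
def torusIncl : (Fin d → ℝ) →L[ℝ] Pt d :=
  LinearMap.toContinuousLinearMap
    { toFun := fun θ => mkPt 0 0 θ
      map_add' := fun _ _ => by simp [mkPt_add]
      map_smul' := fun _ _ => by simp [smul_mkPt] }

@[simp] theorem torusIncl_apply (θ : Fin d → ℝ) : torusIncl θ = mkPt 0 0 θ := rfl

theorem mkPt_mem_closedBox {t u : ℝ} (ht : t ∈ Icc 0 T) (hu : u ∈ Icc 0 U) (θ : Fin d → ℝ) :
    mkPt t u θ ∈ closedBox d T U :=
  ⟨ht.1, ht.2, hu.1, hu.2⟩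

theorem hasDerivAt_mkPt (t u : ℝ) (θ : Fin d → ℝ) :
    HasDerivAt (fun u => mkPt t u θ) (mkPt 0 1 0) u := by
  rw [hasDerivAt_pi]
  intro a
  refine Fin.cases (hasDerivAt_const _ _) (fun b => ?_) a
  exact Fin.cases (hasDerivAt_id _) (fun i => hasDerivAt_const _ _) b

theorem hasFDerivAt_mkPt (t u : ℝ) (θ : Fin d → ℝ) :
    HasFDerivAt (fun θ => mkPt t u θ) torusIncl θ := by
  have : (fun θ : Fin d → ℝ => mkPt t u θ) = fun θ => torusIncl θ + mkPt t u 0 := by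
    funext θ; simp [mkPt_add]
  rw [this]
  exact (torusIncl.hasFDerivAt).add_const _

/-- A map that preserves time, is a small perturbation of the identity in the torus directions, and
maps the level sets of the eikonal coordinate to graphs over the torus that move strictly
monotonically. -/
structure IsStackedGraphMap (T U c K : ℝ) (F : Pt d → Pt d) (F' : Pt d → Pt d →L[ℝ] Pt d) :
    Prop where
  time_eq : ∀ q ∈ closedBox d T U, F q 0 = q 0
  hasFDerivWithinAt : ∀ q ∈ closedBox d T U, HasFDerivWithinAt F (F' q) (closedBox d T U) q
  continuousOn_deriv : ContinuousOn F' (closedBox d T U)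
  bound : ∀ q ∈ closedBox d T U, ‖F' q (mkPt 0 1 0)‖ ≤ K
  torus : ∀ q ∈ closedBox d T U, ∀ θ, ‖torusPart (F' q (mkPt 0 0 θ)) - θ‖ ≤ 1 / 2 * ‖θ‖
  transversal : ∀ q ∈ closedBox d T U, ∀ θ : Fin d → ℝ,
    F' q (mkPt 0 1 θ) 1 ≤ -c + ‖torusPart (F' q (mkPt 0 1 θ))‖
  equivariant : ∀ q ∈ closedBox d T U, ∀ m : Fin d → ℤ,
    F (q + mkPt 0 0 fun i => (m i : ℝ)) = F q + mkPt 0 0 fun i => (m i : ℝ)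

namespace IsStackedGraphMap

variable {F : Pt d → Pt d} {F' : Pt d → Pt d →L[ℝ] Pt d}

theorem continuousOn (H : IsStackedGraphMap T U c K F F') : ContinuousOn F (closedBox d T U) :=
  fun q hq => (H.hasFDerivWithinAt q hq).continuousWithinAt

/-- At fixed `(t, u)` the torus part of `F` minus the identity has derivative at most `1/2` on all
of `ℝ^d`. So the torus part is a bijection of `ℝ^d`, and the image of each level set of `u` is a
graph. -/
theorem norm_torus_sub_sub_le (H : IsStackedGraphMap T U c K F F') {t u : ℝ} (ht : t ∈ Icc 0 T)
    (hu : u ∈ Icc 0 U) (θ θ' : Fin d → ℝ) :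
    ‖torusPart (F (mkPt t u θ)) - torusPart (F (mkPt t u θ')) - (θ - θ')‖ ≤
      1 / 2 * ‖θ - θ'‖ := by
  have hd : ∀ θ ∈ (univ : Set (Fin d → ℝ)), HasFDerivWithinAt
      (fun θ => torusPart (F (mkPt t u θ)) - θ)
      (torusPart ∘L (F' (mkPt t u θ) ∘L torusIncl) - ContinuousLinearMap.id ℝ _) univ θ := by
    intro θ _
    have h1 := (H.hasFDerivWithinAt _ (mkPt_mem_closedBox ht hu θ)).comp θ
      (hasFDerivAt_mkPt t u θ).hasFDerivWithinAt (s := univ)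
      (fun θ _ => mkPt_mem_closedBox ht hu θ)
    exact ((torusPart (d := d)).hasFDerivAt.comp_hasFDerivWithinAt θ h1).sub
      (hasFDerivWithinAt_id θ univ)
  have hb : ∀ θ ∈ (univ : Set (Fin d → ℝ)),
      ‖torusPart ∘L (F' (mkPt t u θ) ∘L torusIncl) - ContinuousLinearMap.id ℝ _‖ ≤ 1 / 2 :=
    fun θ _ => ContinuousLinearMap.opNorm_le_bound _ (by norm_num) fun z =>
      H.torus _ (mkPt_mem_closedBox ht hu θ) z
  have := Convex.norm_image_sub_le_of_norm_hasFDerivWithin_le hd hb convex_univ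
    (mem_univ θ') (mem_univ θ)
  rwa [sub_sub_sub_comm] at this

theorem norm_sub_le_torus (H : IsStackedGraphMap T U c K F F') {t u : ℝ} (ht : t ∈ Icc 0 T)
    (hu : u ∈ Icc 0 U) (θ θ' : Fin d → ℝ) :
    ‖θ - θ'‖ ≤ 2 * ‖torusPart (F (mkPt t u θ)) - torusPart (F (mkPt t u θ'))‖ := by
  have h1 := H.norm_torus_sub_sub_le ht hu θ θ'
  have h2 := norm_sub_norm_le (θ - θ')
    (torusPart (F (mkPt t u θ)) - torusPart (F (mkPt t u θ')))
  rw [norm_sub_rev] at h1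
  linarith

theorem exists_torus_eq (H : IsStackedGraphMap T U c K F F') {t u : ℝ} (ht : t ∈ Icc 0 T)
    (hu : u ∈ Icc 0 U) (x : Fin d → ℝ) : ∃ θ, torusPart (F (mkPt t u θ)) = x := by
  have h1 : ApproximatesLinearOn (fun θ => torusPart (F (mkPt t u θ)))
      ((ContinuousLinearEquiv.refl ℝ (Fin d → ℝ) : (Fin d → ℝ) ≃L[ℝ] (Fin d → ℝ)) :
        (Fin d → ℝ) →L[ℝ] (Fin d → ℝ)) univ (1 / 2) := by
    intro θ _ θ' _
    simpa using H.norm_torus_sub_sub_le ht hu θ θ'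
  refine h1.surjective ?_ x
  -- For `d = 0` the identity has norm `0` rather than `1`, so the comparison of `1/2` with the
  -- inverse norm is made only in the nontrivial case.
  rcases subsingleton_or_nontrivial (Fin d → ℝ) with h | h
  · exact Or.inl h
  · right
    have : ‖((ContinuousLinearEquiv.refl ℝ (Fin d → ℝ)).symm :
        (Fin d → ℝ) →L[ℝ] (Fin d → ℝ))‖₊ = 1 := by
      ext
      simp only [coe_nnnorm, NNReal.coe_one]
      exact ContinuousLinearMap.norm_id
    rw [this, inv_one]
    exact NNReal.half_lt_self one_ne_zero

theorem norm_sub_le_of_eikonal (H : IsStackedGraphMap T U c K F F') {t u u' : ℝ}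
    (ht : t ∈ Icc 0 T) (hu : u ∈ Icc 0 U) (hu' : u' ∈ Icc 0 U) (θ : Fin d → ℝ) :
    ‖F (mkPt t u' θ) - F (mkPt t u θ)‖ ≤ K * |u' - u| :=
  Convex.norm_image_sub_le_of_norm_hasDerivWithin_le
    (fun _ hr => (H.hasFDerivWithinAt _ (mkPt_mem_closedBox ht hr θ)).comp_hasDerivWithinAt _
      (hasDerivAt_mkPt t _ θ).hasDerivWithinAt fun _ hs => mkPt_mem_closedBox ht hs θ)
    (fun _ hr => H.bound _ (mkPt_mem_closedBox ht hr θ)) (convex_Icc 0 U) hu hu'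

/-- Changing `u` moves the image by at most `K * |u' - u|`, and the torus coordinate needed to
compensate is at most twice that. Hence the curve over a fixed torus point is Lipschitz in `u`. -/
theorem norm_sub_le_of_torus_eq (H : IsStackedGraphMap T U c K F F') {t u u' : ℝ}
    (ht : t ∈ Icc 0 T) (hu : u ∈ Icc 0 U) (hu' : u' ∈ Icc 0 U) {θ θ' : Fin d → ℝ}
    (h : torusPart (F (mkPt t u θ)) = torusPart (F (mkPt t u' θ'))) :
    ‖θ' - θ‖ ≤ 2 * (K * |u' - u|) := by
  refine (H.norm_sub_le_torus ht hu' θ' θ).trans ?_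
  rw [← h, ← map_sub]
  have := (norm_torusPart_le _).trans (H.norm_sub_le_of_eikonal ht hu hu' θ)
  rw [map_sub, norm_sub_rev, ← map_sub] at this
  linarith

theorem bound_nonneg (H : IsStackedGraphMap T U c K F F') {q : Pt d} (hq : q ∈ closedBox d T U) :
    0 ≤ K := (norm_nonneg _).trans (H.bound q hq)

/-- Along a curve on which the torus components of the image are constant, the remaining spatial
component of the image is strictly decreasing. -/
theorem eventually_slope_lt (H : IsStackedGraphMap T U c K F F') {t u : ℝ} (ht : t ∈ Icc 0 T)
    (hu : u ∈ Ico 0 U) {θ : ℝ → Fin d → ℝ}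
    (hθ : ∀ r ∈ Icc 0 U, torusPart (F (mkPt t r (θ r))) = torusPart (F (mkPt t u (θ u))))
    {r : ℝ} (hr : -c < r) :
    ∀ᶠ z in 𝓝[>] u, slope (fun z => F (mkPt t z (θ z)) 1) u z < r := by
  have huI : u ∈ Icc 0 U := ⟨hu.1, hu.2.le⟩
  set q := mkPt t u (θ u) with hq
  have hqB : q ∈ closedBox d T U := mkPt_mem_closedBox ht huI _
  have hK := H.bound_nonneg hqB
  -- Then `r = -c + 4 * δ`. One `δ` is spent on the torus part in the transversality bound and one
  -- on the first component of the remainder, leaving the slope at most `-c + 2 * δ < r`.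
  set δ := (r + c) / 4 with hδ
  have hδ0 : 0 < δ := by simp only [hδ]; linarith
  have hlip : ∀ z ∈ Icc 0 U, ‖mkPt t z (θ z) - q‖ ≤ (1 + 2 * K) * |z - u| := by
    intro z hz
    have h1 := H.norm_sub_le_of_torus_eq ht huI hz (hθ z hz).symm
    rw [hq, mkPt_sub]
    have h2 : 0 ≤ K * |z - u| := by positivity
    refine norm_pt_le (by positivity) (by simp; positivity) ?_ ?_
    · simp only [mkPt_one]; nlinarith [abs_nonneg (z - u)]
    · simp only [torusPart_mkPt]; nlinarith [abs_nonneg (z - u)]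
  have hI : ∀ᶠ z in 𝓝[>] u, z ∈ Ioc u U := Ioc_mem_nhdsGT hu.2
  have hmem : ∀ᶠ z in 𝓝[>] u, z ∈ Icc 0 U := by
    filter_upwards [hI] with z hz using ⟨hu.1.trans hz.1.le, hz.2⟩
  have htend : Tendsto (fun z => mkPt t z (θ z)) (𝓝[>] u) (𝓝[closedBox d T U] q) := by
    refine tendsto_nhdsWithin_iff.2 ⟨?_, ?_⟩
    · rw [tendsto_iff_norm_sub_tendsto_zero]
      have h0 : Tendsto (fun z => (1 + 2 * K) * |z - u|) (𝓝[>] u) (𝓝 0) := by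
        have : Continuous fun z => (1 + 2 * K) * |z - u| := by fun_prop
        simpa [ContinuousWithinAt] using this.continuousWithinAt (s := Ioi u) (x := u)
      refine squeeze_zero' (Eventually.of_forall fun _ => norm_nonneg _) ?_ h0
      filter_upwards [hmem] with z hz using hlip z hz
    · filter_upwards [hmem] with z hz using mkPt_mem_closedBox ht hz _
  have hlo := (H.hasFDerivWithinAt q hqB).isLittleO.comp_tendsto htend
  have hC : 0 < δ / (1 + 2 * K) := by positivity
  filter_upwards [hI, hmem, hlo.bound hC] with z hzI hz hb
  have hh : 0 < z - u := sub_pos.2 hzI.1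
  set e := F (mkPt t z (θ z)) - F q - F' q (mkPt t z (θ z) - q) with he
  have hb' : ‖e‖ ≤ δ * (z - u) := by
    have h3 := hlip z hz
    rw [abs_of_pos hh] at h3
    calc ‖e‖ ≤ δ / (1 + 2 * K) * ‖mkPt t z (θ z) - q‖ := hb
      _ ≤ δ / (1 + 2 * K) * ((1 + 2 * K) * (z - u)) := by gcongr
      _ = δ * (z - u) := by field_simp
  -- The curve `θ` is only Lipschitz. Its difference quotient replaces a derivative, which is enough
  -- because transversality holds in every direction `(0, 1, β)`.
  set β := (z - u)⁻¹ • (θ z - θ u) with hβ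
  have hdir : mkPt t z (θ z) - q = (z - u) • mkPt 0 1 β := by
    rw [hq, mkPt_sub, smul_mkPt, hβ, smul_smul, mul_inv_cancel₀ hh.ne']
    simp
  have hFe : F (mkPt t z (θ z)) - F q = (z - u) • F' q (mkPt 0 1 β) + e := by
    rw [he, hdir, map_smul]; abel
  -- The torus part of the image is constant along the curve, so the torus part of the linear term
  -- cancels that of the remainder.
  have htor : ‖torusPart (F' q (mkPt 0 1 β))‖ ≤ δ := by
    have h4 : torusPart ((z - u) • F' q (mkPt 0 1 β) + e) = 0 := by
      rw [← hFe, map_sub, hθ z hz, hq, sub_self]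
    rw [map_add, map_smul] at h4
    have h5 : (z - u) * ‖torusPart (F' q (mkPt 0 1 β))‖ ≤ δ * (z - u) := by
      rw [← abs_of_pos hh, ← Real.norm_eq_abs, ← norm_smul, eq_neg_of_add_eq_zero_left h4,
        norm_neg, Real.norm_eq_abs, abs_of_pos hh]
      exact (norm_torusPart_le e).trans hb'
    nlinarith
  have htr := H.transversal q hqB β
  have h6 : F (mkPt t z (θ z)) 1 - F q 1 = (z - u) * F' q (mkPt 0 1 β) 1 + e 1 := by
    have := congrFun hFe 1
    simpa using this
  have h7 : e 1 ≤ δ * (z - u) := ((le_abs_self _).trans (norm_le_pi_norm e 1)).trans hb'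
  rw [slope_def_field, h6, div_lt_iff₀ hh]
  have h8 : F' q (mkPt 0 1 β) 1 ≤ -c + δ := htr.trans (by linarith)
  have h9 : (z - u) * F' q (mkPt 0 1 β) 1 ≤ (z - u) * (-c + δ) :=
    mul_le_mul_of_nonneg_left h8 hh.le
  have h10 : r = -c + 4 * δ := by rw [hδ]; ring
  rw [h10]
  nlinarith

/-- Over the common torus point each level `r` has exactly one preimage `θ r`. Along this curve the
first spatial component decreases strictly, so it cannot return to the same value. -/
theorem not_lt_of_eq (H : IsStackedGraphMap T U c K F F') (hc : 0 < c) {t u₁ u₂ : ℝ}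
    (ht : t ∈ Icc 0 T) (h₁ : u₁ ∈ Icc 0 U) (h₂ : u₂ ∈ Icc 0 U) {θ₁ θ₂ : Fin d → ℝ}
    (h : F (mkPt t u₁ θ₁) = F (mkPt t u₂ θ₂)) : ¬ u₁ < u₂ := by
  intro hlt
  choose! θ hθ using fun r (hr : r ∈ Icc 0 U) =>
    H.exists_torus_eq ht hr (torusPart (F (mkPt t u₁ θ₁)))
  have e₁ : θ u₁ = θ₁ := by
    have := H.norm_sub_le_torus ht h₁ (θ u₁) θ₁
    rw [hθ u₁ h₁, sub_self, norm_zero, mul_zero] at this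
    exact sub_eq_zero.1 (norm_le_zero_iff.1 this)
  have e₂ : θ u₂ = θ₂ := by
    have := H.norm_sub_le_torus ht h₂ (θ u₂) θ₂
    rw [hθ u₂ h₂, h, sub_self, norm_zero, mul_zero] at this
    exact sub_eq_zero.1 (norm_le_zero_iff.1 this)
  have hcont : ContinuousOn (fun z => F (mkPt t z (θ z)) 1) (Icc 0 U) := by
    have hθc : ContinuousOn θ (Icc 0 U) := by
      have hK := H.bound_nonneg (mkPt_mem_closedBox ht h₁ θ₁)
      have : LipschitzOnWith (2 * K).toNNReal θ (Icc 0 U) := by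
        refine LipschitzOnWith.of_dist_le_mul fun s hs r hr => ?_
        rw [dist_eq_norm, Real.dist_eq, Real.coe_toNNReal _ (by positivity), mul_assoc]
        exact H.norm_sub_le_of_torus_eq ht hr hs (by rw [hθ r hr, hθ s hs])
      exact this.continuousOn
    have h1 : ContinuousOn (fun z => mkPt t z (θ z)) (Icc 0 U) := by
      refine continuousOn_pi.2 fun a => ?_
      refine Fin.cases continuousOn_const (fun b => ?_) a
      exact Fin.cases continuousOn_id (fun i => continuousOn_pi.1 hθc i) b
    exact (continuous_apply 1).comp_continuousOn
      (H.continuousOn.comp h1 fun z hz => mkPt_mem_closedBox ht hz _)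
  have hsub : Icc u₁ u₂ ⊆ Icc 0 U := Icc_subset_Icc h₁.1 h₂.2
  -- The barrier has slope `-(c / 2)`, strictly above the right slope bound `-c` as the comparison
  -- demands, and still negative, which gives the contradiction at `u₂`.
  have key := image_le_of_liminf_slope_right_lt_deriv_boundary'
    (f := fun z => F (mkPt t z (θ z)) 1) (f' := fun _ => -c)
    (B := fun z => F (mkPt t u₁ θ₁) 1 + (z - u₁) * (-(c / 2))) (B' := fun _ => -(c / 2))
    (hcont.mono hsub)
    (fun x hx r hr => by
      have hx' := hsub ⟨hx.1, hx.2.le⟩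
      exact (H.eventually_slope_lt ht ⟨hx'.1, hx.2.trans_le h₂.2⟩
        (fun s hs => by rw [hθ s hs, hθ x hx']) hr).frequently)
    (by simp [e₁]) (by fun_prop)
    (fun x _ => by
      simpa using ((((hasDerivAt_id x).sub_const u₁).mul_const (-(c / 2))).const_add
        (F (mkPt t u₁ θ₁) 1)).hasDerivWithinAt)
    (fun x _ _ => by linarith) (right_mem_Icc.2 hlt.le)
  simp only [e₂, h] at key
  nlinarith

theorem injOn (H : IsStackedGraphMap T U c K F F') (hc : 0 < c) : InjOn F (closedBox d T U) := by
  intro p hp q hq h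
  have h0 : p 0 = q 0 := by rw [← H.time_eq p hp, ← H.time_eq q hq, h]
  have hp0 : p 0 ∈ Icc 0 T := ⟨hp.1, hp.2.1⟩
  have hp1 : p 1 ∈ Icc 0 U := hp.2.2
  have hq1 : q 1 ∈ Icc 0 U := hq.2.2
  have h' : F (mkPt (p 0) (p 1) (torusPart p)) = F (mkPt (p 0) (q 1) (torusPart q)) := by
    rw [mkPt_eta, h0, mkPt_eta, h]
  have h1 : p 1 = q 1 := le_antisymm (not_lt.1 (H.not_lt_of_eq hc hp0 hq1 hp1 h'.symm))
    (not_lt.1 (H.not_lt_of_eq hc hp0 hp1 hq1 h'))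
  refine pt_ext h0 h1 (sub_eq_zero.1 (norm_le_zero_iff.1 ?_))
  refine (H.norm_sub_le_torus hp0 hp1 _ _).trans ?_
  rw [h', h1, sub_self, norm_zero, mul_zero]

theorem proj_eq_iff {p q : Pt d} : proj p = proj q ↔
    ∃ m : Fin d → ℤ, p = q + mkPt 0 0 fun i => (m i : ℝ) := by
  constructor
  · intro h
    have h0 : p 0 = q 0 := congrArg Prod.fst h
    have h1 : p 1 = q 1 := congrArg (fun z => z.2.1) h
    have h2 : ∀ i : Fin d, ∃ m : ℤ, p i.succ.succ = q i.succ.succ + m := by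
      intro i
      have := congrFun (congrArg (fun z => z.2.2) h) i
      have h3 : ((p i.succ.succ - q i.succ.succ : ℝ) : UnitAddCircle) = 0 := by
        rw [AddCircle.coe_sub]; exact sub_eq_zero.2 this
      obtain ⟨m, hm⟩ := (AddCircle.coe_eq_zero_iff (1 : ℝ)).1 h3
      refine ⟨m, ?_⟩
      simp at hm
      linarith
    choose m hm using h2
    exact ⟨m, pt_ext (by simp [h0]) (by simp [h1]) (funext fun i => by simpa using hm i)⟩
  · rintro ⟨m, rfl⟩
    refine Prod.ext (by simp [proj]) (Prod.ext (by simp [proj]) (funext fun i => ?_))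
    simp only [proj, Pi.add_apply, mkPt_succ_succ, AddCircle.coe_add]
    have : ((m i : ℝ) : UnitAddCircle) = 0 :=
      (AddCircle.coe_eq_zero_iff (1 : ℝ)).2 ⟨m i, by simp⟩
    rw [this, add_zero]

theorem add_mkPt_mem_closedBox {q : Pt d} (hq : q ∈ closedBox d T U) (θ : Fin d → ℝ) :
    q + mkPt 0 0 θ ∈ closedBox d T U := by
  simpa [closedBox] using hq

/-- By equivariance `F p = F q + m` reads `F p = F (q + m)`, so injectivity of the lift decides
injectivity on the torus. -/
theorem proj_eq_proj_iff (H : IsStackedGraphMap T U c K F F') (hc : 0 < c) {p q : Pt d}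
    (hp : p ∈ closedBox d T U) (hq : q ∈ closedBox d T U) :
    proj (F p) = proj (F q) ↔ proj p = proj q := by
  rw [proj_eq_iff, proj_eq_iff]
  refine exists_congr fun m => ?_
  rw [← H.equivariant q hq m]
  exact ⟨fun h => H.injOn hc hp (add_mkPt_mem_closedBox hq _) h, fun h => by rw [h]⟩

/-- A kernel vector has no time component since `F` preserves time. A nonzero eikonal component
could be scaled to `1`, and transversality would give `0 ≤ -c`. What remains is a torus vector,
excluded by the bound `1/2`. -/
theorem injective_deriv (H : IsStackedGraphMap T U c K F F') (hT : 0 < T) (hU : 0 < U)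
    (hc : 0 < c) {q : Pt d} (hq : q ∈ closedBox d T U) : Function.Injective (F' q) := by
  refine (injective_iff_map_eq_zero (F' q)).2 fun z hz => ?_
  have h0 : ∀ z, F' q z 0 = z 0 := by
    have hu := uniqueDiffOn_closedBox (d := d) hT hU q hq
    have h1 : HasFDerivWithinAt (fun p => F p 0)
        ((ContinuousLinearMap.proj 0 : Pt d →L[ℝ] ℝ) ∘L F' q) (closedBox d T U) q :=
      (ContinuousLinearMap.proj 0 : Pt d →L[ℝ] ℝ).hasFDerivAt.comp_hasFDerivWithinAt q
        (H.hasFDerivWithinAt q hq)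
    have h2 : HasFDerivWithinAt (fun p => F p 0)
        (ContinuousLinearMap.proj 0 : Pt d →L[ℝ] ℝ) (closedBox d T U) q :=
      ((ContinuousLinearMap.proj 0 : Pt d →L[ℝ] ℝ).hasFDerivWithinAt).congr
        (fun p hp => H.time_eq p hp) (H.time_eq q hq)
    intro z
    exact congrArg (fun l : Pt d →L[ℝ] ℝ => l z) (hu.eq h1 h2)
  have hz0 : z 0 = 0 := by rw [← h0 z, hz]; rfl
  have hz1 : z 1 = 0 := by
    by_contra hne
    have e : F' q (mkPt 0 1 ((z 1)⁻¹ • torusPart z)) = 0 := by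
      have : mkPt 0 1 ((z 1)⁻¹ • torusPart z) = (z 1)⁻¹ • z := by
        refine pt_ext ?_ ?_ ?_ <;> simp [hz0, hne]
      rw [this, map_smul, hz, smul_zero]
    have := H.transversal q hq ((z 1)⁻¹ • torusPart z)
    rw [e] at this
    simp at this
    linarith
  have hz' : z = mkPt 0 0 (torusPart z) := pt_ext hz0 hz1 rfl
  have := H.torus q hq (torusPart z)
  rw [← hz', hz, map_zero, zero_sub, norm_neg] at this
  have h3 : torusPart z = 0 := norm_le_zero_iff.1 (by linarith)
  rw [hz', h3]
  exact pt_ext rfl rfl rfl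

/-- The lift is proper: the torus coordinates of `p` are bounded in terms of `F p`, so near `F q`
the inverse takes values in a compact set. Any cluster point `z` satisfies `F z = F q`, hence `z =
q`. -/
theorem tendsto_of_leftInvOn (H : IsStackedGraphMap T U c K F F') (hc : 0 < c) {G : Pt d → Pt d}
    (hG : LeftInvOn G F (closedBox d T U)) {q : Pt d} (hq : q ∈ closedBox d T U) :
    Tendsto G (𝓝[F '' closedBox d T U] F q) (𝓝 q) := by
  obtain ⟨B, hB⟩ : ∃ B, ∀ z ∈ Icc (0 : ℝ) T ×ˢ Icc (0 : ℝ) U,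
      ‖torusPart (F (mkPt z.1 z.2 0))‖ ≤ B := by
    refine (isCompact_Icc.prod isCompact_Icc).exists_bound_of_continuousOn ?_
    refine (torusPart (d := d)).continuous.comp_continuousOn (H.continuousOn.comp ?_
      fun z hz => mkPt_mem_closedBox hz.1 hz.2 _)
    refine continuousOn_pi.2 fun a => Fin.cases continuousOn_fst (fun b => ?_) a
    exact Fin.cases continuousOn_snd (fun i => continuousOn_const) b
  have hbound : ∀ p ∈ closedBox d T U, ‖torusPart p‖ ≤ 2 * (‖F p‖ + B) := by
    intro p hp
    have hp0 : p 0 ∈ Icc 0 T := ⟨hp.1, hp.2.1⟩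
    have hp1 : p 1 ∈ Icc 0 U := hp.2.2
    have h1 := H.norm_sub_le_torus hp0 hp1 (torusPart p) 0
    rw [mkPt_eta, sub_zero] at h1
    have h2 := norm_sub_le (torusPart (F p)) (torusPart (F (mkPt (p 0) (p 1) 0)))
    have h3 := hB (p 0, p 1) ⟨hp0, hp1⟩
    have h4 := norm_torusPart_le (F p)
    dsimp only at h3
    linarith
  set R := 2 * (‖F q‖ + 1 + B) with hR
  have hcpt : IsCompact (closedBox d T U ∩ {p | ‖torusPart p‖ ≤ R}) := by
    refine Metric.isCompact_of_isClosed_isBounded (isClosed_closedBox.inter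
      (isClosed_le (torusPart (d := d)).continuous.norm continuous_const)) ?_
    refine (Metric.isBounded_iff_subset_closedBall 0).2 ⟨max (max |T| |U|) |R|, ?_⟩
    rintro p ⟨hp, hpR⟩
    rw [mem_closedBall_zero_iff]
    refine norm_pt_le (by positivity) ?_ ?_ ?_
    · rw [abs_of_nonneg hp.1]
      exact (hp.2.1.trans (le_abs_self T)).trans ((le_max_left _ _).trans (le_max_left _ _))
    · rw [abs_of_nonneg hp.2.2.1]
      exact (hp.2.2.2.trans (le_abs_self U)).trans ((le_max_right _ _).trans (le_max_left _ _))
    · exact (le_trans hpR (le_abs_self R)).trans (le_max_right _ _)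
  have hmem : ∀ᶠ x in 𝓝[F '' closedBox d T U] F q,
      G x ∈ closedBox d T U ∩ {p | ‖torusPart p‖ ≤ R} ∧ F (G x) = x := by
    have hball : ∀ᶠ x in 𝓝[F '' closedBox d T U] F q, ‖x‖ < ‖F q‖ + 1 := by
      refine nhdsWithin_le_nhds ?_
      exact (continuous_norm.tendsto (F q)).eventually_lt_const (by linarith)
    filter_upwards [hball, self_mem_nhdsWithin] with x hx hxm
    obtain ⟨p, hp, rfl⟩ := hxm
    rw [hG hp]
    refine ⟨⟨hp, ?_⟩, rfl⟩
    have := hbound p hp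
    change ‖torusPart p‖ ≤ R
    rw [hR]; linarith
  refine hcpt.le_nhds_of_unique_clusterPt (hmem.mono fun x hx => hx.1) fun z hz hcl => ?_
  by_contra hne
  have hFz : F z ≠ F q := fun h => hne (H.injOn hc hz.1 hq h)
  obtain ⟨V, W, hV, hW, hzV, hqW, hVW⟩ := t2_separation hFz
  have hVn : F ⁻¹' V ∈ 𝓝[closedBox d T U] z :=
    (H.continuousOn z hz.1) (hV.mem_nhds hzV)
  have hfr : ∃ᶠ y in map G (𝓝[F '' closedBox d T U] F q), y ∈ closedBox d T U → y ∈ F ⁻¹' V :=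
    hcl.frequently (mem_nhdsWithin_iff_eventually.1 hVn)
  have hfr' : ∃ᶠ x in 𝓝[F '' closedBox d T U] F q, G x ∈ closedBox d T U → G x ∈ F ⁻¹' V := hfr
  have hWn : ∀ᶠ x in 𝓝[F '' closedBox d T U] F q, x ∈ W :=
    nhdsWithin_le_nhds (hW.mem_nhds hqW)
  obtain ⟨x, hx1, ⟨hx2, hx3⟩, hx4⟩ := (hfr'.and_eventually (hmem.and hWn)).exists
  have := hx1 hx2.1
  rw [mem_preimage, hx3] at this
  exact hVW.le_bot ⟨this, hx4⟩

/-- A continuous left inverse of a map with invertible derivative is differentiable with the inverse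
derivative. That derivative is continuous because inversion of linear maps is. -/
theorem isDiffeoOntoImage (H : IsStackedGraphMap T U c K F F') (hT : 0 < T) (hU : 0 < U)
    (hc : 0 < c) : IsDiffeoOntoImage 1 F (closedBox d T U) := by
  have hsucc := fun (f : Pt d → Pt d) (s : Set (Pt d)) =>
    contDiffOn_succ_iff_hasFDerivWithinAt (𝕜 := ℝ) (n := 0) (f := f) (s := s) (by simp)
  simp only [zero_add] at hsucc
  refine ⟨?_, fun p hp q hq => H.proj_eq_proj_iff hc hp hq,
    Function.invFunOn F (closedBox d T U), ?_, (H.injOn hc).leftInvOn_invFunOn⟩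
  · refine (hsucc _ _).2 fun q hq => ⟨closedBox d T U, ?_, by simp, F', H.hasFDerivWithinAt,
      contDiffOn_zero.2 H.continuousOn_deriv⟩
    rw [insert_eq_of_mem hq]; exact self_mem_nhdsWithin
  · have hG := (H.injOn hc).leftInvOn_invFunOn
    set G := Function.invFunOn F (closedBox d T U)
    have hcont : ∀ q ∈ closedBox d T U,
        Tendsto G (𝓝[F '' closedBox d T U] F q) (𝓝[closedBox d T U] q) := by
      intro q hq
      refine tendsto_nhdsWithin_iff.2 ⟨H.tendsto_of_leftInvOn hc hG hq, ?_⟩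
      filter_upwards [self_mem_nhdsWithin] with x hx
      obtain ⟨p, hp, rfl⟩ := hx
      rwa [hG hp]
    have hequiv : ∀ q ∈ closedBox d T U, ∃ e : Pt d ≃L[ℝ] Pt d, (e : Pt d →L[ℝ] Pt d) = F' q := by
      intro q hq
      refine ⟨(LinearEquiv.ofInjectiveEndo (F' q : Pt d →ₗ[ℝ] Pt d)
        (H.injective_deriv hT hU hc hq)).toContinuousLinearEquiv, ?_⟩
      ext; rfl
    refine (hsucc _ _).2 fun x hx => ⟨F '' closedBox d T U, ?_, by simp,
      fun x => ContinuousLinearMap.inverse (F' (G x)), ?_, contDiffOn_zero.2 ?_⟩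
    · rw [insert_eq_of_mem hx]; exact self_mem_nhdsWithin
    · rintro _ ⟨q, hq, rfl⟩
      obtain ⟨e, he⟩ := hequiv q hq
      have hinv : ContinuousLinearMap.inverse (F' (G (F q))) = (e.symm : Pt d →L[ℝ] Pt d) := by
        rw [hG hq, ← he, ContinuousLinearMap.inverse_equiv]
      change HasFDerivWithinAt G (ContinuousLinearMap.inverse (F' (G (F q)))) _ _
      rw [hinv]
      refine HasFDerivWithinAt.of_local_left_inverse (f := F) (t := closedBox d T U) ?_ ?_
        (mem_image_of_mem F hq) ?_
      · rw [hG hq]; exact hcont q hq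
      · rw [hG hq, he]; exact H.hasFDerivWithinAt q hq
      · filter_upwards [self_mem_nhdsWithin] with x hx
        obtain ⟨p, hp, rfl⟩ := hx
        rw [hG hp]
    · rintro _ ⟨q, hq, rfl⟩
      obtain ⟨e, he⟩ := hequiv q hq
      have h1 : Tendsto (fun x => F' (G x)) (𝓝[F '' closedBox d T U] F q) (𝓝 (F' q)) :=
        (H.continuousOn_deriv q hq).tendsto.comp (hcont q hq)
      have h2 : ContinuousAt ContinuousLinearMap.inverse (F' q) := by
        rw [← he]
        exact (contDiffAt_map_inverse (n := 0) e).continuousAt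
      have h3 := h2.tendsto.comp h1
      rw [ContinuousWithinAt, hG hq]
      exact h3

end IsStackedGraphMap

end StackedGraphs


/-! ### Extension of the change of variables map -/

section Extension

variable {d : ℕ} {T U : ℝ} {E : Type*} [NormedAddCommGroup E] [NormedSpace ℝ E]

theorem mkPt_eq_sum (u : ℝ) (θ : Fin d → ℝ) :
    (mkPt 0 u θ : Pt d) = u • Pi.single 1 1 + ∑ i, θ i • Pi.single i.succ.succ 1 := by
  refine pt_ext ?_ ?_ (funext fun j => ?_)
  · simp [Finset.sum_apply, (Fin.succ_ne_zero _).symm]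
  · have : ∀ i : Fin d, (1 : Fin (d + 2)) ≠ i.succ.succ := fun i => by
      rw [← Fin.succ_zero_eq_one]; exact fun h => (Fin.succ_ne_zero i) (Fin.succ_injective _ h).symm
    simp [Finset.sum_apply, this]
  · have : ∀ i : Fin d, i.succ.succ ≠ (1 : Fin (d + 2)) := fun i => by
      rw [← Fin.succ_zero_eq_one]; exact fun h => (Fin.succ_ne_zero i) (Fin.succ_injective _ h)
    simp [Finset.sum_apply, Pi.single_apply, this]

theorem fderivWithin_mkPt (f : Pt d → E) (q : Pt d) (u : ℝ) (θ : Fin d → ℝ) :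
    fderivWithin ℝ f (box d T U) q (mkPt 0 u θ) =
      u • boxPartial T U 1 f q + ∑ i, θ i • boxPartial T U i.succ.succ f q := by
  rw [mkPt_eq_sum]
  simp [boxPartial]

theorem succ_succ_ne_one (i : Fin d) : i.succ.succ ≠ (1 : Fin (d + 2)) := by
  rw [← Fin.succ_zero_eq_one]; exact fun h => (Fin.succ_ne_zero i) (Fin.succ_injective _ h)

theorem norm_sum_torus_le {K : ℝ} {f : Pt d → E} {q : Pt d} (θ : Fin d → ℝ)
    (h : ∀ i : Fin d, ‖boxPartial T U i.succ.succ f q‖ ≤ K) :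
    ‖∑ i, θ i • boxPartial T U i.succ.succ f q‖ ≤ d * (‖θ‖ * K) := by
  refine (norm_sum_le _ _).trans ((Finset.sum_le_card_nsmul _ _ (‖θ‖ * K) fun i _ => ?_).trans
    (by simp))
  rw [norm_smul]
  exact mul_le_mul (norm_le_pi_norm θ i) (h i) (norm_nonneg _) (norm_nonneg _)

/-- With `θ = b` this recovers `∂_u = X̆ - ∑ b_i ∂/∂ϑ^i` from controlled directions, at the cost of
a factor `‖b‖`. -/
theorem norm_boxPartial_one_le {K : ℝ} {f : Pt d → E} {q : Pt d} {θ : Fin d → ℝ}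
    (h : ∀ i : Fin d, ‖boxPartial T U i.succ.succ f q‖ ≤ K)
    (hX : ‖fderivWithin ℝ f (box d T U) q (mkPt 0 1 θ)‖ ≤ K) :
    ‖boxPartial T U 1 f q‖ ≤ K + d * (‖θ‖ * K) := by
  rw [fderivWithin_mkPt, one_smul] at hX
  have h1 := norm_sum_torus_le θ h
  have h2 := norm_sub_le (boxPartial T U 1 f q + ∑ i, θ i • boxPartial T U i.succ.succ f q)
    (∑ i, θ i • boxPartial T U i.succ.succ f q)
  rw [add_sub_cancel_right] at h2
  linarith

theorem boxPartial_comp {X : Type*} [NormedAddCommGroup X] [NormedSpace ℝ X] {g : X → E}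
    {s : Pt d → X} (hT : 0 < T) (hU : 0 < U) (hg : ContDiff ℝ ∞ g)
    (hs : ContDiffOn ℝ ∞ s (box d T U)) (a : Fin (d + 2)) {q : Pt d} (hq : q ∈ box d T U) :
    boxPartial T U a (fun q => g (s q)) q = fderiv ℝ g (s q) (boxPartial T U a s q) := by
  have h1 := ((hs.differentiableOn (by simp)) q hq).hasFDerivWithinAt
  have h2 := ((hg.differentiable (by simp)) (s q)).hasFDerivAt.comp_hasFDerivWithinAt q h1
  exact congrArg (fun l : Pt d →L[ℝ] E => l (Pi.single a 1))
    (h2.fderivWithin (uniqueDiffOn_box hT hU q hq))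

theorem boxPartial_boxPartial_comp {X : Type*} [NormedAddCommGroup X] [NormedSpace ℝ X] {g : X → E}
    {s : Pt d → X} (hT : 0 < T) (hU : 0 < U) (hg : ContDiff ℝ ∞ g)
    (hs : ContDiffOn ℝ ∞ s (box d T U)) (a b : Fin (d + 2)) {q : Pt d} (hq : q ∈ box d T U) :
    boxPartial T U b (boxPartial T U a fun q => g (s q)) q =
      fderiv ℝ (fderiv ℝ g) (s q) (boxPartial T U b s q) (boxPartial T U a s q) +
        fderiv ℝ g (s q) (boxPartial T U b (boxPartial T U a s) q) := by
  rw [boxPartial_congr (fun z hz => boxPartial_comp hT hU hg hs a hz) hq]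
  have hg' : ContDiff ℝ ∞ (fderiv ℝ g) := hg.fderiv_right (by simp)
  have hsa := contDiffOn_boxPartial hT hU hs a
  have h1 := ((hs.differentiableOn (by simp)) q hq).hasFDerivWithinAt
  have h2 := ((hg'.differentiable (by simp)) (s q)).hasFDerivAt.comp_hasFDerivWithinAt q h1
  have h3 := ((hsa.differentiableOn (by simp)) q hq).hasFDerivWithinAt
  have h4 := (h2.clm_apply h3).fderivWithin (uniqueDiffOn_box hT hU q hq)
  have h5 := congrArg (fun l : Pt d →L[ℝ] E => l (Pi.single b 1)) h4
  refine Eq.trans h5 ?_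
  simp [boxPartial, add_comm]

theorem le_on_closedBox {f g : Pt d → ℝ} (hT : 0 < T) (hU : 0 < U)
    (hf : ContinuousOn f (closedBox d T U)) (hg : ContinuousOn g (closedBox d T U))
    (h : ∀ q ∈ box d T U, f q ≤ g q) {q : Pt d} (hq : q ∈ closedBox d T U) : f q ≤ g q := by
  have hcl : q ∈ closure (box d T U) := by
    rw [← closure_openBox hT hU] at hq
    exact closure_mono openBox_subset_box hq
  have := mem_closure_iff_nhdsWithin_neBot.1 hcl
  refine le_of_tendsto_of_tendsto ((hf q hq).mono box_subset_closedBox)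
    ((hg q hq).mono box_subset_closedBox) ?_
  filter_upwards [self_mem_nhdsWithin] with z hz using h z hz

/-- Uniform control, in geometric coordinates, of the change of variables map `Υ`, which is the flow
of the vectorfield `ℓ ∘ s`. The vectorfield `∂/∂u + ∑ b_i ∂/∂ϑ_i` is `X̆`. -/
structure FlowControl {X : Type*} [NormedAddCommGroup X] [NormedSpace ℝ X] (T U : ℝ)
    (Υ : Pt d → Pt d) (s : Pt d → X) (b : Pt d → Fin d → ℝ) (m : Pt d → ℝ) (ℓ : X → Pt d)
    (c η Λ K : ℝ) : Prop where
  T_pos : 0 < T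
  U_pos : 0 < U
  c_pos : 0 < c
  smooth_Υ : ContDiffOn ℝ ∞ Υ (box d T U)
  smooth_s : ContDiffOn ℝ ∞ s (box d T U)
  smooth_ℓ : ContDiff ℝ ∞ ℓ
  flow : ∀ q ∈ box d T U, boxPartial T U 0 Υ q = ℓ (s q)
  time_eq : ∀ q ∈ box d T U, Υ q 0 = q 0
  transport : ∀ q ∈ box d T U, fderivWithin ℝ Υ (box d T U) q (mkPt 0 1 (b q)) =
    -(m q) • (ℓ (s q) - Pi.single 0 1)
  bound_s : ∀ q ∈ box d T U, ‖s q‖ ≤ K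
  -- Index `1` is excluded here and in the second-order bounds: `∂_u` is reached only through `X̆`,
  -- once `b` is bounded.
  bound_ds : ∀ q ∈ box d T U, ∀ a, a ≠ 1 → ‖boxPartial T U a s q‖ ≤ K
  bound_Xs : ∀ q ∈ box d T U, ‖fderivWithin ℝ s (box d T U) q (mkPt 0 1 (b q))‖ ≤ K
  bound_dds : ∀ q ∈ box d T U, ∀ a, a ≠ 1 → ∀ e, e ≠ 1 →
    ‖boxPartial T U e (boxPartial T U a s) q‖ ≤ K
  bound_Xds : ∀ q ∈ box d T U, ∀ a, a ≠ 1 →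
    ‖fderivWithin ℝ (boxPartial T U a s) (box d T U) q (mkPt 0 1 (b q))‖ ≤ K
  le_m : ∀ q ∈ box d T U, c ≤ m q
  m_le : ∀ q ∈ box d T U, m q ≤ K
  torus : ∀ q ∈ box d T U, ∀ (i : Fin d) (j : Fin (d + 1)),
    |boxPartial T U i.succ.succ Υ q j.succ - if j = i.succ then 1 else 0| ≤ η
  bound_ℓ : ∀ q ∈ box d T U, ‖ℓ (s q)‖ ≤ Λ
  ℓ_one : ∀ q ∈ box d T U, 1 / 2 ≤ ℓ (s q) 1
  small : 2 * (d * η) ≤ 1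
  small_mul : 2 * (d * η) * Λ ≤ 1 / 4
  initial : ∀ q ∈ box d T U, q 0 = 0 → Υ q = mkPt 0 (1 - q 1) (torusPart q)
  equivariant : ∀ q ∈ box d T U, ∀ k : Fin d → ℤ,
    Υ (q + mkPt 0 0 fun i => (k i : ℝ)) = Υ q + mkPt 0 0 fun i => (k i : ℝ)

namespace FlowControl

variable {X : Type*} [NormedAddCommGroup X] [NormedSpace ℝ X]
  {Υ : Pt d → Pt d} {s : Pt d → X} {b : Pt d → Fin d → ℝ} {m : Pt d → ℝ} {ℓ : X → Pt d}
  {c η Λ K : ℝ}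

theorem box_nonempty (H : FlowControl T U Υ s b m ℓ c η Λ K) : (box d T U).Nonempty :=
  (openBox_nonempty H.T_pos H.U_pos).mono openBox_subset_box

theorem K_nonneg (H : FlowControl T U Υ s b m ℓ c η Λ K) : 0 ≤ K := by
  obtain ⟨q, hq⟩ := H.box_nonempty
  exact (norm_nonneg _).trans (H.bound_s q hq)

theorem Λ_nonneg (H : FlowControl T U Υ s b m ℓ c η Λ K) : 0 ≤ Λ := by
  obtain ⟨q, hq⟩ := H.box_nonempty
  exact (norm_nonneg _).trans (H.bound_ℓ q hq)

theorem torusPart_incl_sub_le (H : FlowControl T U Υ s b m ℓ c η Λ K) {q : Pt d}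
    (hq : q ∈ box d T U) (θ : Fin d → ℝ) :
    ‖torusPart (fderivWithin ℝ Υ (box d T U) q (mkPt 0 0 θ)) - θ‖ ≤ d * η * ‖θ‖ := by
  -- For `d = 0` the sign of `η` is not determined by `torus`, but only the product with `d`
  -- matters.
  have hη : 0 ≤ (d : ℝ) * η := by
    rcases Nat.eq_zero_or_pos d with rfl | h
    · simp
    · exact mul_nonneg (Nat.cast_nonneg _) ((abs_nonneg _).trans (H.torus q hq ⟨0, h⟩ 0))
  refine (pi_norm_le_iff_of_nonneg (by positivity)).2 fun k => ?_
  have e : (torusPart (fderivWithin ℝ Υ (box d T U) q (mkPt 0 0 θ)) - θ) k =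
      ∑ i, θ i * (boxPartial T U i.succ.succ Υ q k.succ.succ -
        if k.succ = i.succ then 1 else 0) := by
    rw [fderivWithin_mkPt]
    simp [mul_sub, Finset.sum_sub_distrib, Finset.sum_apply]
  rw [e]
  refine (norm_sum_le _ _).trans ((Finset.sum_le_card_nsmul _ _ (‖θ‖ * η) fun i _ => ?_).trans
    (le_of_eq (by simp; ring)))
  rw [norm_mul]
  exact mul_le_mul (norm_le_pi_norm θ i) (H.torus q hq i k.succ) (norm_nonneg _) (norm_nonneg _)

theorem incl_one_le (H : FlowControl T U Υ s b m ℓ c η Λ K) {q : Pt d}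
    (hq : q ∈ box d T U) (θ : Fin d → ℝ) :
    fderivWithin ℝ Υ (box d T U) q (mkPt 0 0 θ) 1 ≤ d * η * ‖θ‖ := by
  have e : fderivWithin ℝ Υ (box d T U) q (mkPt 0 0 θ) 1 =
      ∑ i, θ i * boxPartial T U i.succ.succ Υ q 1 := by
    rw [fderivWithin_mkPt]
    simp [Finset.sum_apply]
  rw [e]
  refine (Finset.sum_le_card_nsmul _ _ (‖θ‖ * η) fun i _ => ?_).trans
    (le_of_eq (by simp; ring))
  have h1 := H.torus q hq i 0
  rw [if_neg (Fin.succ_ne_zero i).symm, sub_zero, Fin.succ_zero_eq_one] at h1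
  refine (le_abs_self _).trans ?_
  rw [abs_mul]
  exact mul_le_mul (norm_le_pi_norm θ i) h1 (abs_nonneg _) (norm_nonneg _)

theorem norm_le_incl (H : FlowControl T U Υ s b m ℓ c η Λ K) {q : Pt d}
    (hq : q ∈ box d T U) (θ : Fin d → ℝ) :
    ‖θ‖ ≤ 2 * ‖torusPart (fderivWithin ℝ Υ (box d T U) q (mkPt 0 0 θ))‖ := by
  have h1 := H.torusPart_incl_sub_le hq θ
  have h2 := norm_sub_norm_le θ (torusPart (fderivWithin ℝ Υ (box d T U) q (mkPt 0 0 θ)))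
  rw [norm_sub_rev] at h1
  have h3 : d * η * ‖θ‖ ≤ 1 / 2 * ‖θ‖ :=
    mul_le_mul_of_nonneg_right (by linarith [H.small]) (norm_nonneg _)
  linarith

theorem torusPart_transport (H : FlowControl T U Υ s b m ℓ c η Λ K) {q : Pt d}
    (hq : q ∈ box d T U) :
    ‖torusPart (fderivWithin ℝ Υ (box d T U) q (mkPt 0 1 (b q)))‖ ≤ m q * Λ := by
  have hm : 0 ≤ m q := H.c_pos.le.trans (H.le_m q hq)
  have e : torusPart (fderivWithin ℝ Υ (box d T U) q (mkPt 0 1 (b q))) =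
      -(m q) • torusPart (ℓ (s q)) := by
    rw [H.transport q hq, map_smul, map_sub]
    congr 1
    have : torusPart (Pi.single 0 1 : Pt d) = 0 := by ext i; simp
    rw [this, sub_zero]
  rw [e, norm_smul, norm_neg, Real.norm_of_nonneg hm]
  exact mul_le_mul_of_nonneg_left ((norm_torusPart_le _).trans (H.bound_ℓ q hq)) hm

theorem mkPt_split (θ θ' : Fin d → ℝ) :
    (mkPt 0 1 θ : Pt d) = mkPt 0 1 θ' + mkPt 0 0 (θ - θ') := by
  rw [mkPt_add]; simp

/-- Split `(0, 1, θ)` into `X̆` and the torus vector `θ - b`. The first contributes `-m ℓ¹ ≤ -m/2`.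
The second contributes at most `d η ‖θ - b‖`, where `‖θ - b‖ ≤ 2 (r + m Λ)` with `r` the size of the
torus part of the image. The smallness conditions leave `-m/4 + r`. -/
theorem transversal (H : FlowControl T U Υ s b m ℓ c η Λ K) {q : Pt d}
    (hq : q ∈ box d T U) (θ : Fin d → ℝ) :
    fderivWithin ℝ Υ (box d T U) q (mkPt 0 1 θ) 1 ≤
      -(c / 4) + ‖torusPart (fderivWithin ℝ Υ (box d T U) q (mkPt 0 1 θ))‖ := by
  have hc := H.le_m q hq
  have hm : 0 < m q := H.c_pos.trans_le hc
  set D := fderivWithin ℝ Υ (box d T U) q with hD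
  set r := ‖torusPart (D (mkPt 0 1 θ))‖ with hr
  have e : D (mkPt 0 1 θ) = D (mkPt 0 1 (b q)) + D (mkPt 0 0 (θ - b q)) := by
    rw [mkPt_split θ (b q), map_add]
  have h1 : D (mkPt 0 1 (b q)) 1 = -(m q) * ℓ (s q) 1 := by
    rw [hD, H.transport q hq]; simp
  have h2 : ‖θ - b q‖ ≤ 2 * (r + m q * Λ) := by
    refine (H.norm_le_incl hq _).trans ?_
    have h3 : torusPart (D (mkPt 0 0 (θ - b q))) =
        torusPart (D (mkPt 0 1 θ)) - torusPart (D (mkPt 0 1 (b q))) := by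
      rw [e, map_add]; abel
    rw [← hD, h3]
    have := norm_sub_le (torusPart (D (mkPt 0 1 θ))) (torusPart (D (mkPt 0 1 (b q))))
    have h4 := H.torusPart_transport hq
    linarith
  have h5 := H.incl_one_le hq (θ - b q)
  have hη : 0 ≤ (d : ℝ) * η := by
    rcases Nat.eq_zero_or_pos d with rfl | h
    · simp
    · exact mul_nonneg (Nat.cast_nonneg _) ((abs_nonneg _).trans (H.torus q hq ⟨0, h⟩ 0))
  have h6 : d * η * ‖θ - b q‖ ≤ d * η * (2 * (r + m q * Λ)) := mul_le_mul_of_nonneg_left h2 hη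
  have h7 : m q * (1 / 2) ≤ m q * ℓ (s q) 1 := mul_le_mul_of_nonneg_left (H.ℓ_one q hq) hm.le
  have h8 : m q * (2 * (d * η) * Λ) ≤ m q * (1 / 4) := mul_le_mul_of_nonneg_left H.small_mul hm.le
  have h9 : 2 * (d * η) * r ≤ 1 * r := mul_le_mul_of_nonneg_right H.small (norm_nonneg _)
  rw [e, Pi.add_apply, h1]
  nlinarith

/-- Apply `∑ b_i ∂/∂ϑ^i = X̆ - ∂_u` to the torus components of `Υ` and invert the torus block. -/
theorem norm_b_le (H : FlowControl T U Υ s b m ℓ c η Λ K) {q : Pt d} (hq : q ∈ box d T U) :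
    ‖b q‖ ≤ 2 * (K * Λ + ‖boxPartial T U 1 Υ q‖) := by
  refine (H.norm_le_incl hq _).trans ?_
  have e : torusPart (fderivWithin ℝ Υ (box d T U) q (mkPt 0 0 (b q))) =
      torusPart (fderivWithin ℝ Υ (box d T U) q (mkPt 0 1 (b q))) -
        torusPart (boxPartial T U 1 Υ q) := by
    rw [← map_sub, fderivWithin_mkPt, fderivWithin_mkPt]
    simp
  rw [e]
  have h1 := norm_sub_le (torusPart (fderivWithin ℝ Υ (box d T U) q (mkPt 0 1 (b q))))
    (torusPart (boxPartial T U 1 Υ q))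
  have h2 := H.torusPart_transport hq
  have h3 := norm_torusPart_le (boxPartial T U 1 Υ q)
  have h4 : m q * Λ ≤ K * Λ := mul_le_mul_of_nonneg_right (H.m_le q hq) H.Λ_nonneg
  linarith

theorem boxPartial_zero_boxPartial (H : FlowControl T U Υ s b m ℓ c η Λ K) {q : Pt d}
    (hq : q ∈ box d T U) (a : Fin (d + 2)) :
    boxPartial T U 0 (boxPartial T U a Υ) q = boxPartial T U a (fun q => ℓ (s q)) q := by
  rw [boxPartial_comm H.T_pos H.U_pos H.smooth_Υ 0 a hq,
    boxPartial_congr (fun z hz => H.flow z hz) hq]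

theorem boxPartial_one_initial (H : FlowControl T U Υ s b m ℓ c η Λ K) {q : Pt d}
    (hq : q ∈ box d T U) (h0 : q 0 = 0) : boxPartial T U 1 Υ q = mkPt 0 (-1) 0 := by
  have h1 := ((H.smooth_Υ.differentiableOn (by simp)) q hq).hasFDerivWithinAt
  have h2 : HasDerivWithinAt (fun u => mkPt 0 u (torusPart q)) (mkPt 0 1 0) (Icc 0 U) (q 1) :=
    (hasDerivAt_mkPt _ _ _).hasDerivWithinAt
  have hq' : mkPt 0 (q 1) (torusPart q) = q := pt_ext h0.symm rfl rfl
  have hmem : ∀ u ∈ Icc 0 U, mkPt 0 u (torusPart q) ∈ box d T U :=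
    fun u hu => ⟨le_rfl, H.T_pos, hu.1, hu.2⟩
  rw [← hq'] at h1
  have h3 := h1.comp_hasDerivWithinAt (q 1) h2 hmem
  have h4 : HasDerivWithinAt (fun u => mkPt 0 (1 - u) (torusPart q)) (mkPt 0 (-1) 0)
      (Icc 0 U) (q 1) := by
    rw [hasDerivWithinAt_pi]
    intro a
    refine Fin.cases (hasDerivWithinAt_const _ _ _) (fun e => ?_) a
    refine Fin.cases ?_ (fun i => hasDerivWithinAt_const _ _ _) e
    exact ((hasDerivAt_id (q 1)).const_sub 1).hasDerivWithinAt
  have h5 := h4.congr (f₁ := fun u => Υ (mkPt 0 u (torusPart q)))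
    (fun u hu => H.initial _ (hmem u hu) rfl) (H.initial _ (hmem _ hq.2.2) rfl)
  have h6 := (uniqueDiffOn_Icc H.U_pos (q 1) hq.2.2).eq_deriv _ h3 h5
  rw [hq', fderivWithin_mkPt] at h6
  simpa using h6

/-- The extension of the change of variables map. -/
def extendMap (T : ℝ) (Υ : Pt d → Pt d) (q : Pt d) : Pt d :=
  fun β => timeExt T (fun q => Υ q β) q

/-- The derivative of the extension of the change of variables map. -/
def extendMapDeriv (T U : ℝ) (Υ : Pt d → Pt d) (q : Pt d) : Pt d →L[ℝ] Pt d :=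
  ContinuousLinearMap.pi fun β =>
    coeffForm fun a => timeExt T (boxPartial T U a fun q => Υ q β) q

theorem extendMapDeriv_of_mem_box (H : FlowControl T U Υ s b m ℓ c η Λ K) {q : Pt d}
    (hq : q ∈ box d T U) : extendMapDeriv T U Υ q = fderivWithin ℝ Υ (box d T U) q := by
  refine ContinuousLinearMap.ext fun z => funext fun β => ?_
  have e : (fun a => timeExt T (boxPartial T U a fun q => Υ q β) q) =
      fun a => ((ContinuousLinearMap.proj β : Pt d →L[ℝ] ℝ) ∘L
        fderivWithin ℝ Υ (box d T U) q) (Pi.single a 1) := by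
    funext a
    rw [timeExt_of_mem_box hq, boxPartial_apply H.T_pos H.U_pos H.smooth_Υ β a hq]
    rfl
  change coeffForm (fun a => timeExt T (boxPartial T U a fun q => Υ q β) q) z = _
  rw [e, coeffForm_eq]
  rfl

theorem extendMap_of_mem_box {q : Pt d} (hq : q ∈ box d T U) : extendMap T Υ q = Υ q :=
  funext fun _ => timeExt_of_mem_box hq

variable [ProperSpace X]

theorem exists_bound_ℓ (H : FlowControl T U Υ s b m ℓ c η Λ K) : ∃ B, 0 ≤ B ∧
    ∀ q ∈ box d T U, ‖fderiv ℝ ℓ (s q)‖ ≤ B ∧ ‖fderiv ℝ (fderiv ℝ ℓ) (s q)‖ ≤ B := by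
  have h1 : Continuous (fderiv ℝ ℓ) := H.smooth_ℓ.continuous_fderiv (by simp)
  have h2 : Continuous (fderiv ℝ (fderiv ℝ ℓ)) :=
    (H.smooth_ℓ.fderiv_right (m := ∞) (by simp)).continuous_fderiv (by simp)
  obtain ⟨B₁, hB₁⟩ := (isCompact_closedBall (0 : X) K).exists_bound_of_continuousOn h1.continuousOn
  obtain ⟨B₂, hB₂⟩ := (isCompact_closedBall (0 : X) K).exists_bound_of_continuousOn
    (E := X →L[ℝ] X →L[ℝ] Pt d) (f := fderiv ℝ (fderiv ℝ ℓ)) h2.continuousOn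
  refine ⟨max 0 (max B₁ B₂), le_max_left _ _, fun q hq => ?_⟩
  have hm : s q ∈ Metric.closedBall (0 : X) K := mem_closedBall_zero_iff.2 (H.bound_s q hq)
  exact ⟨(hB₁ _ hm).trans ((le_max_left _ _).trans (le_max_right _ _)),
    (hB₂ _ hm).trans ((le_max_right _ _).trans (le_max_right _ _))⟩

/-- The shift `b` is itself estimated by `∂_u Υ`, so the bound closes only through Grönwall's
inequality. It closes because `b` enters `∂_u s` linearly. -/
theorem exists_bound_eikonal (H : FlowControl T U Υ s b m ℓ c η Λ K) :
    ∃ B, ∀ q ∈ box d T U, ‖boxPartial T U 1 Υ q‖ ≤ B := by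
  obtain ⟨B, hB0, hB⟩ := H.exists_bound_ℓ
  have hK := H.K_nonneg
  set k₁ := B * (d * (2 * K)) with hk₁
  set k₀ := B * (K + d * (2 * (K * Λ) * K)) with hk₀
  have hk₁0 : 0 ≤ k₁ := by positivity
  have hk₀0 : 0 ≤ k₀ := by have := H.Λ_nonneg; positivity
  have hder : ∀ q ∈ box d T U, ‖boxPartial T U 0 (boxPartial T U 1 Υ) q‖ ≤
      k₁ * ‖boxPartial T U 1 Υ q‖ + k₀ := by
    intro q hq
    rw [H.boxPartial_zero_boxPartial hq, boxPartial_comp H.T_pos H.U_pos H.smooth_ℓ H.smooth_s 1 hq]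
    have h1 := norm_boxPartial_one_le (fun i => H.bound_ds q hq _ (succ_succ_ne_one i))
      (H.bound_Xs q hq)
    have h2 := H.norm_b_le hq
    refine (ContinuousLinearMap.le_opNorm _ _).trans ?_
    calc _ ≤ B * (K + d * (2 * (K * Λ + ‖boxPartial T U 1 Υ q‖) * K)) := by
          refine mul_le_mul (hB q hq).1 (h1.trans ?_) (norm_nonneg _) hB0
          gcongr
      _ = k₁ * ‖boxPartial T U 1 Υ q‖ + k₀ := by rw [hk₁, hk₀]; ring
  refine ⟨gronwallBound 1 k₁ k₀ T, fun q hq => ?_⟩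
  have hqc := box_subset_closedBox hq
  have hsm := contDiffOn_boxPartial H.T_pos H.U_pos H.smooth_Υ 1
  have hd := fun t ht => hasDerivWithinAt_update hsm hqc (s := t) ht
  have hsub : Icc 0 (q 0) ⊆ Ico 0 T := fun t ht => ⟨ht.1, ht.2.trans_lt hq.2.1⟩
  -- At `t = 0` the map is `(u, ϑ) ↦ (1 - u, ϑ)`, so `∂_u Υ` is minus a unit vector.
  have hinit : ‖boxPartial T U 1 Υ (Function.update q 0 0)‖ ≤ 1 := by
    rw [H.boxPartial_one_initial (update_mem_box hqc ⟨le_rfl, H.T_pos⟩) (by simp)]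
    exact norm_pt_le zero_le_one (by simp) (by simp) (by simp)
  have key := norm_le_gronwallBound_of_norm_deriv_right_le
    (f := fun t => boxPartial T U 1 Υ (Function.update q 0 t))
    (f' := fun t => boxPartial T U 0 (boxPartial T U 1 Υ) (Function.update q 0 t))
    (δ := 1) (K := k₁) (ε := k₀) (a := 0) (b := q 0)
    (fun t ht => ((hd t (hsub ht)).continuousWithinAt).mono hsub)
    (fun t ht => by
      have ht' := hsub ⟨ht.1, ht.2.le⟩
      refine (hd t ht').mono_of_mem_nhdsWithin ?_
      exact mem_of_superset (Ico_mem_nhdsGE ht'.2) (Ico_subset_Ico_left ht'.1))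
    hinit (fun t ht => hder _ (update_mem_box hqc (hsub ⟨ht.1, ht.2.le⟩)))
    (q 0) (right_mem_Icc.2 hq.1)
  rw [Function.update_eq_self, sub_zero] at key
  exact key.trans (gronwallBound_mono zero_le_one hk₀0 hk₁0 hq.2.1.le)

/-- Once `∂_u Υ` is bounded so is `b`, and the chain rule does the rest. Every second derivative
contains a torus direction; `∂_u ∂_u s` never occurs, which is why strings with one `X̆` suffice. -/
theorem exists_bound_flow (H : FlowControl T U Υ s b m ℓ c η Λ K) : ∃ B, 0 ≤ B ∧
    ∀ q ∈ box d T U, ‖boxPartial T U 1 Υ q‖ ≤ B ∧ ‖ℓ (s q)‖ ≤ B ∧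
      ∀ a, ‖boxPartial T U a (fun q => ℓ (s q)) q‖ ≤ B ∧
        ∀ i : Fin d, ‖boxPartial T U a (boxPartial T U i.succ.succ fun q => ℓ (s q)) q‖ ≤ B := by
  obtain ⟨B, hB0, hB⟩ := H.exists_bound_ℓ
  obtain ⟨B₁, hB₁⟩ := H.exists_bound_eikonal
  have hK := H.K_nonneg
  have hΛ := H.Λ_nonneg
  have hB₁0 : 0 ≤ B₁ := by
    obtain ⟨q, hq⟩ := H.box_nonempty
    exact (norm_nonneg _).trans (hB₁ q hq)
  set K' := K + d * (2 * (K * Λ + B₁) * K) with hK'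
  have hKK' : K ≤ K' := by
    have : 0 ≤ d * (2 * (K * Λ + B₁) * K) := by positivity
    linarith
  have hK'0 := hK.trans hKK'
  have hb : ∀ q ∈ box d T U, K + d * (‖b q‖ * K) ≤ K' := by
    intro q hq
    have := (H.norm_b_le hq).trans
      (mul_le_mul_of_nonneg_left (add_le_add_right (hB₁ q hq) _) zero_le_two)
    rw [hK']
    gcongr
  have hds : ∀ q ∈ box d T U, ∀ a, ‖boxPartial T U a s q‖ ≤ K' := by
    intro q hq a
    by_cases ha : a = 1
    · rw [ha]
      exact (norm_boxPartial_one_le (fun i => H.bound_ds q hq _ (succ_succ_ne_one i))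
        (H.bound_Xs q hq)).trans (hb q hq)
    · exact (H.bound_ds q hq a ha).trans hKK'
  have hdds : ∀ q ∈ box d T U, ∀ e (i : Fin d),
      ‖boxPartial T U e (boxPartial T U i.succ.succ s) q‖ ≤ K' := by
    intro q hq e i
    have hi := succ_succ_ne_one i
    by_cases he : e = 1
    · rw [he]
      exact (norm_boxPartial_one_le
        (fun j => H.bound_dds q hq _ hi _ (succ_succ_ne_one j))
        (H.bound_Xds q hq _ hi)).trans (hb q hq)
    · exact (H.bound_dds q hq _ hi e he).trans hKK'
  refine ⟨B₁ + (Λ + (B * K' + (B * K' * K' + B * K'))), by positivity, fun q hq => ?_⟩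
  have p1 : 0 ≤ B * K' := by positivity
  have p2 : 0 ≤ B * K' * K' := by positivity
  have hBq := hB q hq
  refine ⟨by linarith [hB₁ q hq], by linarith [H.bound_ℓ q hq], fun a => ⟨?_, fun i => ?_⟩⟩
  · rw [boxPartial_comp H.T_pos H.U_pos H.smooth_ℓ H.smooth_s a hq]
    have h1 := (ContinuousLinearMap.le_opNorm (fderiv ℝ ℓ (s q)) (boxPartial T U a s q)).trans
      (mul_le_mul hBq.1 (hds q hq a) (norm_nonneg _) hB0)
    linarith
  · rw [boxPartial_boxPartial_comp H.T_pos H.U_pos H.smooth_ℓ H.smooth_s _ a hq]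
    have h1 := (ContinuousLinearMap.le_opNorm (fderiv ℝ ℓ (s q))
      (boxPartial T U a (boxPartial T U i.succ.succ s) q)).trans
      (mul_le_mul hBq.1 (hdds q hq a i) (norm_nonneg _) hB0)
    have h2 := ((fderiv ℝ (fderiv ℝ ℓ) (s q)).le_opNorm₂ (boxPartial T U a s q)
      (boxPartial T U i.succ.succ s q)).trans
      (mul_le_mul (mul_le_mul hBq.2 (hds q hq a) (norm_nonneg _) hB0) (hds q hq i.succ.succ)
        (norm_nonneg _) p1)
    have h3 := norm_add_le
      (fderiv ℝ (fderiv ℝ ℓ) (s q) (boxPartial T U a s q) (boxPartial T U i.succ.succ s q))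
      (fderiv ℝ ℓ (s q) (boxPartial T U a (boxPartial T U i.succ.succ s) q))
    linarith

theorem exists_hasLipPartials (H : FlowControl T U Υ s b m ℓ c η Λ K) : ∃ B, 0 ≤ B ∧
    (∀ q ∈ box d T U, ‖boxPartial T U 1 Υ q‖ ≤ B) ∧ ∀ β,
      HasLipPartials T U B (timeExt T fun q => Υ q β)
        (fun a => timeExt T (boxPartial T U a fun q => Υ q β)) ∧
      ∀ i : Fin d, HasLipPartials T U B (timeExt T (boxPartial T U i.succ.succ fun q => Υ q β))
        (fun a => timeExt T (boxPartial T U a (boxPartial T U i.succ.succ fun q => Υ q β))) := by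
  obtain ⟨B, hB0, hB⟩ := H.exists_bound_flow
  have hT := H.T_pos
  have hU := H.U_pos
  have hs : ∀ β, ContDiffOn ℝ ∞ (fun q => Υ q β) (box d T U) := contDiffOn_pi.1 H.smooth_Υ
  refine ⟨B, hB0, fun q hq => (hB q hq).1, fun β => ⟨?_, fun i => ?_⟩⟩
  · refine hasLipPartials_timeExt hT hU hB0 (hs β) (fun q hq => ?_) fun a q hq => ?_
    · rw [boxPartial_apply hT hU H.smooth_Υ β 0 hq, H.flow q hq]
      exact (norm_le_pi_norm _ β).trans (hB q hq).2.1
    · rw [boxPartial_boxPartial_apply hT hU H.smooth_Υ β a 0 hq, H.boxPartial_zero_boxPartial hq]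
      exact (norm_le_pi_norm _ β).trans ((hB q hq).2.2 a).1
  · have hsi := contDiffOn_boxPartial hT hU H.smooth_Υ i.succ.succ
    refine hasLipPartials_timeExt hT hU hB0 (contDiffOn_boxPartial hT hU (hs β) _)
      (fun q hq => ?_) fun a q hq => ?_
    · rw [boxPartial_boxPartial_apply hT hU H.smooth_Υ β _ 0 hq, H.boxPartial_zero_boxPartial hq]
      exact (norm_le_pi_norm _ β).trans ((hB q hq).2.2 i.succ.succ).1
    -- Commuting `∂_t` inward twice gives `∂_t ∂_a ∂_{ϑ^i} Υ = ∂_a ∂_{ϑ^i} (ℓ ∘ s)`.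
    · have e1 : boxPartial T U 0 (boxPartial T U a
          (boxPartial T U i.succ.succ fun q => Υ q β)) q =
          boxPartial T U 0 (boxPartial T U a fun q => boxPartial T U i.succ.succ Υ q β) q := by
        refine boxPartial_congr (fun z hz => ?_) hq 0
        exact boxPartial_congr (fun y hy => boxPartial_apply hT hU H.smooth_Υ β _ hy) hz a
      rw [e1, boxPartial_boxPartial_apply hT hU hsi β a 0 hq,
        boxPartial_comm hT hU hsi 0 a hq,
        boxPartial_congr (fun z hz => H.boxPartial_zero_boxPartial hz _) hq]
      exact (norm_le_pi_norm _ β).trans (((hB q hq).2.2 a).2 i)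

/-- Apart from regularity, each condition is an equality or a non-strict inequality between
functions continuous on the closed box, so it passes from the dense half-open box to `t = T`. -/
theorem exists_isStackedGraphMap (H : FlowControl T U Υ s b m ℓ c η Λ K) :
    ∃ B, IsStackedGraphMap T U (c / 4) B (extendMap T Υ) (extendMapDeriv T U Υ) := by
  obtain ⟨B, hB0, hB1, hB⟩ := H.exists_hasLipPartials
  have hT := H.T_pos
  have hU := H.U_pos
  have hcΥ : ContinuousOn (extendMap T Υ) (closedBox d T U) :=
    continuousOn_pi.2 fun β => (hB β).1.continuousOn
  have hcD : ContinuousOn (extendMapDeriv T U Υ) (closedBox d T U) := by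
    have h1 : ∀ β, ContinuousOn
        (fun q => coeffForm fun a => timeExt T (boxPartial T U a fun q => Υ q β) q)
        (closedBox d T U) := fun β =>
      continuous_coeffForm.comp_continuousOn (continuousOn_pi.2 (hB β).1.continuousOn_partial)
    have h2 : Continuous fun l : Fin (d + 2) → (Pt d →L[ℝ] ℝ) => ContinuousLinearMap.pi l :=
      (ContinuousLinearMap.piEquivL ℝ (Pt d) (fun _ : Fin (d + 2) => ℝ)).continuous
    exact h2.comp_continuousOn (continuousOn_pi.2 h1)
  have happ : ∀ z : Pt d, ContinuousOn (fun q => extendMapDeriv T U Υ q z) (closedBox d T U) :=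
    fun z => hcD.clm_apply continuousOn_const
  have htor : ∀ {f : Pt d → Pt d}, ContinuousOn f (closedBox d T U) →
      ContinuousOn (fun q => torusPart (f q)) (closedBox d T U) := fun h =>
    (torusPart (d := d)).continuous.comp_continuousOn h
  have heq : ∀ {f g : Pt d → ℝ}, ContinuousOn f (closedBox d T U) →
      ContinuousOn g (closedBox d T U) → (∀ q ∈ box d T U, f q = g q) →
      ∀ q ∈ closedBox d T U, f q = g q := fun hf hg h q hq =>
    le_antisymm (le_on_closedBox hT hU hf hg (fun z hz => (h z hz).le) hq)
      (le_on_closedBox hT hU hg hf (fun z hz => (h z hz).ge) hq)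
  refine ⟨B, ?_, ?_, hcD, ?_, ?_, ?_, ?_⟩
  · refine heq (continuousOn_pi.1 hcΥ 0) (continuous_apply 0).continuousOn fun q hq => ?_
    rw [extendMap_of_mem_box hq, H.time_eq q hq]
  · intro q hq
    rw [hasFDerivWithinAt_pi']
    exact fun β => (hB β).1.hasFDerivWithinAt q hq
  · intro q hq
    refine le_on_closedBox hT hU (happ _).norm continuousOn_const (fun q hq => ?_) hq
    rw [H.extendMapDeriv_of_mem_box hq, fderivWithin_mkPt]
    simpa using hB1 q hq
  · intro q hq θ
    refine le_on_closedBox hT hU ((htor (happ _)).sub continuousOn_const).norm continuousOn_const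
      (fun q hq => ?_) hq
    simp only [Pi.sub_apply, H.extendMapDeriv_of_mem_box hq]
    refine (H.torusPart_incl_sub_le hq θ).trans ?_
    exact mul_le_mul_of_nonneg_right (by linarith [H.small]) (norm_nonneg _)
  · intro q hq θ
    refine le_on_closedBox hT hU (continuousOn_pi.1 (happ _) 1)
      (continuousOn_const.add (htor (happ _)).norm) (fun q hq => ?_) hq
    simp only [Pi.add_apply, H.extendMapDeriv_of_mem_box hq]
    exact H.transversal hq θ
  · intro q hq k
    funext β
    refine heq (f := fun q => extendMap T Υ (q + mkPt 0 0 fun i => (k i : ℝ)) β)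
      (g := fun q => (extendMap T Υ q + mkPt 0 0 fun i => (k i : ℝ)) β) ?_ ?_ (fun q hq => ?_) q hq
    · exact (continuousOn_pi.1 hcΥ β).comp (by fun_prop)
        fun q hq => IsStackedGraphMap.add_mkPt_mem_closedBox hq _
    · exact (continuousOn_pi.1 hcΥ β).add continuousOn_const
    · have hq' : q + mkPt 0 0 (fun i => (k i : ℝ)) ∈ box d T U := by simpa [box] using hq
      rw [extendMap_of_mem_box hq, extendMap_of_mem_box hq', H.equivariant q hq]

theorem exists_extension (H : FlowControl T U Υ s b m ℓ c η Λ K) :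
    ∃ Υ' : Pt d → Pt d, EqOn Υ' Υ (box d T U) ∧ IsDiffeoOntoImage 1 Υ' (closedBox d T U) ∧
      ∀ β : Fin (d + 2),
        (InCZeroWOneInfty T U (fun q => Υ' q β) ∧ InCOneLInfty T U (fun q => Υ' q β)) ∧
        ∀ i : Fin d,
          InCZeroWOneInfty T U (fun q => fderivWithin ℝ Υ' (closedBox d T U) q
            (Pi.single i.succ.succ 1) β) ∧
          InCOneLInfty T U (fun q => fderivWithin ℝ Υ' (closedBox d T U) q
            (Pi.single i.succ.succ 1) β) := by
  obtain ⟨B, hB0, -, hB⟩ := H.exists_hasLipPartials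
  obtain ⟨B', hG⟩ := H.exists_isStackedGraphMap
  have hT := H.T_pos
  have hU := H.U_pos
  refine ⟨extendMap T Υ, fun q hq => extendMap_of_mem_box hq,
    hG.isDiffeoOntoImage hT hU (by linarith [H.c_pos]), fun β =>
    ⟨⟨(hB β).1.inCZeroWOneInfty hB0, (hB β).1.inCOneLInfty hT hB0⟩, fun i => ?_⟩⟩
  have h1 : EqOn (fun q => fderivWithin ℝ (extendMap T Υ) (closedBox d T U) q
      (Pi.single i.succ.succ 1) β) (timeExt T (boxPartial T U i.succ.succ fun q => Υ q β))
      (closedBox d T U) := by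
    intro q hq
    dsimp only
    rw [(hG.hasFDerivWithinAt q hq).fderivWithin (uniqueDiffOn_closedBox hT hU q hq)]
    exact coeffForm_single _ _
  have h2 := ((hB β).2 i).congr h1
  exact ⟨h2.inCZeroWOneInfty hB0, h2.inCOneLInfty hT hB0⟩

end FlowControl

end Extension


/-! ### Geometric coordinates of a solution -/

section Solution

variable {d M : ℕ} {S : System d M} {C : Config d M}

theorem fderivWithin_clm_apply {T U : ℝ} {E F : Type*} [NormedAddCommGroup E] [NormedSpace ℝ E]
    [NormedAddCommGroup F] [NormedSpace ℝ F] {f : Pt d → E} (hT : 0 < T) (hU : 0 < U)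
    (hf : ContDiffOn ℝ ∞ f (box d T U)) (l : E →L[ℝ] F) {q : Pt d} (hq : q ∈ box d T U)
    (z : Pt d) :
    fderivWithin ℝ (fun q => l (f q)) (box d T U) q z = l (fderivWithin ℝ f (box d T U) q z) := by
  have h1 := ((hf.differentiableOn (by simp)) q hq).hasFDerivWithinAt
  have h2 := l.hasFDerivAt.comp_hasFDerivWithinAt q h1
  exact congrArg (fun l : Pt d →L[ℝ] F => l z) (h2.fderivWithin (uniqueDiffOn_box hT hU q hq))

theorem contDiffOn_clm_apply {E F : Type*} [NormedAddCommGroup E] [NormedSpace ℝ E]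
    [NormedAddCommGroup F] [NormedSpace ℝ F] {f : Pt d → E} {s : Set (Pt d)} (l : E →L[ℝ] F)
    (hf : ContDiffOn ℝ ∞ f s) : ContDiffOn ℝ ∞ (fun q => l (f q)) s :=
  l.contDiff.comp_contDiffOn hf

namespace Config

/-- The derivative of the geometric coordinates with respect to the Cartesian ones. -/
def chartDeriv (C : Config d M) (p : Pt d) : Pt d →L[ℝ] Pt d :=
  fderivWithin ℝ C.chart C.region p

/-- The derivative of the change of variables map. -/
def mapDeriv (C : Config d M) (q : Pt d) : Pt d →L[ℝ] Pt d :=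
  fderivWithin ℝ C.Υ (box d C.T C.U₀) q

/-- The torus components of `X̆` in geometric coordinates. -/
def shift (S : System d M) (C : Config d M) (q : Pt d) : Fin d → ℝ :=
  torusPart (C.chartDeriv (C.Υ q) (C.vecX S (C.Υ q)))

/-- The pair of unknowns in geometric coordinates. -/
def state (C : Config d M) (q : Pt d) : ℝ × (Fin M → ℝ) := (C.Ψ (C.Υ q), C.v (C.Υ q))

theorem mem_slice {p : Pt d} (hp : p ∈ C.region) : p ∈ C.slice (p 0) C.U₀ :=
  ⟨rfl, hp.2.2⟩

theorem abs_string_le_stringSum {P : List (Fin (d + 2)) → Prop} {m N : ℕ}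
    (w : List (Fin (d + 2))) (hw : P w) (hm : m ≤ w.length) (hN : w.length ≤ N)
    (f : Pt d → ℝ) (p : Pt d) : |C.string S w f p| ≤ C.stringSum S P m N f p := by
  classical
  have hnn : ∀ k, ∀ x : Fin k → Fin (d + 2),
      0 ≤ (if P (List.ofFn x) then |C.string S (List.ofFn x) f p| else 0) := by
    intro k x
    split_ifs
    · exact abs_nonneg _
    · exact le_rfl
  have h1 : |C.string S w f p| ≤ ∑ x : Fin w.length → Fin (d + 2),
      if P (List.ofFn x) then |C.string S (List.ofFn x) f p| else 0 := by
    have h2 := Finset.single_le_sum (s := Finset.univ)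
      (f := fun x : Fin w.length → Fin (d + 2) =>
        if P (List.ofFn x) then |C.string S (List.ofFn x) f p| else 0)
      (fun x _ => hnn _ x) (Finset.mem_univ w.get)
    simpa [List.ofFn_get, hw] using h2
  refine h1.trans ?_
  have h3 := Finset.single_le_sum (s := Finset.Icc m N)
    (f := fun k => ∑ x : Fin k → Fin (d + 2),
      if P (List.ofFn x) then |C.string S (List.ofFn x) f p| else 0)
    (fun k _ => Finset.sum_nonneg fun x _ => hnn k x) (Finset.mem_Icc.2 ⟨hm, hN⟩)
  unfold stringSum
  convert h3 using 4

end Config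

namespace Config.IsSolution

theorem map_mem (h : C.IsSolution S) {q : Pt d} (hq : q ∈ box d C.T C.U₀) : C.Υ q ∈ C.region :=
  h.image_Υ ▸ mem_image_of_mem _ hq

theorem exists_eq_map (h : C.IsSolution S) {p : Pt d} (hp : p ∈ C.region) :
    ∃ q ∈ box d C.T C.U₀, C.Υ q = p := by
  rwa [← h.image_Υ] at hp

theorem chart_mem (h : C.IsSolution S) {p : Pt d} (hp : p ∈ C.region) :
    C.chart p ∈ box d C.T C.U₀ := by
  obtain ⟨q, hq, rfl⟩ := h.exists_eq_map hp
  rwa [h.chart_Υ q hq]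

theorem map_chart (h : C.IsSolution S) {p : Pt d} (hp : p ∈ C.region) : C.Υ (C.chart p) = p := by
  obtain ⟨q, hq, rfl⟩ := h.exists_eq_map hp
  rw [h.chart_Υ q hq]

theorem contDiffOn_chart (h : C.IsSolution S) : ContDiffOn ℝ ∞ C.chart C.region := by
  obtain ⟨-, -, G, hG, hGΥ⟩ := h.diffeo
  rw [h.image_Υ] at hG
  refine hG.congr fun p hp => ?_
  obtain ⟨q, hq, rfl⟩ := h.exists_eq_map hp
  rw [h.chart_Υ q hq, hGΥ hq]

theorem hasFDerivWithinAt_map (h : C.IsSolution S) {q : Pt d} (hq : q ∈ box d C.T C.U₀) :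
    HasFDerivWithinAt C.Υ (C.mapDeriv q) (box d C.T C.U₀) q :=
  ((h.diffeo.1.differentiableOn (by simp)) q hq).hasFDerivWithinAt

theorem hasFDerivWithinAt_chart (h : C.IsSolution S) {p : Pt d} (hp : p ∈ C.region) :
    HasFDerivWithinAt C.chart (C.chartDeriv p) C.region p :=
  ((h.contDiffOn_chart.differentiableOn (by simp)) p hp).hasFDerivWithinAt

theorem chartDeriv_comp_mapDeriv (h : C.IsSolution S) {q : Pt d} (hq : q ∈ box d C.T C.U₀) :
    C.chartDeriv (C.Υ q) ∘L C.mapDeriv q = ContinuousLinearMap.id ℝ (Pt d) := by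
  have h1 := (h.hasFDerivWithinAt_chart (h.map_mem hq)).comp q (h.hasFDerivWithinAt_map hq)
    fun z hz => h.map_mem hz
  have h2 : HasFDerivWithinAt (C.chart ∘ C.Υ) (ContinuousLinearMap.id ℝ (Pt d))
      (box d C.T C.U₀) q :=
    (hasFDerivWithinAt_id q _).congr (fun z hz => h.chart_Υ z hz) (h.chart_Υ q hq)
  exact (uniqueDiffOn_box h.T_pos h.U₀_pos q hq).eq h1 h2

/-- The region is known only as the image of the box. `DΥ` has a left inverse, hence is onto in
finite dimension, and unique differentiability is transported. Without it `fderivWithin` on the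
region could not be computed by the chain rule. -/
theorem uniqueDiffOn_region (h : C.IsSolution S) : UniqueDiffOn ℝ C.region := by
  intro p hp
  obtain ⟨q, hq, rfl⟩ := h.exists_eq_map hp
  have hinj : Function.Injective (C.mapDeriv q : Pt d →ₗ[ℝ] Pt d) := by
    refine Function.LeftInverse.injective (g := C.chartDeriv (C.Υ q)) fun z => ?_
    exact congrArg (fun l : Pt d →L[ℝ] Pt d => l z) (h.chartDeriv_comp_mapDeriv hq)
  have hsurj : Function.Surjective (C.mapDeriv q) := LinearMap.injective_iff_surjective.1 hinj
  have := (h.hasFDerivWithinAt_map hq).uniqueDiffWithinAt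
    (uniqueDiffOn_box h.T_pos h.U₀_pos q hq) hsurj.denseRange
  rwa [h.image_Υ] at this

theorem mapDeriv_chartDeriv (h : C.IsSolution S) {q : Pt d} (hq : q ∈ box d C.T C.U₀) (z : Pt d) :
    C.mapDeriv q (C.chartDeriv (C.Υ q) z) = z := by
  have hp := h.map_mem hq
  have h0 : HasFDerivWithinAt C.Υ (C.mapDeriv q) (box d C.T C.U₀) (C.chart (C.Υ q)) := by
    rw [h.chart_Υ q hq]; exact h.hasFDerivWithinAt_map hq
  have h1 := h0.comp (C.Υ q) (h.hasFDerivWithinAt_chart hp) fun z hz => h.chart_mem hz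
  have h2 : HasFDerivWithinAt (C.Υ ∘ C.chart) (ContinuousLinearMap.id ℝ (Pt d))
      C.region (C.Υ q) :=
    (hasFDerivWithinAt_id _ _).congr (fun z hz => h.map_chart hz) (h.map_chart hp)
  exact congrArg (fun l : Pt d →L[ℝ] Pt d => l z) ((h.uniqueDiffOn_region _ hp).eq h1 h2)

theorem der_map (h : C.IsSolution S) {f F : Pt d → ℝ} (hF : ContDiffOn ℝ ∞ F (box d C.T C.U₀))
    (hfF : ∀ q ∈ box d C.T C.U₀, f (C.Υ q) = F q) {q : Pt d} (hq : q ∈ box d C.T C.U₀)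
    (Z : Pt d → Pt d) :
    C.der f Z (C.Υ q) = fderivWithin ℝ F (box d C.T C.U₀) q (C.chartDeriv (C.Υ q) (Z (C.Υ q))) := by
  have hp := h.map_mem hq
  have h0 : HasFDerivWithinAt F (fderivWithin ℝ F (box d C.T C.U₀) q) (box d C.T C.U₀)
      (C.chart (C.Υ q)) := by
    rw [h.chart_Υ q hq]; exact ((hF.differentiableOn (by simp)) q hq).hasFDerivWithinAt
  have h1 := h0.comp (C.Υ q) (h.hasFDerivWithinAt_chart hp) fun z hz => h.chart_mem hz
  have h2 : ∀ p ∈ C.region, f p = F (C.chart p) := fun p hp => by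
    rw [← hfF _ (h.chart_mem hp), h.map_chart hp]
  have h3 := h1.congr (f₁ := f) h2 (h2 _ hp)
  rw [Config.der, h3.fderivWithin (h.uniqueDiffOn_region _ hp)]
  rfl

theorem chartDeriv_apply (h : C.IsSolution S) {p : Pt d} (hp : p ∈ C.region) (z : Pt d)
    (a : Fin (d + 2)) :
    C.chartDeriv p z a = fderivWithin ℝ (fun p => C.chart p a) C.region p z := by
  have h1 := (ContinuousLinearMap.proj a : Pt d →L[ℝ] ℝ).hasFDerivAt.comp_hasFDerivWithinAt p
    (h.hasFDerivWithinAt_chart hp)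
  exact (congrArg (fun l : Pt d →L[ℝ] ℝ => l z)
    (h1.fderivWithin (h.uniqueDiffOn_region p hp))).symm

theorem chartDeriv_zero (h : C.IsSolution S) {p : Pt d} (hp : p ∈ C.region) (z : Pt d) :
    C.chartDeriv p z 0 = z 0 := by
  rw [h.chartDeriv_apply hp]
  have h1 := (ContinuousLinearMap.proj 0 : Pt d →L[ℝ] ℝ).hasFDerivWithinAt (s := C.region) (x := p)
  exact congrArg (fun l : Pt d →L[ℝ] ℝ => l z) (h1.fderivWithin (h.uniqueDiffOn_region p hp))

theorem chartDeriv_one (h : C.IsSolution S) {p : Pt d} (hp : p ∈ C.region) (z : Pt d) :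
    C.chartDeriv p z 1 = fderivWithin ℝ C.u C.region p z :=
  h.chartDeriv_apply hp z 1

theorem torusPart_chartDeriv (h : C.IsSolution S) {p : Pt d} (hp : p ∈ C.region) (z : Pt d)
    (i : Fin d) :
    torusPart (C.chartDeriv p z) i = fderivWithin ℝ (fun p => C.ϑ p i) C.region p z :=
  h.chartDeriv_apply hp z i.succ.succ

theorem single_zero_eq : (Pi.single 0 1 : Pt d) = mkPt 1 0 0 :=
  pt_ext (by simp) (by simp) (by ext i; simp)

/-- `L t = 1`, `L u = 0` and `L ϑ = 0`. -/
theorem chartDeriv_vecL (h : C.IsSolution S) {p : Pt d} (hp : p ∈ C.region) :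
    C.chartDeriv p (C.vecL S p) = Pi.single 0 1 := by
  rw [single_zero_eq]
  refine pt_ext ?_ ?_ (funext fun i => ?_)
  · rw [h.chartDeriv_zero hp]; exact S.L_zero _ _
  · rw [h.chartDeriv_one hp]; exact h.eikonal p hp
  · rw [h.torusPart_chartDeriv hp]; exact h.torus p hp i

theorem vecX_eq (S : System d M) (C : Config d M) (p : Pt d) :
    C.vecX S p = -(C.μ p) • (C.vecL S p - Pi.single 0 1) := by
  funext a
  refine Fin.cases ?_ (fun j => ?_) a
  · simp [Config.vecX, Config.vecL, S.L_zero]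
  · simp [Config.vecX, Config.vecL]

/-- `X̆ t = 0`, and `X̆ u = -μ (L u - ∂_t u) = μ ∂_t u = 1`. -/
theorem chartDeriv_vecX (h : C.IsSolution S) {q : Pt d} (hq : q ∈ box d C.T C.U₀)
    (hμ : 0 < C.μ (C.Υ q)) :
    C.chartDeriv (C.Υ q) (C.vecX S (C.Υ q)) = mkPt 0 1 (C.shift S q) := by
  have hp := h.map_mem hq
  refine pt_ext ?_ ?_ rfl
  · rw [h.chartDeriv_zero hp]; rfl
  · rw [vecX_eq, map_smul, map_sub, h.chartDeriv_vecL hp]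
    have h1 : C.chartDeriv (C.Υ q) (Pi.single 0 1) 1 = C.pd 0 C.u (C.Υ q) :=
      h.chartDeriv_one hp _
    have h2 : C.μ (C.Υ q) * C.pd 0 C.u (C.Υ q) = 1 := by
      -- If `∂_t u` vanished, `μ = 1 / 0` would be `0`, against positivity.
      have h3 : C.pd 0 C.u (C.Υ q) ≠ 0 := by
        intro h0
        rw [Config.μ, h0] at hμ
        simp at hμ
      rw [Config.μ]
      field_simp
    simp [h1, h2]

theorem chartDeriv_vecΘ (h : C.IsSolution S) {q : Pt d} (hq : q ∈ box d C.T C.U₀) (i : Fin d) :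
    C.chartDeriv (C.Υ q) (C.vecΘ i (C.Υ q)) = Pi.single i.succ.succ 1 := by
  rw [Config.vecΘ, h.chart_Υ q hq]
  exact congrArg (fun l : Pt d →L[ℝ] Pt d => l (Pi.single i.succ.succ 1))
    (h.chartDeriv_comp_mapDeriv hq)

theorem chartDeriv_vecZ (h : C.IsSolution S) {q : Pt d} (hq : q ∈ box d C.T C.U₀)
    {a : Fin (d + 2)} (ha : a ≠ 1) :
    C.chartDeriv (C.Υ q) (C.vecZ S a (C.Υ q)) = Pi.single a 1 := by
  revert ha
  refine Fin.cases (fun _ => h.chartDeriv_vecL (h.map_mem hq)) (fun b => ?_) a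
  refine Fin.cases (fun hb => absurd rfl hb) (fun i _ => ?_) b
  exact h.chartDeriv_vecΘ hq i

theorem der_vecZ (h : C.IsSolution S) {f F : Pt d → ℝ} (hF : ContDiffOn ℝ ∞ F (box d C.T C.U₀))
    (hfF : ∀ q ∈ box d C.T C.U₀, f (C.Υ q) = F q) {q : Pt d} (hq : q ∈ box d C.T C.U₀)
    {a : Fin (d + 2)} (ha : a ≠ 1) :
    C.der f (C.vecZ S a) (C.Υ q) = boxPartial C.T C.U₀ a F q := by
  rw [h.der_map hF hfF hq, h.chartDeriv_vecZ hq ha, boxPartial]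

theorem der_vecX (h : C.IsSolution S) {f F : Pt d → ℝ} (hF : ContDiffOn ℝ ∞ F (box d C.T C.U₀))
    (hfF : ∀ q ∈ box d C.T C.U₀, f (C.Υ q) = F q) {q : Pt d} (hq : q ∈ box d C.T C.U₀)
    (hμ : 0 < C.μ (C.Υ q)) :
    C.der f (C.vecZ S 1) (C.Υ q) =
      fderivWithin ℝ F (box d C.T C.U₀) q (mkPt 0 1 (C.shift S q)) := by
  rw [h.der_map hF hfF hq]
  change fderivWithin ℝ F _ q (C.chartDeriv (C.Υ q) (C.vecX S (C.Υ q))) = _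
  rw [h.chartDeriv_vecX hq hμ]

/-- Bounds for all strings of length one, and for all strings of length two whose innermost
vectorfield is not `X̆`. -/
def StringBound (S : System d M) (C : Config d M) (K : ℝ) (f : Pt d → ℝ) : Prop :=
  ∀ p ∈ C.region, (∀ e, |C.string S [e] f p| ≤ K) ∧
    ∀ a, a ≠ 1 → ∀ e, |C.string S [e, a] f p| ≤ K

theorem contDiffOn_state (h : C.IsSolution S) : ContDiffOn ℝ ∞ C.state (box d C.T C.U₀) :=
  (h.smooth_Ψ.comp h.diffeo.1 fun _ hq => h.map_mem hq).prodMk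
    (h.smooth_v.comp h.diffeo.1 fun _ hq => h.map_mem hq)

theorem norm_prod_pi_le {K : ℝ} (hK : 0 ≤ K) {x : ℝ × (Fin M → ℝ)} (h1 : |x.1| ≤ K)
    (h2 : ∀ J, |x.2 J| ≤ K) : ‖x‖ ≤ K :=
  max_le h1 ((pi_norm_le_iff_of_nonneg hK).2 h2)

/-- The component `J` of `v`, as a linear functional of the pair of unknowns. -/
def sndProj (J : Fin M) : ℝ × (Fin M → ℝ) →L[ℝ] ℝ :=
  ContinuousLinearMap.proj J ∘L ContinuousLinearMap.snd ℝ ℝ (Fin M → ℝ)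

theorem norm_le_of_functionals {K : ℝ} (hK : 0 ≤ K) {x : ℝ × (Fin M → ℝ)}
    (h : ∀ l : ℝ × (Fin M → ℝ) →L[ℝ] ℝ,
      (l = ContinuousLinearMap.fst ℝ ℝ (Fin M → ℝ) ∨ ∃ J, l = sndProj J) → |l x| ≤ K) :
    ‖x‖ ≤ K :=
  norm_prod_pi_le hK (h _ (Or.inl rfl)) fun J => h _ (Or.inr ⟨J, rfl⟩)

section Bounds

variable {K : ℝ}

theorem exists_stringBound {l : ℝ × (Fin M → ℝ) →L[ℝ] ℝ}
    (hl : l = ContinuousLinearMap.fst ℝ ℝ (Fin M → ℝ) ∨ ∃ J, l = sndProj J)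
    (hΨ : StringBound S C K C.Ψ) (hv : ∀ J, StringBound S C K (fun p => C.v p J)) :
    ∃ f : Pt d → ℝ, (∀ q, f (C.Υ q) = l (C.state q)) ∧ StringBound S C K f := by
  rcases hl with rfl | ⟨J, rfl⟩
  · exact ⟨C.Ψ, fun _ => rfl, hΨ⟩
  · exact ⟨fun p => C.v p J, fun _ => rfl, hv J⟩

theorem norm_boxPartial_state_le (h : C.IsSolution S) (hK : 0 ≤ K)
    (hΨ : StringBound S C K C.Ψ) (hv : ∀ J, StringBound S C K (fun p => C.v p J)) {q : Pt d}
    (hq : q ∈ box d C.T C.U₀) {a : Fin (d + 2)}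
    (ha : a ≠ 1) : ‖boxPartial C.T C.U₀ a C.state q‖ ≤ K := by
  refine norm_le_of_functionals hK fun l hl => ?_
  obtain ⟨f, hf, hb⟩ := exists_stringBound hl hΨ hv
  rw [← boxPartial_clm h.T_pos h.U₀_pos h.contDiffOn_state l a hq,
    ← h.der_vecZ (contDiffOn_clm_apply l h.contDiffOn_state) (fun q _ => hf q) hq ha]
  exact (hb _ (h.map_mem hq)).1 a

theorem norm_shift_state_le (h : C.IsSolution S) (hμ : ∀ p ∈ C.region, 0 < C.μ p) (hK : 0 ≤ K)
    (hΨ : StringBound S C K C.Ψ) (hv : ∀ J, StringBound S C K (fun p => C.v p J)) {q : Pt d}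
    (hq : q ∈ box d C.T C.U₀) :
    ‖fderivWithin ℝ C.state (box d C.T C.U₀) q (mkPt 0 1 (C.shift S q))‖ ≤ K := by
  refine norm_le_of_functionals hK fun l hl => ?_
  obtain ⟨f, hf, hb⟩ := exists_stringBound hl hΨ hv
  have hp := h.map_mem hq
  rw [← fderivWithin_clm_apply h.T_pos h.U₀_pos h.contDiffOn_state l hq,
    ← h.der_vecX (contDiffOn_clm_apply l h.contDiffOn_state) (fun q _ => hf q) hq (hμ _ hp)]
  exact (hb _ hp).1 1

theorem norm_boxPartial_boxPartial_state_le (h : C.IsSolution S) (hK : 0 ≤ K)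
    (hΨ : StringBound S C K C.Ψ) (hv : ∀ J, StringBound S C K (fun p => C.v p J)) {q : Pt d}
    (hq : q ∈ box d C.T C.U₀)
    {a e : Fin (d + 2)} (ha : a ≠ 1) (he : e ≠ 1) :
    ‖boxPartial C.T C.U₀ e (boxPartial C.T C.U₀ a C.state) q‖ ≤ K := by
  refine norm_le_of_functionals hK fun l hl => ?_
  obtain ⟨f, hf, hb⟩ := exists_stringBound hl hΨ hv
  have hs := h.contDiffOn_state
  have hsa := contDiffOn_boxPartial h.T_pos h.U₀_pos hs a
  have h1 : ∀ q ∈ box d C.T C.U₀,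
      C.der f (C.vecZ S a) (C.Υ q) = l (boxPartial C.T C.U₀ a C.state q) := fun q hq => by
    rw [← boxPartial_clm h.T_pos h.U₀_pos hs l a hq,
      ← h.der_vecZ (contDiffOn_clm_apply l hs) (fun q _ => hf q) hq ha]
  rw [← boxPartial_clm h.T_pos h.U₀_pos hsa l e hq,
    ← h.der_vecZ (contDiffOn_clm_apply l hsa) h1 hq he]
  exact (hb _ (h.map_mem hq)).2 a ha e

theorem norm_shift_boxPartial_state_le (h : C.IsSolution S)
    (hμ : ∀ p ∈ C.region, 0 < C.μ p) (hK : 0 ≤ K)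
    (hΨ : StringBound S C K C.Ψ) (hv : ∀ J, StringBound S C K (fun p => C.v p J)) {q : Pt d}
    (hq : q ∈ box d C.T C.U₀)
    {a : Fin (d + 2)} (ha : a ≠ 1) :
    ‖fderivWithin ℝ (boxPartial C.T C.U₀ a C.state) (box d C.T C.U₀) q
      (mkPt 0 1 (C.shift S q))‖ ≤ K := by
  refine norm_le_of_functionals hK fun l hl => ?_
  obtain ⟨f, hf, hb⟩ := exists_stringBound hl hΨ hv
  have hs := h.contDiffOn_state
  have hsa := contDiffOn_boxPartial h.T_pos h.U₀_pos hs a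
  have hp := h.map_mem hq
  have h1 : ∀ q ∈ box d C.T C.U₀,
      C.der f (C.vecZ S a) (C.Υ q) = l (boxPartial C.T C.U₀ a C.state q) := fun q hq => by
    rw [← boxPartial_clm h.T_pos h.U₀_pos hs l a hq,
      ← h.der_vecZ (contDiffOn_clm_apply l hs) (fun q _ => hf q) hq ha]
  rw [← fderivWithin_clm_apply h.T_pos h.U₀_pos hsa l hq,
    ← h.der_vecX (contDiffOn_clm_apply l hsa) h1 hq (hμ _ hp)]
  exact (hb _ hp).2 a ha 1

end Bounds

/-! ### Initial values and equivariance of the change of variables map. -/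

theorem map_zero_eq (h : C.IsSolution S) {q : Pt d} (hq : q ∈ box d C.T C.U₀) : C.Υ q 0 = q 0 :=
  congrFun (h.chart_Υ q hq) 0

theorem map_initial (h : C.IsSolution S) {q : Pt d} (hq : q ∈ box d C.T C.U₀) (h0 : q 0 = 0) :
    C.Υ q = mkPt 0 (1 - q 1) (torusPart q) := by
  have hc := h.chart_Υ q hq
  have e0 : C.Υ q 0 = 0 := (h.map_zero_eq hq).trans h0
  have e1 : C.u (C.Υ q) = q 1 := congrFun hc 1
  rw [h.eikonal_init _ e0] at e1
  refine pt_ext e0 (by rw [mkPt_one]; linarith) (funext fun i => ?_)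
  have e2 : C.ϑ (C.Υ q) i = q i.succ.succ := congrFun hc i.succ.succ
  rw [h.torus_init _ (h.map_mem hq) e0] at e2
  exact e2

theorem add_mkPt_mem_box {T U : ℝ} {q : Pt d} (hq : q ∈ box d T U) (θ : Fin d → ℝ) :
    q + mkPt 0 0 θ ∈ box d T U := by
  simpa [box] using hq

/-- Since `Υ` descends to the torus, a lattice translation by `k` changes `Υ` by some lattice
vector. Along a time line this vector is continuous and integer-valued, hence constant, and at `t =
0` it equals `k`. -/
theorem map_equivariant (h : C.IsSolution S) {q : Pt d} (hq : q ∈ box d C.T C.U₀)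
    (k : Fin d → ℤ) :
    C.Υ (q + mkPt 0 0 fun i => (k i : ℝ)) = C.Υ q + mkPt 0 0 fun i => (k i : ℝ) := by
  set κ : Pt d := mkPt 0 0 fun i => (k i : ℝ) with hκ
  have hint : ∀ q ∈ box d C.T C.U₀, ∃ m : Fin d → ℤ,
      C.Υ (q + κ) = C.Υ q + mkPt 0 0 fun i => (m i : ℝ) := by
    intro q hq
    refine IsStackedGraphMap.proj_eq_iff.1 ((h.diffeo.2.1 _ (add_mkPt_mem_box hq _) _ hq).2 ?_)
    exact IsStackedGraphMap.proj_eq_iff.2 ⟨k, rfl⟩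
  have hqc := box_subset_closedBox hq
  obtain ⟨m, hm⟩ := hint q hq
  have hmem : ∀ t ∈ Icc 0 (q 0), Function.update q 0 t ∈ box d C.T C.U₀ :=
    fun t ht => update_mem_box hqc ⟨ht.1, ht.2.trans_lt hq.2.1⟩
  have key : ∀ i, (m i : ℝ) = k i := by
    intro i
    set g : ℝ → ℝ := fun t => C.Υ (Function.update q 0 t + κ) i.succ.succ -
      C.Υ (Function.update q 0 t) i.succ.succ with hg
    have hu : Continuous fun t : ℝ => Function.update q 0 t :=
      continuous_const.update 0 continuous_id
    have hΥ : ContinuousOn (fun q => C.Υ q i.succ.succ) (box d C.T C.U₀) :=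
      continuousOn_pi.1 h.diffeo.1.continuousOn _
    have hgc : ContinuousOn g (Icc 0 (q 0)) :=
      (hΥ.comp (hu.add continuous_const).continuousOn
        fun t ht => add_mkPt_mem_box (hmem t ht) _).sub (hΥ.comp hu.continuousOn hmem)
    have hgm : MapsTo g (Icc 0 (q 0)) (range ((↑) : ℤ → ℝ)) := by
      intro t ht
      obtain ⟨m', hm'⟩ := hint _ (hmem t ht)
      exact ⟨m' i, by simp [hg, hm']⟩
    have hdisc := Int.isClosedEmbedding_coe_real.isEmbedding.isDiscrete_range
    have hconst := isPreconnected_Icc.constant_of_mapsTo hdisc hgc hgm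
      (left_mem_Icc.2 hq.1) (right_mem_Icc.2 hq.1)
    have e0 : g 0 = k i := by
      have h0 := hmem 0 (left_mem_Icc.2 hq.1)
      simp only [hg, hκ]
      rw [h.map_initial (add_mkPt_mem_box h0 _) (by simp), h.map_initial h0 (by simp)]
      simp
    have e1 : g (q 0) = m i := by
      simp only [hg, hκ]
      rw [Function.update_eq_self, hm]
      simp
    rw [← e1, ← hconst, e0]
  rw [hm, hκ]
  simp only [key]

end Config.IsSolution

/-- The vectorfield `L` as a function of the pair of unknowns. -/
def System.vecField (S : System d M) (x : ℝ × (Fin M → ℝ)) : Pt d := fun α => S.L α x.1 x.2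

theorem System.contDiff_vecField (S : System d M) : ContDiff ℝ ∞ S.vecField :=
  contDiff_pi.2 S.smooth_L

/-- Near the trivial background, `L¹` is bounded below and `L` is bounded. -/
theorem System.exists_vecField_bound (S : System d M) : ∃ r > 0, ∃ Λ ≥ 1,
    ∀ x, ‖x‖ < r → ‖S.vecField x‖ ≤ Λ ∧ 1 / 2 ≤ S.vecField x 1 := by
  have hc := S.contDiff_vecField.continuous
  have h0 : S.vecField 0 1 = 1 := S.L_one
  have h1 : ∀ᶠ x in 𝓝 (0 : ℝ × (Fin M → ℝ)), ‖S.vecField x‖ < ‖S.vecField 0‖ + 1 :=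
    (hc.norm.tendsto 0).eventually_lt_const (by linarith)
  have h2 : ∀ᶠ x in 𝓝 (0 : ℝ × (Fin M → ℝ)), 1 / 2 < S.vecField x 1 :=
    (((continuous_apply 1).comp hc).tendsto 0).eventually_const_lt (by
      simp only [Function.comp_apply, h0]; norm_num)
  obtain ⟨r, hr, hball⟩ := Metric.eventually_nhds_iff.1 (h1.and h2)
  refine ⟨r, hr, ‖S.vecField 0‖ + 1, by linarith [norm_nonneg (S.vecField 0)], fun x hx => ?_⟩
  have := hball (y := x) (by rwa [dist_zero_right])
  exact ⟨this.1.le, this.2.le⟩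

/-! ### From the bootstrap assumptions to control of the flow. -/

namespace Config.Bootstrap

variable {α ε₀ A ε : ℝ} {Nmid : ℕ}

theorem abs_le_of_boundedBy {f : Pt d → ℝ} {B : ℝ} (hU : 0 ≤ C.U₀)
    (hf : ∀ t ∈ Ico 0 C.T, ∀ u ∈ Icc 0 C.U₀, C.BoundedBy f t u B) {p : Pt d}
    (hp : p ∈ C.region) : |f p| ≤ B :=
  hf (p 0) ⟨hp.1, hp.2.1⟩ C.U₀ (right_mem_Icc.2 hU) p (C.mem_slice hp)

theorem abs_string_v_le (h : C.IsSolution S) (hB : C.Bootstrap S α ε₀ A ε Nmid) (J : Fin M)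
    {w : List (Fin (d + 2))} (hw : StrZ w) (hN : w.length ≤ Nmid - 1) {p : Pt d}
    (hp : p ∈ C.region) : |C.string S w (fun p => C.v p J) p| ≤ √ε := by
  have h1 := (le_abs_self _).trans (abs_le_of_boundedBy h.U₀_pos.le hB.aux_v hp)
  refine le_trans ?_ h1
  refine (Config.abs_string_le_stringSum w hw (Nat.zero_le _) hN _ p).trans ?_
  refine Finset.single_le_sum (f := fun J => C.stringSum S StrZ 0 (Nmid - 1) (fun p => C.v p J) p)
    (fun J _ => ?_) (Finset.mem_univ J)
  exact (abs_nonneg _).trans (Config.abs_string_le_stringSum [] (by simp [StrZ]) (Nat.zero_le _)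
    (Nat.zero_le _) _ p)

theorem stringBound_v (h : C.IsSolution S) (hB : C.Bootstrap S α ε₀ A ε Nmid) (hN : 3 ≤ Nmid)
    (J : Fin M) : Config.IsSolution.StringBound S C (√ε) (fun p => C.v p J) := by
  refine fun p hp => ⟨fun e => ?_, fun a ha e => ?_⟩
  · refine abs_string_v_le h hB J ?_ (by simp; omega) hp
    exact List.count_le_length
  · refine abs_string_v_le h hB J ?_ (by simp; omega) hp
    rw [StrZ, List.count_cons, List.count_singleton]
    simp [ha]
    split_ifs <;> simp

theorem stringBound_Ψ (h : C.IsSolution S) (hB : C.Bootstrap S α ε₀ A ε Nmid) (hN : 3 ≤ Nmid)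
    (hA : 0 < A) : Config.IsSolution.StringBound S C (A + √ε) C.Ψ := by
  have h1 : ∀ w : List (Fin (d + 2)), StrZStar w → 1 ≤ w.length → w.length ≤ Nmid →
      ∀ p ∈ C.region, |C.string S w C.Ψ p| ≤ A + √ε := by
    intro w hw h1 h2 p hp
    have h3 := (le_abs_self _).trans (abs_le_of_boundedBy h.U₀_pos.le hB.aux_ZΨ hp)
    have h4 := C.abs_string_le_stringSum (S := S) w hw h1 h2 C.Ψ p
    linarith
  refine fun p hp => ⟨fun e => ?_, fun a ha e => ?_⟩
  -- The single letter `X̆` is not a string of type `StrZStar`; it has its own bound, of size `A`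
  -- instead of `√ε`.
  · by_cases he : e = 1
    · rw [he]
      exact abs_le_of_boundedBy h.U₀_pos.le hB.aux_XΨ hp
    · exact h1 [e] ⟨List.count_le_length, e, by simp, he⟩ (by simp) (by simp; omega) p hp
  · refine h1 [e, a] ⟨?_, a, by simp, ha⟩ (by simp) (by simp; omega) p hp
    rw [List.count_cons, List.count_singleton]
    simp [ha]
    split_ifs <;> simp

theorem le_μ (h : C.IsSolution S) (hB : C.Bootstrap S α ε₀ A ε Nmid) {p : Pt d}
    (hp : p ∈ C.region) :
    sInf ((fun z : ℝ × ℝ => C.μStar z.1 z.2) '' (Ico 0 C.T ×ˢ Icc 0 C.U₀)) ≤ C.μ p := by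
  have hpos : ∀ t ∈ Ico 0 C.T, ∀ u ∈ Icc 0 C.U₀, ∀ p ∈ C.slice t u, 0 ≤ C.μ p := by
    intro t ht u hu p hp
    refine (hB.μ_pos p ⟨?_, ?_, hp.2.1, hp.2.2.trans hu.2⟩).le
    · rw [hp.1]; exact ht.1
    · rw [hp.1]; exact ht.2
  have ht : p 0 ∈ Ico 0 C.T := ⟨hp.1, hp.2.1⟩
  have hu : C.U₀ ∈ Icc 0 C.U₀ := right_mem_Icc.2 h.U₀_pos.le
  have hmem : C.μStar (p 0) C.U₀ ∈
      (fun z : ℝ × ℝ => C.μStar z.1 z.2) '' (Ico 0 C.T ×ˢ Icc 0 C.U₀) :=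
    ⟨(p 0, C.U₀), ⟨ht, hu⟩, rfl⟩
  refine (csInf_le ⟨0, ?_⟩ hmem).trans ?_
  · rintro _ ⟨⟨t, u⟩, ⟨ht, hu⟩, rfl⟩
    -- The real infimum is meaningful only for sets bounded below; positivity of `μ` supplies the
    -- bound `0`. An empty slice would have infimum `0`.
    exact Real.sInf_nonneg (by rintro _ ⟨p, hp, rfl⟩; exact hpos t ht u hu p hp)
  · refine csInf_le ⟨0, ?_⟩ (mem_image_of_mem _ (C.mem_slice hp))
    rintro _ ⟨p', hp', rfl⟩
    exact hpos _ ht _ hu p' hp'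

theorem abs_torus_sub_le (h : C.IsSolution S) (hB : C.Bootstrap S α ε₀ A ε Nmid) {q : Pt d}
    (hq : q ∈ box d C.T C.U₀) (i : Fin d) (j : Fin (d + 1)) :
    |boxPartial C.T C.U₀ i.succ.succ C.Υ q j.succ - if j = i.succ then 1 else 0| ≤ √ε := by
  have hp := h.map_mem hq
  have h1 := (le_abs_self _).trans
    (abs_le_of_boundedBy h.U₀_pos.le (fun t ht u hu => hB.aux_Θ t ht u hu i j) hp)
  have h2 := (C.abs_string_le_stringSum (S := S) (P := StrZ) (m := 0) (N := Nmid - 1) []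
    (by simp [StrZ]) le_rfl (Nat.zero_le _) (C.ΘSmall i j) (C.Υ q)).trans h1
  have e : C.ΘSmall i j (C.Υ q) =
      boxPartial C.T C.U₀ i.succ.succ C.Υ q j.succ - if j = i.succ then 1 else 0 := by
    rw [Config.ΘSmall, Config.vecΘ, h.chart_Υ q hq, boxPartial]
  rw [← e]
  exact h2

theorem flowControl (h : C.IsSolution S) (hB : C.Bootstrap S α ε₀ A ε Nmid) (hN : 3 ≤ Nmid)
    (hA : 0 < A) {r Λ : ℝ} (hΛ : 1 ≤ Λ)
    (hr : ∀ x, ‖x‖ < r → ‖S.vecField x‖ ≤ Λ ∧ 1 / 2 ≤ S.vecField x 1)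
    (hαr : α + √ε < r) (hεr : √ε < r) (hsmall : 2 * (d * √ε) * Λ ≤ 1 / 4)
    (hμ : 0 < sInf ((fun z : ℝ × ℝ => C.μStar z.1 z.2) '' (Ico 0 C.T ×ˢ Icc 0 C.U₀))) :
    ∃ c K, FlowControl C.T C.U₀ C.Υ C.state (C.shift S) (fun q => C.μ (C.Υ q)) S.vecField
      c (√ε) Λ K := by
  have hr0 : 0 < r := (Real.sqrt_nonneg ε).trans_lt hεr
  have hstate : ∀ q ∈ box d C.T C.U₀, ‖C.state q‖ < r := by
    intro q hq
    have hp := h.map_mem hq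
    refine max_lt ((abs_le_of_boundedBy h.U₀_pos.le hB.aux_Ψ hp).trans_lt hαr)
      ((pi_norm_lt_iff hr0).2 fun J => ?_)
    exact (abs_string_v_le h hB J (w := []) (by simp [StrZ]) (Nat.zero_le _) hp).trans_lt hεr
  set m := 1 + 2 * (C.AStar S)⁻¹ *
    C.supNorm (fun p => C.blowupCoeff S p * C.der C.Ψ (C.vecX S) p) 0 C.U₀ + √α + √ε with hm
  -- The summands dominate, in order, the state, the string bounds of `Ψ` and `v`, and `μ`.
  set K := r + (A + √ε) + |m| with hK
  have hs0 := Real.sqrt_nonneg ε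
  have hm0 := abs_nonneg m
  have hK0 : 0 ≤ K := by linarith
  have hΨ : IsSolution.StringBound S C K C.Ψ := fun p hp =>
    ⟨fun e => ((stringBound_Ψ h hB hN hA p hp).1 e).trans (by linarith),
      fun a ha e => ((stringBound_Ψ h hB hN hA p hp).2 a ha e).trans (by linarith)⟩
  have hv : ∀ J, IsSolution.StringBound S C K (fun p => C.v p J) := fun J p hp =>
    ⟨fun e => ((stringBound_v h hB hN J p hp).1 e).trans (by linarith),
      fun a ha e => ((stringBound_v h hB hN J p hp).2 a ha e).trans (by linarith)⟩
  have hμ' := hB.μ_pos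
  -- The lower bound `c` for `μ` is the infimum of `μ_⋆`.
  exact ⟨_, K, {
    T_pos := h.T_pos
    U_pos := h.U₀_pos
    c_pos := hμ
    smooth_Υ := h.diffeo.1
    smooth_s := h.contDiffOn_state
    smooth_ℓ := S.contDiff_vecField
    flow := fun q hq => by
      have h1 := h.mapDeriv_chartDeriv hq (C.vecL S (C.Υ q))
      rw [h.chartDeriv_vecL (h.map_mem hq)] at h1
      exact h1
    time_eq := fun q hq => h.map_zero_eq hq
    transport := fun q hq => by
      have h1 := h.mapDeriv_chartDeriv hq (C.vecX S (C.Υ q))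
      rw [h.chartDeriv_vecX hq (hμ' _ (h.map_mem hq)), IsSolution.vecX_eq] at h1
      exact h1
    bound_s := fun q hq => (hstate q hq).le.trans (by linarith)
    bound_ds := fun q hq a ha => h.norm_boxPartial_state_le hK0 hΨ hv hq ha
    bound_Xs := fun q hq => h.norm_shift_state_le hμ' hK0 hΨ hv hq
    bound_dds := fun q hq a ha e he =>
      h.norm_boxPartial_boxPartial_state_le hK0 hΨ hv hq ha he
    bound_Xds := fun q hq a ha => h.norm_shift_boxPartial_state_le hμ' hK0 hΨ hv hq ha
    le_m := fun q hq => le_μ h hB (h.map_mem hq)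
    m_le := fun q hq => by
      have h1 : |C.μ (C.Υ q)| ≤ m := hB.aux_μ (C.Υ q 0) ⟨(h.map_mem hq).1, (h.map_mem hq).2.1⟩
        C.U₀ (right_mem_Icc.2 h.U₀_pos.le) _ (C.mem_slice (h.map_mem hq))
      have h2 := le_abs_self (C.μ (C.Υ q))
      have h3 := le_abs_self m
      linarith
    torus := fun q hq i j => abs_torus_sub_le h hB hq i j
    bound_ℓ := fun q hq => (hr _ (hstate q hq)).1
    ℓ_one := fun q hq => (hr _ (hstate q hq)).2
    -- Follows from `hsmall`, since `Λ ≥ 1`.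
    small := by
      have : 0 ≤ 2 * (d * √ε) := by positivity
      nlinarith
    small_mul := hsmall
    initial := fun q hq h0 => h.map_initial hq h0
    equivariant := fun q hq k => h.map_equivariant hq k }⟩

end Config.Bootstrap

theorem isSmallnessScale_id : IsSmallnessScale id :=
  ⟨continuousOn_id, strictMonoOn_id, fun _ hs => hs⟩

end Solution

end

end ShockFormation

open ShockFormation in
theorem proposition7p3 {d M : ℕ} (S : System d M) (Ntop Nmid : ℕ)
    (hNtop : (d + 1) + 5 ≤ Ntop) (hNmid : Nmid = (Ntop + 1) / 2 + 1) :
    ∃ α₀ > (0 : ℝ), ∃ ε₁ > (0 : ℝ), ∃ f g : ℝ → ℝ, IsSmallnessScale f ∧ IsSmallnessScale g ∧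
      ∀ (α ε₀ A ε : ℝ), 0 < α → 0 ≤ ε₀ → 0 < A → 0 < ε →
        α < α₀ → ε₀ ≤ ε → ε < α → ε < ε₁ → ε < f A⁻¹ →
      ∀ C : Config d M, 0 < C.AStar S → ε < g (C.AStar S) →
        C.IsSolution S → C.Bootstrap S α ε₀ A ε Nmid →
        0 < sInf ((fun z : ℝ × ℝ => C.μStar z.1 z.2) '' (Set.Ico 0 C.T ×ˢ Set.Icc 0 C.U₀)) →
        ∃ Υ' : Pt d → Pt d,
          Set.EqOn Υ' C.Υ (box d C.T C.U₀) ∧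
          IsDiffeoOntoImage 1 Υ' (closedBox d C.T C.U₀) ∧
          ∀ β : Fin (d + 2),
            (InCZeroWOneInfty C.T C.U₀ (fun q => Υ' q β) ∧
              InCOneLInfty C.T C.U₀ (fun q => Υ' q β)) ∧
            ∀ i : Fin d,
              InCZeroWOneInfty C.T C.U₀ (fun q => fderivWithin ℝ Υ' (closedBox d C.T C.U₀) q
                (Pi.single i.succ.succ 1) β) ∧
              InCOneLInfty C.T C.U₀ (fun q => fderivWithin ℝ Υ' (closedBox d C.T C.U₀) q
                (Pi.single i.succ.succ 1) β) := by
  obtain ⟨r, hr0, Λ, hΛ, hr⟩ := S.exists_vecField_bound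
  have hden : 0 < 8 * ((d : ℝ) + 1) * Λ := by positivity
  -- With `α < r / 2`, the first entry keeps `(Ψ, v)` in the ball where `L` is controlled. The
  -- second gives `2 d √ε Λ ≤ 1/4`; `d + 1` keeps the denominator positive for `d = 0`. The
  -- threshold for `ε` is `δ ^ 2` because the bounds involve `√ε`.
  set δ := min (r / 2) (1 / (8 * ((d : ℝ) + 1) * Λ)) with hδ
  have hδ0 : 0 < δ := lt_min (by linarith) (by positivity)
  refine ⟨r / 2, by linarith, δ ^ 2, by positivity, id, id, isSmallnessScale_id,
    isSmallnessScale_id, ?_⟩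
  intro α ε₀ A ε _ _ hA _ hα _ _ hε _ C _ _ hsol hB hμ
  have hsε : √ε < δ := (Real.sqrt_lt' hδ0).2 hε
  have h1 : √ε < r / 2 := hsε.trans_le (min_le_left _ _)
  have h2 : √ε ≤ 1 / (8 * ((d : ℝ) + 1) * Λ) := hsε.le.trans (min_le_right _ _)
  have h3 : √ε * (8 * ((d : ℝ) + 1) * Λ) ≤ 1 := (le_div_iff₀ hden).1 h2
  have hsmall : 2 * (d * √ε) * Λ ≤ 1 / 4 := by
    have : 0 ≤ √ε * Λ := by positivity
    nlinarith
  -- `Ntop ≥ 6` forces `Nmid ≥ 4`, so strings of length two are covered by `Nmid - 1`.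
  obtain ⟨c, K, hF⟩ := Config.Bootstrap.flowControl hsol hB (by omega) hA hΛ hr (by linarith)
    (by linarith) hsmall hμ
  exact hF.exists_extension
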